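/- \textbf{Setting.} Let $(X_t)_{t\in\mathbb Z}$ be a strictly stationary real-valued time series with continuous marginal c.d.f. $F$; put $U_s=F(X_s)$, $M_{1:n}=\max(X_1,\dots,X_n)$, $u_n(\tau)=\inf\{x:F(x)\ge 1-\tau/n\}$ and $N_n^{(\tau)}(B)=\sum_{t=1}^n 1(t/n\in B,\ X_t>u_n(\tau))$ for $B\subset E=(0,1]$. Let $\theta\in(0,1]$, let $\pi$ be a probability distribution on $\{1,2,\dots\}$ and $\pi_2^{(\sigma)}$, $\sigma\in[0,1]$, probability distributions on $\{(i,j):i\ge j\ge 0,\ i\ge1\}$. With $\ast k$ denoting $k$-fold convolution, let $p^{(\tau)}(0)=e^{-\theta\tau}$, $p^{(\tau)}(m)=\sum_{k=1}^m e^{-\theta\tau}\frac{(\theta\tau)^k}{k!}\pi^{\ast k}(m)$ for $m\ge1$; and, for $\tau_1\ge\tau_2\ge0$, $p_2^{(\tau_1,\tau_2)}(0,0)=e^{-\theta\tau_1}$, $p_2^{(\tau_1,\tau_2)}(i,j)=0$ for $i<j$, and $p_2^{(\tau_1,\tau_2)}(i,j)=e^{-\theta\tau_1}\sum_{k=1}^i\frac{(\theta\tau_1)^k}{k!}\pi_2^{(\tau_2/\tau_1),\ast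 k}(i,j)$ for $i\ge j\ge0$, $i\ge1$. Let $H$ be the $\mathrm{Exp}(\theta)$ distribution and $\bar p(m)=\int_0^\infty p^{(\tau)}(m)\,dH(\tau)$. Let $b_n\to\infty$ be integers (block lengths) with $b_n=o(n)$, and $k_n=\lfloor n/b_n\rfloor$. For $\varepsilon>0$ let $\alpha_\varepsilon(\ell)$ and $\beta_\varepsilon(\ell)$ be the suprema over $k\ge1$ of the $\alpha$- and $\beta$-mixing coefficients between the $\sigma$-algebras generated by $U_s1(U_s>1-\varepsilon)$ with $1\le s\le k$ and with $s\ge k+\ell$, respectively. Assume: (i) $(X_t)$ has extremal index $\theta$, i.e. for every $\tau>0$ there are $u_n$ with $n(1-F(u_n))\to\tau$ and $P(M_{1:n}\le u_n)\to e^{-\theta\tau}$; for every $\tau>0$ the point process $N_n^{(\tau)}$ on $E$ converges in distribution to the compound Poisson process with intensity $\theta\tau$ and compounding distribution $\pi$; and for all $\tau_1\ge\tau_2\ge0$, $\tau_1>0$, the two-level point process $(N_n^{(\tau_1)},N_n^{(\tau_2)})$ converges in distribution to the two-level compound Poisson process with intensity $\theta\tau_1$ and compounding distribution $\pi_2^{(\tau_2/\tau_1)}$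 (independent pairs of counts on disjoint intervals $I$, with mass function $p_2^{(|I|\tau_1,|I|\tau_2)}$). (ii) For some $\varepsilon_1\in(0,1)$, $\eta>2$, $C>0$: $\alpha_{\varepsilon_1}(n)\le Cn^{-\eta}$ for all $n\ge1$, $k_n=o(b_n^\eta)$, and there are $\ell_n\to\infty$ with $\ell_n=o(b_n)$ and $k_n\alpha_{\varepsilon_1}(\ell_n)\to0$. (iii) For some $c>1-\varepsilon_1$, $P\big(\min_{1\le i\le 2k_n}\max\{U_s:(i-1)b_n/2+1\le s\le ib_n/2\}\le c\big)\to0$. (iv) For every $j\ge1$, $E[\varphi_{n,j}(Z_{1:b_n})]=\bar p(j)+o(k_n^{-1/2})$, where $\varphi_{n,j}(z)=P(N_{b_n}^{(z)}(E)=j)$ and $Z_{1:b_n}=b_n(1-F(M_{1:b_n}))$. (v) $\sqrt{k_n}\,\beta_{\varepsilon_2}(b_n)\to0$ for some $\varepsilon_2>0$. \textbf{The matrices.} The following numbers $d_{j,j'}^{db}$ and $d_{j,j'}^{sb}$ are the asymptotic covariances in the central limit theorems, at rate $\sqrt{k_n}$, for the disjoint-blocks (db) and the sliding-blocks (sb)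 estimators of $\bar p(j)$; here they are defined by formulas. Let $N_E^{(\tau)}\sim p^{(\tau)}$ and $Z\sim H$ satisfy $P(N_E^{(\tau)}=j,Z>\mu)=p_2^{(\tau,\mu)}(j,0)$ if $\tau\ge\mu$ and $=e^{-\theta\mu}1(j=0)$ if $\tau<\mu$, and $P(N_E^{(\tau)}=j,N_E^{(\tau')}=j')=p_2^{(\tau,\tau')}(j,j')$ if $\tau\ge\tau'$ and $=p_2^{(\tau',\tau)}(j',j)$ if $\tau<\tau'$. Put $$d^{db}_{j,j'}=\int_0^\infty\!\!\int_0^\infty \mathrm{Cov}\big(1(N_E^{(\tau)}=j)+p^{(Z)}(j),\,1(N_E^{(\tau')}=j')+p^{(Z)}(j')\big)\,dH(\tau)\,dH(\tau').$$ (The covariance is expanded bilinearly and so depends on the laws of pairs only.) Further, $$d^{sb}_{j,j'}=2\int_0^1\Big\{\int_0^\infty\!\!\int_0^\infty \mathrm{Cov}\big(1(X_{1,\xi}^{(\tau)}=j),1(Y_{1,\xi}^{(\tau')}=j')\big)dH(\tau)dH(\tau')+\int_0^\infty\mathrm{Cov}\big(1(X_{3,\xi}^{(\tau)}=j),p^{(Y_{3,\xi})}(j')\big)dH(\tau)$$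 $$\qquad+\int_0^\infty\mathrm{Cov}\big(1(X_{3,\xi}^{(\tau)}=j'),p^{(Y_{3,\xi})}(j)\big)dH(\tau)+\mathrm{Cov}\big(p^{(X_{2,\xi})}(j),p^{(Y_{2,\xi})}(j')\big)\Big\}\,d\xi,$$ where, for $x,y>0$, $$P(X_{1,\xi}^{(\tau)}=j,Y_{1,\xi}^{(\tau')}=j')=\sum_{l=0}^j\sum_{r=j-l}^{j'}p^{(\xi\tau)}(l)\,p^{(\xi\tau')}(j'-r)\,p_2^{((1-\xi)\tau',(1-\xi)\tau)}(r,j-l)\quad\text{for }\tau\le\tau',$$ and for $\tau>\tau'$ the same expression with $(\tau,j)$ and $(\tau',j')$ interchanged; $$P(X_{2,\xi}>x,Y_{2,\xi}>y)=\exp(-\theta\{(x\wedge y)\xi+(x\vee y)\}),$$ $$P(X_{3,\xi}^{(\tau)}=j,Y_{3,\xi}>x)=e^{-\theta\xi x}\sum_{l=0}^jp^{(\xi\tau)}(l)\,p_2^{((1-\xi)\tau,(1-\xi)x)}(j-l,0)\,1(x\le\tau)+e^{-\theta x}p^{(\tau\xi)}(j)\,1(x>\tau).$$ For $\mathrm{mb}\in\{db,sb\}$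 let $\Sigma_m^{mb}=(d^{mb}_{j,j'})_{1\le j,j'\le m}$ and $\Gamma_m^{mb}=A_m\Sigma_m^{mb}A_m^\top$, where $A_m\in\mathbb R^{m\times m}$ is the matrix with $(v_1,\dots,v_m)^\top=A_m(s_1,\dots,s_m)^\top$ for the recursion $v_j=4s_j-2\sum_{k=1}^{j-1}\pi(j-k)s_k-2\sum_{k=1}^{j-1}\bar p(j-k)v_k$; $\Gamma_m^{mb}$ is the asymptotic covariance matrix of the corresponding estimators of $\pi(1),\dots,\pi(m)$. \textbf{Theorem.} For every $m$ the matrices $\Sigma_m^{sb}$ and $\Sigma_m^{db}$ are symmetric positive semidefinite, and $$\Sigma_m^{sb}\le_L\Sigma_m^{db}\quad\text{and}\quad\Gamma_m^{sb}\le_L\Gamma_m^{db}$$ in the Loewner order. In particular, if $(s_1^{mb},\dots,s_m^{mb})\sim\mathcal N_m(0,\Sigma_m^{mb})$ and $(v_1^{mb},\dots,v_m^{mb})\sim\mathcal N_m(0,\Gamma_m^{mb})$ denote the Gaussian limits, then $\mathrm{Var}(s_j^{sb})\le\mathrm{Var}(s_j^{db})$ and $\mathrm{Var}(v_j^{sb})\le\mathrm{Var}(v_j^{db})$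 for all $1\le j\le m$. -/

import Mathlib

open MeasureTheory ProbabilityTheory Filter Topology
open scoped ENNReal Matrix

noncomputable section

namespace SlidingBlocks

/-! ### Compound Poisson counts -/

/-- `k`-fold convolution of a mass function on `ℕ`. -/
def convPow (f : ℕ → ℝ) : ℕ → ℕ → ℝ
  | 0, i => if i = 0 then 1 else 0
  | k + 1, i => ∑ a ∈ Finset.HasAntidiagonal.antidiagonal i, convPow f k a.1 * f a.2

/-- `k`-fold convolution of a mass function on `ℕ × ℕ`. -/
def convPow₂ (f : ℕ → ℕ → ℝ) : ℕ → ℕ → ℕ → ℝ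
  | 0, i, j => if i = 0 ∧ j = 0 then 1 else 0
  | k + 1, i, j => ∑ a ∈ Finset.HasAntidiagonal.antidiagonal i, ∑ c ∈ Finset.HasAntidiagonal.antidiagonal j,
      convPow₂ f k a.1 c.1 * f a.2 c.2

/-- `p^{(τ)}(m)`: mass function of a Poisson(`θ τ`) sum of independent variables with
mass function `π` on the positive integers. -/
def cpMass (θ : ℝ) (π : ℕ → ℝ) (τ : ℝ) (m : ℕ) : ℝ :=
  if m = 0 then Real.exp (-(θ * τ))
  else ∑ k ∈ Finset.Icc 1 m,
    Real.exp (-(θ * τ)) * (θ * τ) ^ k / (k.factorial : ℝ) * convPow π k m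

/-- `p₂^{(τ₁,τ₂)}(i,j)`, for `τ₁ ≥ τ₂ ≥ 0`: mass function of a Poisson(`θ τ₁`) sum of independent
pairs with mass function `π₂ (τ₂/τ₁)` on `{(i,j) : i ≥ j, i ≥ 1}`. -/
def cpMass₂ (θ : ℝ) (π₂ : ℝ → ℕ → ℕ → ℝ) (τ₁ τ₂ : ℝ) (i j : ℕ) : ℝ :=
  if i < j then 0
  else if i = 0 then Real.exp (-(θ * τ₁))
  else Real.exp (-(θ * τ₁)) *
    ∑ k ∈ Finset.Icc 1 i, (θ * τ₁) ^ k / (k.factorial : ℝ) * convPow₂ (π₂ (τ₂ / τ₁)) k i j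

/-- `π` is the mass function of a probability measure on `{1, 2, …}`. -/
structure IsClusterMass (π : ℕ → ℝ) : Prop where
  nonneg : ∀ i, 0 ≤ π i
  zero : π 0 = 0
  hasSum : HasSum π 1

/-- `f` is the mass function of a probability measure on `{(i,j) : i ≥ j ≥ 0, i ≥ 1}`. -/
structure IsClusterMass₂ (f : ℕ → ℕ → ℝ) : Prop where
  nonneg : ∀ i j, 0 ≤ f i j
  zero_of_lt : ∀ i j, i < j → f i j = 0
  zero_zero : f 0 0 = 0
  hasSum : HasSum (fun w : ℕ × ℕ => f w.1 w.2) 1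

/-! ### The time series, its exceedances and its regularity conditions -/

section TimeSeries

variable {Ω : Type*} [MeasurableSpace Ω] (P : Measure Ω) (X : ℤ → Ω → ℝ)

/-- Strict stationarity: the law of the whole sequence is invariant under time shifts. -/
def IsStationary : Prop :=
  ∀ h : ℤ, P.map (fun ω t => X (t + h) ω) = P.map (fun ω t => X t ω)

/-- The marginal c.d.f. `F`. -/
def margCDF (x : ℝ) : ℝ := P.real {ω | X 0 ω ≤ x}

/-- `M_{1:n} = max {X₁, …, Xₙ}` (for `n ≥ 1`). -/
def blockMax (n : ℕ) (ω : Ω) : ℝ := sSup ((fun t : ℤ => X t ω) '' Set.Icc 1 (n : ℤ))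

/-- `θ ∈ (0,1]` is the extremal index of the series. -/
def HasExtremalIndex (θ : ℝ) : Prop :=
  0 < θ ∧ θ ≤ 1 ∧ ∀ τ : ℝ, 0 < τ → ∃ u : ℕ → ℝ,
    Tendsto (fun n : ℕ => (n : ℝ) * (1 - margCDF P X (u n))) atTop (𝓝 τ) ∧
    Tendsto (fun n : ℕ => P.real {ω | blockMax X n ω ≤ u n}) atTop (𝓝 (Real.exp (-(θ * τ))))

/-- `uₙ(τ) = F^←(1 - τ/n) = inf {x : F x ≥ 1 - τ/n}`, an infimum in the extended reals. -/
def threshold (n : ℕ) (τ : ℝ) : EReal :=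
  sInf ((fun x : ℝ => (x : EReal)) '' {x : ℝ | 1 - τ / n ≤ margCDF P X x})

/-- `Nₙ^{(τ)}(B)`, the number of `t ∈ {1, …, n}` with `t/n ∈ B` and `X_t > uₙ(τ)`. -/
def exceedances (n : ℕ) (τ : ℝ) (B : Set ℝ) (ω : Ω) : ℕ :=
  ∑ t ∈ Finset.Icc 1 n,
    Set.indicator {ω | (t : ℝ) / n ∈ B ∧ threshold P X n τ < (X (t : ℤ) ω : EReal)}
      (fun _ => 1) ω

/-- The intervals `(l i, u i] ⊆ (0,1]` are pairwise disjoint. -/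
def DisjointIntervals {r : ℕ} (l u : Fin r → ℝ) : Prop :=
  (∀ i, 0 ≤ l i ∧ l i ≤ u i ∧ u i ≤ 1) ∧
    Pairwise fun i j => Disjoint (Set.Ioc (l i) (u i)) (Set.Ioc (l j) (u j))

/-- For all `τ > 0` the point process of exceedances `Nₙ^{(τ)}` on `(0,1]` converges in distribution
to the compound Poisson process with intensity `θ τ` and compounding distribution `π`: the counts
in finitely many disjoint intervals converge jointly to independent compound Poisson counts. -/
def OneLevelLimit (θ : ℝ) (π : ℕ → ℝ) : Prop :=
  ∀ τ : ℝ, 0 < τ → ∀ (r : ℕ) (l u : Fin r → ℝ), DisjointIntervals l u → ∀ x : Fin r → ℕ,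
    Tendsto (fun n : ℕ => P.real {ω | ∀ i, exceedances P X n τ (Set.Ioc (l i) (u i)) ω = x i})
      atTop (𝓝 (∏ i, cpMass θ π ((u i - l i) * τ) (x i)))

/-- For all `τ₁ ≥ τ₂ ≥ 0` with `τ₁ > 0`, the two-level point process of exceedances
`(Nₙ^{(τ₁)}, Nₙ^{(τ₂)})` on `(0,1]` converges in distribution to the two-level compound Poisson
process with intensity `θ τ₁` and compounding distribution `π₂ (τ₂/τ₁)`: the pairs of counts in
finitely many disjoint intervals converge jointly to independent compound Poisson pairs. -/
def TwoLevelLimit (θ : ℝ) (π₂ : ℝ → ℕ → ℕ → ℝ) : Prop :=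
  ∀ τ₁ τ₂ : ℝ, 0 < τ₁ → 0 ≤ τ₂ → τ₂ ≤ τ₁ →
    ∀ (r : ℕ) (l u : Fin r → ℝ), DisjointIntervals l u → ∀ x y : Fin r → ℕ,
      Tendsto (fun n : ℕ => P.real {ω | ∀ i,
          exceedances P X n τ₁ (Set.Ioc (l i) (u i)) ω = x i ∧
          exceedances P X n τ₂ (Set.Ioc (l i) (u i)) ω = y i})
        atTop (𝓝 (∏ i, cpMass₂ θ π₂ ((u i - l i) * τ₁) ((u i - l i) * τ₂) (x i) (y i)))

/-- The σ-algebra generated by `U_s 1(U_s > 1 - ε)`, `s ∈ S`, where `U_s = F(X_s)`. -/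
abbrev tailSigma (ε : ℝ) (S : Set ℤ) : MeasurableSpace Ω :=
  ⨆ s ∈ S, MeasurableSpace.comap
    (fun ω => Set.indicator (Set.Ioi (1 - ε)) id (margCDF P X (X s ω))) (borel ℝ)

/-- The α-mixing coefficient `α_ε(ℓ)`. -/
def alphaMix (ε : ℝ) (ℓ : ℕ) : ℝ :=
  sSup {x : ℝ | ∃ k : ℕ, 1 ≤ k ∧ ∃ A B : Set Ω,
    MeasurableSet[tailSigma P X ε (Set.Icc 1 (k : ℤ))] A ∧
    MeasurableSet[tailSigma P X ε (Set.Ici ((k : ℤ) + ℓ))] B ∧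
    x = |P.real (A ∩ B) - P.real A * P.real B|}

/-- `A` is a finite partition of the sample space into sets of the σ-algebra `m`. -/
def IsFinPartition (m : MeasurableSpace Ω) {p : ℕ} (A : Fin p → Set Ω) : Prop :=
  (∀ i, MeasurableSet[m] (A i)) ∧ (Pairwise fun i j => Disjoint (A i) (A j)) ∧
    (⋃ i, A i) = Set.univ

/-- The β-mixing coefficient `β_ε(ℓ)`. -/
def betaMix (ε : ℝ) (ℓ : ℕ) : ℝ :=
  sSup {x : ℝ | ∃ k : ℕ, 1 ≤ k ∧ ∃ (p q : ℕ) (A : Fin p → Set Ω) (B : Fin q → Set Ω),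
    IsFinPartition (tailSigma P X ε (Set.Icc 1 (k : ℤ))) A ∧
    IsFinPartition (tailSigma P X ε (Set.Ici ((k : ℤ) + ℓ))) B ∧
    x = 1 / 2 * ∑ i, ∑ j, |P.real (A i ∩ B j) - P.real (A i) * P.real (B j)|}

variable (b : ℕ → ℕ)

/-- The number `kₙ = ⌊n / bₙ⌋` of disjoint blocks. -/
def numBlocks (n : ℕ) : ℕ := n / b n

/-- Polynomially decaying α-mixing coefficients, and block lengths adapted to them. -/
def MixingCondition (ε₁ : ℝ) : Prop :=
  ∃ η C : ℝ, 2 < η ∧ 0 < C ∧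
    (∀ n : ℕ, 1 ≤ n → alphaMix P X ε₁ n ≤ C * (n : ℝ) ^ (-η)) ∧
    ((fun n => (numBlocks b n : ℝ)) =o[atTop] fun n => (b n : ℝ) ^ η) ∧
    ∃ ℓ : ℕ → ℕ, Tendsto ℓ atTop atTop ∧
      ((fun n => (ℓ n : ℝ)) =o[atTop] fun n => (b n : ℝ)) ∧
      Tendsto (fun n => (numBlocks b n : ℝ) * alphaMix P X ε₁ (ℓ n)) atTop (𝓝 0)

/-- For some `c > 1 - ε₁`, the probability that one of the `2 kₙ` half blocks has all its `U_s`
at most `c` tends to zero. -/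
def HalfBlockCondition (ε₁ : ℝ) : Prop :=
  ∃ c : ℝ, 1 - ε₁ < c ∧
    Tendsto (fun n : ℕ => P.real {ω | ∃ i : ℕ, 1 ≤ i ∧ i ≤ 2 * numBlocks b n ∧
      ∀ s : ℕ, ((i : ℝ) - 1) * b n / 2 + 1 ≤ s → (s : ℝ) ≤ i * b n / 2 →
        margCDF P X (X (s : ℤ) ω) ≤ c}) atTop (𝓝 0)

/-- `φ_{n,j}(z) = P(N_{bₙ}^{(z)}(E) = j)` with `E = (0,1]`. -/
def blockCountProb (n j : ℕ) (z : ℝ) : ℝ :=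
  P.real {ω | exceedances P X (b n) z (Set.Ioc 0 1) ω = j}

/-- `p̄(m) = E[p^{(Z)}(m)]` with `Z` exponential with parameter `θ`. -/
def pBar (θ : ℝ) (π : ℕ → ℝ) (m : ℕ) : ℝ := ∫ z, cpMass θ π z m ∂(expMeasure θ)

/-- The bias condition: `E[φ_{n,j}(Z_{1:bₙ})] = p̄(j) + o(kₙ^{-1/2})` for all `j ≥ 1`, where
`Z_{1:bₙ} = bₙ (1 - F(M_{1:bₙ}))`. -/
def BiasCondition (θ : ℝ) (π : ℕ → ℝ) : Prop :=
  ∀ j : ℕ, 1 ≤ j → Tendsto (fun n : ℕ => Real.sqrt (numBlocks b n) *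
    ((∫ ω, blockCountProb P X b n j ((b n : ℝ) * (1 - margCDF P X (blockMax X (b n) ω))) ∂P)
      - pBar θ π j)) atTop (𝓝 0)

/-- The assumptions under which the disjoint and the sliding blocks estimators are asymptotically
normal, for a stationary series `X` with block lengths `b`. -/
structure RegularityConditions (θ : ℝ) (π : ℕ → ℝ) (π₂ : ℝ → ℕ → ℕ → ℝ) : Prop where
  extremalIndex : HasExtremalIndex P X θ
  clusterMass : IsClusterMass π
  clusterMass₂ : ∀ σ ∈ Set.Icc (0 : ℝ) 1, IsClusterMass₂ (π₂ σ)
  oneLevel : OneLevelLimit P X θ π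
  twoLevel : TwoLevelLimit P X θ π₂
  block_tendsto : Tendsto b atTop atTop
  block_isLittleO : (fun n => (b n : ℝ)) =o[atTop] fun n : ℕ => (n : ℝ)
  mixing : ∃ ε₁ ∈ Set.Ioo (0 : ℝ) 1, MixingCondition P X b ε₁ ∧ HalfBlockCondition P X b ε₁
  bias : BiasCondition P X b θ π
  betaMixing : ∃ ε₂ : ℝ, 0 < ε₂ ∧
    Tendsto (fun n => Real.sqrt (numBlocks b n) * betaMix P X ε₂ (b n)) atTop (𝓝 0)

end TimeSeries

/-! ### Joint laws specified by their mass or tail functions -/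

/-- The law on `ℕ × ℕ` with mass function `q`. -/
def lawOfMass (q : ℕ → ℕ → ℝ) : Measure (ℕ × ℕ) :=
  Measure.sum fun w : ℕ × ℕ => ENNReal.ofReal (q w.1 w.2) • Measure.dirac w

/-- `μ` is the law of a pair `(N, Z)` with values in `ℕ × (0,∞)` such that
`P(N = j, Z > x) = G j x` for all `j` and `x > 0`. -/
structure HasMixedTail (G : ℕ → ℝ → ℝ) (μ : Measure (ℕ × ℝ)) : Prop where
  prob : IsProbabilityMeasure μ
  pos : μ (Set.univ ×ˢ Set.Iic 0) = 0
  tail : ∀ (j : ℕ) (x : ℝ), 0 < x → μ ({j} ×ˢ Set.Ioi x) = ENNReal.ofReal (G j x)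

theorem HasMixedTail.unique {G : ℕ → ℝ → ℝ} {μ ν : Measure (ℕ × ℝ)} (hμ : HasMixedTail G μ)
    (hν : HasMixedTail G ν) : μ = ν := by
  have key : ∀ (ρ : Measure (ℕ × ℝ)), HasMixedTail G ρ → ∀ (j : ℕ) (x : ℝ),
      ρ ({j} ×ˢ Set.Ioi x) =
        ⨆ n : ℕ, ENNReal.ofReal (G j (max x 0 + 1 / ((n : ℝ) + 1))) := by
    intro ρ h j x
    have h0 : ρ ({j} ×ˢ Set.Ioi x) = ρ ({j} ×ˢ Set.Ioi (max x 0)) := by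
      apply le_antisymm
      · have hsub : ({j} : Set ℕ) ×ˢ Set.Ioi x ⊆
            ({j} ×ˢ Set.Ioi (max x 0)) ∪ (Set.univ ×ˢ Set.Iic 0) := by
          rintro ⟨i, z⟩ ⟨hi, hz⟩
          rcases le_or_gt z 0 with h' | h'
          · exact Or.inr ⟨trivial, h'⟩
          · exact Or.inl ⟨hi, max_lt hz h'⟩
        calc _ ≤ _ := measure_mono hsub
          _ ≤ _ := measure_union_le _ _
          _ = _ := by rw [h.pos, add_zero]
      · exact measure_mono (Set.prod_mono le_rfl (Set.Ioi_subset_Ioi (le_max_left _ _)))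
    have h1 : ({j} : Set ℕ) ×ˢ Set.Ioi (max x 0) =
        ⋃ n : ℕ, ({j} : Set ℕ) ×ˢ Set.Ioi (max x 0 + 1 / ((n : ℝ) + 1)) := by
      rw [← Set.prod_iUnion]
      congr 1
      ext z
      simp only [Set.mem_Ioi, Set.mem_iUnion]
      constructor
      · intro hz
        obtain ⟨n, hn⟩ := exists_nat_one_div_lt (sub_pos.2 hz)
        exact ⟨n, by linarith⟩
      · rintro ⟨n, hn⟩
        have : (0 : ℝ) < 1 / ((n : ℝ) + 1) := by positivity
        linarith
    rw [h0, h1, Monotone.measure_iUnion]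
    · congr 1
      ext n
      exact h.tail j _ (by have := le_max_right x 0; positivity)
    · intro m n hmn
      apply Set.prod_mono le_rfl (Set.Ioi_subset_Ioi _)
      gcongr
  have := hμ.prob
  have := hν.prob
  have hgen : Prod.instMeasurableSpace = MeasurableSpace.generateFrom (Set.image2 (· ×ˢ ·)
      (Set.range fun j : ℕ => ({j} : Set ℕ)) (Set.range (Set.Ioi : ℝ → Set ℝ))) := by
    refine (generateFrom_eq_prod ?_ (borel_eq_generateFrom_Ioi ℝ).symm ?_ ?_).symm
    · refine le_antisymm le_top fun A _ => ?_
      rw [← Set.biUnion_of_singleton A]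
      exact MeasurableSet.biUnion A.to_countable fun j _ =>
        MeasurableSpace.measurableSet_generateFrom ⟨j, rfl⟩
    · exact ⟨fun n => {n}, fun n => ⟨n, rfl⟩, by ext; simp⟩
    · exact ⟨fun n : ℕ => Set.Ioi (-(n : ℝ)), fun n => ⟨_, rfl⟩, Set.iUnion_eq_univ_iff.2 fun x => by
        obtain ⟨n, hn⟩ := exists_nat_gt (-x)
        exact ⟨n, by simp only [Set.mem_Ioi]; linarith⟩⟩
  refine ext_of_generate_finite _ hgen ?_ ?_ (by simp)
  · refine IsPiSystem.prod ?_ isPiSystem_Ioi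
    rintro _ ⟨j, rfl⟩ _ ⟨j', rfl⟩ ⟨i, hi, hi'⟩
    simp only [Set.mem_singleton_iff] at hi hi'
    subst hi; subst hi'
    exact ⟨i, by simp⟩
  · rintro _ ⟨_, ⟨j, rfl⟩, _, ⟨x, rfl⟩, rfl⟩
    rw [key μ hμ, key ν hν]

open Classical in
/-- The law of a pair `(N, Z)` with `P(N = j, Z > x) = G j x`. -/
def lawOfMixedTail (G : ℕ → ℝ → ℝ) : Measure (ℕ × ℝ) :=
  if h : ∃ μ, HasMixedTail G μ then h.choose else 0

/-- `μ` is the law of a pair `(X, Y)` with values in `(0,∞)²` such that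
`P(X > x, Y > y) = S x y` for all `x, y > 0`. -/
structure HasSurvival (S : ℝ → ℝ → ℝ) (μ : Measure (ℝ × ℝ)) : Prop where
  prob : IsProbabilityMeasure μ
  pos : μ ((Set.Ioi 0 ×ˢ Set.Ioi 0)ᶜ) = 0
  tail : ∀ x y : ℝ, 0 < x → 0 < y → μ (Set.Ioi x ×ˢ Set.Ioi y) = ENNReal.ofReal (S x y)

theorem HasSurvival.unique {S : ℝ → ℝ → ℝ} {μ ν : Measure (ℝ × ℝ)} (hμ : HasSurvival S μ)
    (hν : HasSurvival S ν) : μ = ν := by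
  have key : ∀ (ρ : Measure (ℝ × ℝ)), HasSurvival S ρ → ∀ x y : ℝ,
      ρ (Set.Ioi x ×ˢ Set.Ioi y) = ⨆ n : ℕ,
        ENNReal.ofReal (S (max x 0 + 1 / ((n : ℝ) + 1)) (max y 0 + 1 / ((n : ℝ) + 1))) := by
    intro ρ h x y
    have h0 : ρ (Set.Ioi x ×ˢ Set.Ioi y) = ρ (Set.Ioi (max x 0) ×ˢ Set.Ioi (max y 0)) := by
      apply le_antisymm
      · have hsub : Set.Ioi x ×ˢ Set.Ioi y ⊆
            (Set.Ioi (max x 0) ×ˢ Set.Ioi (max y 0)) ∪ (Set.Ioi 0 ×ˢ Set.Ioi 0)ᶜ := by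
          intro w hw
          by_cases h' : w ∈ Set.Ioi (0 : ℝ) ×ˢ Set.Ioi (0 : ℝ)
          · exact Or.inl ⟨Set.mem_Ioi.2 (max_lt hw.1 h'.1), Set.mem_Ioi.2 (max_lt hw.2 h'.2)⟩
          · exact Or.inr h'
        calc _ ≤ _ := measure_mono hsub
          _ ≤ _ := measure_union_le _ _
          _ = _ := by rw [h.pos, add_zero]
      · exact measure_mono (Set.prod_mono (Set.Ioi_subset_Ioi (le_max_left _ _))
          (Set.Ioi_subset_Ioi (le_max_left _ _)))
    have h1 : Set.Ioi (max x 0) ×ˢ Set.Ioi (max y 0) =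
        ⋃ n : ℕ, Set.Ioi (max x 0 + 1 / ((n : ℝ) + 1)) ×ˢ
          Set.Ioi (max y 0 + 1 / ((n : ℝ) + 1)) := by
      ext w
      simp only [Set.mem_prod, Set.mem_Ioi, Set.mem_iUnion]
      constructor
      · intro hz
        obtain ⟨n, hn⟩ := exists_nat_one_div_lt (lt_min (sub_pos.2 hz.1) (sub_pos.2 hz.2))
        have := lt_min_iff.1 hn
        exact ⟨n, by linarith, by linarith⟩
      · rintro ⟨n, hn, hn'⟩
        have : (0 : ℝ) < 1 / ((n : ℝ) + 1) := by positivity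
        constructor <;> linarith
    rw [h0, h1, Monotone.measure_iUnion]
    · congr 1
      ext n
      have hx := le_max_right x 0
      have hy := le_max_right y 0
      exact h.tail _ _ (by positivity) (by positivity)
    · intro m n hmn
      apply Set.prod_mono <;> apply Set.Ioi_subset_Ioi <;> gcongr
  have := hμ.prob
  have := hν.prob
  have hsp : IsCountablySpanning (Set.range (Set.Ioi : ℝ → Set ℝ)) :=
    ⟨fun n : ℕ => Set.Ioi (-(n : ℝ)), fun n => ⟨_, rfl⟩, Set.iUnion_eq_univ_iff.2 fun x => by
      obtain ⟨n, hn⟩ := exists_nat_gt (-x)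
      exact ⟨n, by simp only [Set.mem_Ioi]; linarith⟩⟩
  refine ext_of_generate_finite _ (generateFrom_eq_prod (borel_eq_generateFrom_Ioi ℝ).symm
    (borel_eq_generateFrom_Ioi ℝ).symm hsp hsp).symm
    (isPiSystem_Ioi.prod isPiSystem_Ioi) ?_ (by simp)
  rintro _ ⟨_, ⟨x, rfl⟩, _, ⟨y, rfl⟩, rfl⟩
  rw [key μ hμ, key ν hν]

open Classical in
/-- The law of a pair `(X, Y)` with joint survival function `S`. -/
def lawOfSurvival (S : ℝ → ℝ → ℝ) : Measure (ℝ × ℝ) :=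
  if h : ∃ μ, HasSurvival S μ then h.choose else 0

/-! ### The asymptotic covariance matrices -/

section Covariances

variable (θ : ℝ) (π : ℕ → ℝ) (π₂ : ℝ → ℕ → ℕ → ℝ)

/-- `1(i = j)` as a real number. -/
def ind (j i : ℕ) : ℝ := if i = j then 1 else 0

/-- `P(N_E^{(τ)} = j, N_E^{(τ')} = j')`. -/
def massNN (τ τ' : ℝ) (j j' : ℕ) : ℝ :=
  if τ' ≤ τ then cpMass₂ θ π₂ τ τ' j j' else cpMass₂ θ π₂ τ' τ j' j

/-- `P(N_E^{(τ)} = j, Z > μ)`. -/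
def tailNZ (τ : ℝ) (j : ℕ) (μ : ℝ) : ℝ :=
  if μ ≤ τ then cpMass₂ θ π₂ τ μ j 0 else if j = 0 then Real.exp (-(θ * μ)) else 0

/-- `Cov(1(N_E^{(τ)} = j), p^{(Z)}(j'))`. -/
def covNZ (τ : ℝ) (j j' : ℕ) : ℝ :=
  cov[fun w : ℕ × ℝ => ind j w.1, fun w => cpMass θ π w.2 j';
    lawOfMixedTail (tailNZ θ π₂ τ)]

/-- `d_{j,j'}^{db} = ∫∫ Cov(1(N_E^{(τ)} = j) + p^{(Z)}(j), 1(N_E^{(τ')} = j') + p^{(Z)}(j'))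
dH(τ) dH(τ')`; the covariance is expanded by bilinearity, because exactly the laws of the pairs
`(N_E^{(τ)}, N_E^{(τ')})`, `(N_E^{(τ)}, Z)` and the law `H` of `Z` are specified. -/
def dDb (j j' : ℕ) : ℝ :=
  ∫ τ', ∫ τ,
    (cov[fun w : ℕ × ℕ => ind j w.1, fun w => ind j' w.2; lawOfMass (massNN θ π₂ τ τ')]
      + covNZ θ π π₂ τ j j'
      + covNZ θ π π₂ τ' j' j
      + cov[fun z => cpMass θ π z j, fun z => cpMass θ π z j'; expMeasure θ])
    ∂(expMeasure θ) ∂(expMeasure θ)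

/-- `P(X_{1,ξ}^{(τ)} = j, Y_{1,ξ}^{(τ')} = j')` for `τ ≤ τ'`. -/
def mass₁Aux (ξ τ τ' : ℝ) (j j' : ℕ) : ℝ :=
  ∑ l ∈ Finset.range (j + 1), ∑ r ∈ Finset.Icc (j - l) j',
    cpMass θ π (ξ * τ) l * cpMass θ π (ξ * τ') (j' - r)
      * cpMass₂ θ π₂ ((1 - ξ) * τ') ((1 - ξ) * τ) r (j - l)

/-- `P(X_{1,ξ}^{(τ)} = j, Y_{1,ξ}^{(τ')} = j')`; for `τ > τ'` the roles of the two levels are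
interchanged. -/
def mass₁ (ξ τ τ' : ℝ) (j j' : ℕ) : ℝ :=
  if τ ≤ τ' then mass₁Aux θ π π₂ ξ τ τ' j j' else mass₁Aux θ π π₂ ξ τ' τ j' j

/-- `P(X_{2,ξ} > x, Y_{2,ξ} > y)`. -/
def survival₂ (ξ x y : ℝ) : ℝ := Real.exp (-(θ * (min x y * ξ + max x y)))

/-- `P(X_{3,ξ}^{(τ)} = j, Y_{3,ξ} > x)`. -/
def tail₃ (ξ τ : ℝ) (j : ℕ) (x : ℝ) : ℝ :=
  if x ≤ τ then
    Real.exp (-(θ * ξ * x)) * ∑ l ∈ Finset.range (j + 1),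
      cpMass θ π (ξ * τ) l * cpMass₂ θ π₂ ((1 - ξ) * τ) ((1 - ξ) * x) (j - l) 0
  else Real.exp (-(θ * x)) * cpMass θ π (τ * ξ) j

/-- `Cov(1(X_{3,ξ}^{(τ)} = j), p^{(Y_{3,ξ})}(j'))`. -/
def cov₃ (ξ τ : ℝ) (j j' : ℕ) : ℝ :=
  cov[fun w : ℕ × ℝ => ind j w.1, fun w => cpMass θ π w.2 j';
    lawOfMixedTail (tail₃ θ π π₂ ξ τ)]

/-- `d_{j,j'}^{sb}`. -/
def dSb (j j' : ℕ) : ℝ :=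
  2 * ∫ ξ in (0 : ℝ)..1,
    ((∫ τ', ∫ τ,
        cov[fun w : ℕ × ℕ => ind j w.1, fun w => ind j' w.2; lawOfMass (mass₁ θ π π₂ ξ τ τ')]
        ∂(expMeasure θ) ∂(expMeasure θ))
      + (∫ τ, cov₃ θ π π₂ ξ τ j j' ∂(expMeasure θ))
      + (∫ τ, cov₃ θ π π₂ ξ τ j' j ∂(expMeasure θ))
      + cov[fun w : ℝ × ℝ => cpMass θ π w.1 j, fun w => cpMass θ π w.2 j';
          lawOfSurvival (survival₂ θ ξ)])

/-- `Σ_m^{db}`; the index `i : Fin m` stands for the cluster size `i + 1`. -/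
def SigmaDb (m : ℕ) : Matrix (Fin m) (Fin m) ℝ :=
  Matrix.of fun i i' => dDb θ π π₂ (i + 1) (i' + 1)

/-- `Σ_m^{sb}`; the index `i : Fin m` stands for the cluster size `i + 1`. -/
def SigmaSb (m : ℕ) : Matrix (Fin m) (Fin m) ℝ :=
  Matrix.of fun i i' => dSb θ π π₂ (i + 1) (i' + 1)

/-- The recursion `v_j = 4 s_j - 2 ∑_{k<j} π(j-k) s_k - 2 ∑_{k<j} p̄(j-k) v_k`, where `k ≥ 1`. -/
def recV (s : ℕ → ℝ) (j : ℕ) : ℝ :=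
  4 * s j - 2 * ∑ k ∈ Finset.Ico 1 j, π (j - k) * s k
    - 2 * ∑ k ∈ (Finset.Ico 1 j).attach, pBar θ π (j - k.1) * recV s k.1
termination_by j
decreasing_by exact (Finset.mem_Ico.1 k.2).2

/-- The matrix `A_m` with `(v_1, …, v_m)ᵀ = A_m (s_1, …, s_m)ᵀ`: its `i'`-th column is the value of
`(v_1, …, v_m)` when `s` is the corresponding unit vector. -/
def matA (m : ℕ) : Matrix (Fin m) (Fin m) ℝ :=
  Matrix.of fun i i' => recV θ π (fun k => if k = (i' : ℕ) + 1 then 1 else 0) (i + 1)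

/-- `Γ_m^{db} = A_m Σ_m^{db} A_mᵀ`. -/
def GammaDb (m : ℕ) : Matrix (Fin m) (Fin m) ℝ :=
  matA θ π m * SigmaDb θ π π₂ m * (matA θ π m)ᵀ

/-- `Γ_m^{sb} = A_m Σ_m^{sb} A_mᵀ`. -/
def GammaSb (m : ℕ) : Matrix (Fin m) (Fin m) ℝ :=
  matA θ π m * SigmaSb θ π π₂ m * (matA θ π m)ᵀ

end Covariances

/-- The Loewner order between symmetric matrices. -/
def LoewnerLE {m : ℕ} (A B : Matrix (Fin m) (Fin m) ℝ) : Prop :=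
  A.IsSymm ∧ B.IsSymm ∧ (B - A).PosSemidef

end SlidingBlocks

end

namespace SlidingBlocks

/-! ### Positive semidefinite sequences of finite range -/

/-! Let `blockCov ξ` be the limiting covariance of the statistics of two blocks whose relative
offset is `ξ`. Identifying all the laws shows that the disjoint-blocks entries are `blockCov 0`
(`dDb_eq`) and the sliding-blocks entries are `2 ∫₀¹ blockCov ξ dξ` (`dSb_eq`). Fix a vector `a` and
put `f ξ = ∑ a j * a j' * blockCov ξ j j'`. Extended evenly, and by zero for `|ξ| ≥ 1` because
disjoint blocks are asymptotically independent, `f` behaves like the autocovariance function of the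
block statistic as the block slides. Hence `∫ f ≥ 0`. Also `∫ f ≤ f 0`: a sliding average is an
average of disjoint-blocks averages with shifted starting points, all of the same variance, and
averaging does not increase variance.

The argument is carried out on a grid with `L` points per block. A positive semidefinite sequence of
range `L` satisfies `0 ≤ ∑_{|k|<L} f (|k|/L) ≤ L * f 0` (`sum_nonneg_and_le_of_posSemidef`).
Dividing by `L` and letting `L → ∞` gives both inequalities for the quadratic forms
(`quadraticForm_compare`).

Positive semidefiniteness (`sum_blockCov_nonneg`) is obtained without constructing a limit process
indexed by all levels. By the fundamental theorem of calculus `p^{(Z)}(j)` is the integral of `1(x <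
Z)` against the derivative of `x ↦ p^{(x)}(j)`, and `{Z > x}` plays the role of `{N^{(x)} = 0}`.
Both terms of the block statistic are thus weighted integrals over levels of indicators of counts,
and every covariance is an integral of the single kernel `covKernel`. This kernel is the limit of
covariances of exceedance counts of the series itself, so nonnegativity of variances passes to the
limit by dominated convergence (`sum_integral_kernel_nonneg`). Pairs of levels on three disjoint
intervals (left part, overlap, right part) suffice to identify it.

The claims on `Γ` follow by congruence with `A_m`, and those on variances by reading off diagonals.
-/

theorem sum_sum_dist_succ (c : ℕ → ℝ) (N : ℕ) :
    ∑ i ∈ Finset.range (N + 1), ∑ j ∈ Finset.range (N + 1), c (Nat.dist i j) =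
      (∑ i ∈ Finset.range N, ∑ j ∈ Finset.range N, c (Nat.dist i j)) +
        (2 * ∑ k ∈ Finset.range (N + 1), c k - c 0) := by
  -- A border row of the enlarged array meets each distance `1, …, N` exactly once.
  have h : ∑ i ∈ Finset.range N, c (Nat.dist N i) = ∑ k ∈ Finset.range (N + 1), c k - c 0 := by
    rw [Finset.sum_range_succ', add_sub_cancel_right,
      ← Finset.sum_range_reflect (fun k => c (k + 1)) N]
    refine Finset.sum_congr rfl fun i hi => ?_
    have := Finset.mem_range.1 hi
    congr 1
    rw [Nat.dist_eq_sub_of_le_right this.le]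
    omega
  have h' : ∑ i ∈ Finset.range N, c (Nat.dist i N) = ∑ k ∈ Finset.range (N + 1), c k - c 0 := by
    rw [← h]
    exact Finset.sum_congr rfl fun i _ => by rw [Nat.dist_comm]
  rw [Finset.sum_range_succ, Finset.sum_range_succ _ N, h, Nat.dist_self]
  simp_rw [Finset.sum_range_succ _ N]
  rw [Finset.sum_add_distrib, h', Finset.sum_range_succ _ N]
  ring

/-- The double sum telescopes into increments that are eventually constant, so its Cesàro mean
converges to that constant. -/
theorem tendsto_average_sum_dist (c : ℕ → ℝ) (L : ℕ) (hc : ∀ k, L ≤ k → c k = 0) :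
    Tendsto (fun N : ℕ => (N : ℝ)⁻¹ *
      ∑ i ∈ Finset.range N, ∑ j ∈ Finset.range N, c (Nat.dist i j)) atTop
      (𝓝 (2 * ∑ k ∈ Finset.range L, c k - c 0)) := by
  have h : ∀ N : ℕ, ∑ i ∈ Finset.range N, ∑ j ∈ Finset.range N, c (Nat.dist i j) =
      ∑ i ∈ Finset.range N, (2 * ∑ k ∈ Finset.range (i + 1), c k - c 0) := by
    intro N
    induction N with
    | zero => simp
    | succ N ih => rw [sum_sum_dist_succ, ih, ← Finset.sum_range_succ fun i =>
        2 * ∑ k ∈ Finset.range (i + 1), c k - c 0]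
  simp_rw [h]
  refine Tendsto.cesaro (tendsto_const_nhds.congr' ?_)
  filter_upwards [eventually_ge_atTop L] with i hi
  have : ∑ k ∈ Finset.range (i + 1), c k = ∑ k ∈ Finset.range L, c k := by
    symm
    refine Finset.sum_subset (Finset.range_mono (by omega)) fun k _ hk => hc k ?_
    simpa using hk
  rw [this]

/-- If `k ↦ c |k|` is positive semidefinite on `ℤ` and vanishes for `|k| ≥ L`, then
`0 ≤ ∑_{|k| < L} c |k| ≤ L c 0`. -/
theorem sum_nonneg_and_le_of_posSemidef (c : ℕ → ℝ) (L : ℕ) (hL : 0 < L)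
    (hc : ∀ k, L ≤ k → c k = 0)
    (hpos : ∀ (N : ℕ) (w : ℕ → ℝ),
      0 ≤ ∑ i ∈ Finset.range N, ∑ j ∈ Finset.range N, w i * w j * c (Nat.dist i j)) :
    0 ≤ 2 * ∑ k ∈ Finset.range L, c k - c 0 ∧
      2 * ∑ k ∈ Finset.range L, c k - c 0 ≤ L * c 0 := by
  have hlim := tendsto_average_sum_dist c L hc
  constructor
  · refine ge_of_tendsto' hlim fun N => mul_nonneg (by positivity) ?_
    simpa using hpos N fun _ => 1
  · refine le_of_tendsto hlim ?_
    filter_upwards [eventually_gt_atTop 0] with N hN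
    -- The weights are differences of indicators of residue classes mod `L`. One class corresponds
    -- to one family of disjoint blocks, and summing over all pairs of classes expresses that the
    -- variance of a mean is at most the mean of the variances.
    let χ : ℕ → ℕ → ℝ := fun u i => if i % L = u then 1 else 0
    have hχ : ∀ i j : ℕ, ∑ u ∈ Finset.range L, ∑ v ∈ Finset.range L,
        (χ u i - χ v i) * (χ u j - χ v j) = 2 * L * (if i % L = j % L then 1 else 0) - 2 := by
      intro i j
      have h1 : ∀ i : ℕ, ∑ u ∈ Finset.range L, χ u i = 1 := by
        intro i
        simp only [χ]
        rw [Finset.sum_ite_eq, if_pos (Finset.mem_range.2 (Nat.mod_lt _ hL))]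
      have h2 : ∑ u ∈ Finset.range L, χ u i * χ u j = if i % L = j % L then 1 else 0 := by
        simp only [χ, ite_mul, one_mul, zero_mul]
        rw [Finset.sum_ite_eq, if_pos (Finset.mem_range.2 (Nat.mod_lt _ hL))]
        simp only [eq_comm]
      have h3 : ∀ u v : ℕ, (χ u i - χ v i) * (χ u j - χ v j) =
          χ u i * χ u j + χ v i * χ v j - χ u i * χ v j - χ v i * χ u j := by intros; ring
      simp_rw [h3, Finset.sum_sub_distrib, Finset.sum_add_distrib, Finset.sum_const,
        ← Finset.mul_sum, ← Finset.sum_mul, h2, h1, Finset.card_range, nsmul_eq_mul,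
        ← Finset.mul_sum, h2, mul_one, one_mul, h1]
      ring
    have key : 0 ≤ ∑ i ∈ Finset.range N, ∑ j ∈ Finset.range N,
        (2 * L * (if i % L = j % L then 1 else 0) - 2) * c (Nat.dist i j) := by
      have : 0 ≤ ∑ u ∈ Finset.range L, ∑ v ∈ Finset.range L, ∑ i ∈ Finset.range N,
          ∑ j ∈ Finset.range N, (χ u i - χ v i) * (χ u j - χ v j) * c (Nat.dist i j) :=
        Finset.sum_nonneg fun u _ => Finset.sum_nonneg fun v _ => hpos N fun i => χ u i - χ v i
      refine this.trans_eq ?_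
      simp_rw [← hχ, Finset.sum_mul]
      rw [Finset.sum_congr rfl fun u _ => Finset.sum_comm, Finset.sum_comm]
      refine Finset.sum_congr rfl fun i _ => ?_
      rw [Finset.sum_congr rfl fun u _ => Finset.sum_comm, Finset.sum_comm]
    -- Distinct indices of the same class are at distance at least `L`, where `c` vanishes, so only
    -- the diagonal survives.
    have hdiag : ∑ i ∈ Finset.range N, ∑ j ∈ Finset.range N,
        (if i % L = j % L then 1 else 0) * c (Nat.dist i j) = N * c 0 := by
      rw [← nsmul_eq_mul, ← Finset.card_range N, ← Finset.sum_const, Finset.card_range]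
      refine Finset.sum_congr rfl fun i hi => ?_
      rw [Finset.sum_eq_single i _ (fun h => absurd hi h)]
      · simp [Nat.dist_self]
      · intro j _ hj
        split_ifs with h
        · rw [one_mul]
          refine hc _ (Nat.le_of_dvd (Nat.dist_pos_of_ne hj.symm) ?_)
          rcases le_total i j with hij | hij
          · rw [Nat.dist_eq_sub_of_le hij]; exact (Nat.modEq_iff_dvd' hij).1 h
          · rw [Nat.dist_eq_sub_of_le_right hij]; exact (Nat.modEq_iff_dvd' hij).1 h.symm
        · simp
    have hsplit : ∑ i ∈ Finset.range N, ∑ j ∈ Finset.range N,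
        (2 * L * (if i % L = j % L then 1 else 0) - 2) * c (Nat.dist i j) =
        2 * L * (∑ i ∈ Finset.range N, ∑ j ∈ Finset.range N,
          (if i % L = j % L then 1 else 0) * c (Nat.dist i j)) -
        2 * ∑ i ∈ Finset.range N, ∑ j ∈ Finset.range N, c (Nat.dist i j) := by
      simp_rw [Finset.mul_sum, ← Finset.sum_sub_distrib]
      exact Finset.sum_congr rfl fun i _ => Finset.sum_congr rfl fun j _ => by ring
    rw [hsplit, hdiag] at key
    have hN' : (0 : ℝ) < N := by exact_mod_cast hN
    rw [inv_mul_le_iff₀ hN']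
    linarith

/-! ### Riemann sums -/

/-- The sum is the integral of the step function `f (⌊L * x⌋₊ / L)`, which converges pointwise by
continuity and is dominated by `B`. Continuity at the endpoint `1` plays no role. -/
theorem tendsto_riemann_sum (f : ℝ → ℝ) (B : ℝ) (hf : ContinuousOn f (Set.Ico 0 1))
    (hB : ∀ x ∈ Set.Ico (0 : ℝ) 1, |f x| ≤ B) :
    Tendsto (fun L : ℕ => (L : ℝ)⁻¹ * ∑ k ∈ Finset.range L, f (k / L)) atTop
      (𝓝 (∫ x in (0 : ℝ)..1, f x)) := by
  have hfl : ∀ (L : ℕ) (x : ℝ), x ∈ Set.Ico (0 : ℝ) 1 → 0 < L →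
      ((⌊L * x⌋₊ : ℝ) / L) ∈ Set.Ico (0 : ℝ) 1 := by
    intro L x hx hL
    have hL' : (0 : ℝ) < L := by exact_mod_cast hL
    refine ⟨by positivity, ?_⟩
    rw [div_lt_one hL']
    calc (⌊L * x⌋₊ : ℝ) ≤ L * x := Nat.floor_le (mul_nonneg hL'.le hx.1)
      _ < L * 1 := by have := hx.2; gcongr
      _ = L := mul_one _
  have hstep : ∀ (L : ℕ), 0 < L → ∀ k < L, IntervalIntegrable
        (fun x : ℝ => f (⌊L * x⌋₊ / L)) volume (k / L : ℝ) ((k + 1 : ℕ) / L : ℝ) ∧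
      ∫ x in (k / L : ℝ)..((k + 1 : ℕ) / L : ℝ), f (⌊L * x⌋₊ / L) = (L : ℝ)⁻¹ * f (k / L) := by
    intro L hL k hk
    have hL' : (0 : ℝ) < L := by exact_mod_cast hL
    have hle : (k / L : ℝ) ≤ ((k + 1 : ℕ) / L : ℝ) := by gcongr; simp
    have hae : ∀ᵐ x ∂(volume : Measure ℝ), x ∈ Set.uIoc (k / L : ℝ) ((k + 1 : ℕ) / L : ℝ) →
        f (k / L) = f (⌊L * x⌋₊ / L) := by
      -- The floor jumps at the right end of the cell, which is a null set.
      have : ∀ᵐ x ∂(volume : Measure ℝ), x ≠ ((k + 1 : ℕ) / L : ℝ) := by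
        simp [ae_iff]
      filter_upwards [this] with x hx hx'
      rw [Set.uIoc_of_le hle] at hx'
      have hx2 := lt_of_le_of_ne hx'.2 hx
      have hx1 := hx'.1
      rw [div_lt_iff₀ hL'] at hx1
      rw [lt_div_iff₀ hL'] at hx2
      have : ⌊(L : ℝ) * x⌋₊ = k := by
        rw [Nat.floor_eq_iff (by nlinarith [(Nat.cast_nonneg k : (0 : ℝ) ≤ k)])]
        push_cast at hx2
        constructor <;> nlinarith
      rw [this]
    constructor
    · refine (intervalIntegrable_const (c := f (k / L))).congr_ae ?_
      rw [Filter.EventuallyEq, ae_restrict_iff' measurableSet_uIoc]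
      exact hae
    · rw [← intervalIntegral.integral_congr_ae hae, intervalIntegral.integral_const, smul_eq_mul]
      congr 1
      push_cast
      field_simp
      ring
  have hsum : ∀ L : ℕ, 0 < L → (L : ℝ)⁻¹ * ∑ k ∈ Finset.range L, f (k / L) =
      ∫ x in Set.Ico (0 : ℝ) 1, f (⌊L * x⌋₊ / L) := by
    intro L hL
    have hL' : (L : ℝ) ≠ 0 := by positivity
    rw [integral_Ico_eq_integral_Ioc, ← intervalIntegral.integral_of_le zero_le_one]
    have := intervalIntegral.sum_integral_adjacent_intervals (a := fun k : ℕ => (k / L : ℝ))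
      (f := fun x : ℝ => f (⌊L * x⌋₊ / L)) (μ := volume) (n := L) fun k hk => (hstep L hL k hk).1
    simp only [Nat.cast_zero, zero_div, div_self hL'] at this
    rw [← this, Finset.mul_sum]
    exact Finset.sum_congr rfl fun k hk => ((hstep L hL k (Finset.mem_range.1 hk)).2).symm
  rw [intervalIntegral.integral_of_le zero_le_one, ← integral_Ico_eq_integral_Ioc]
  -- The indicator switches the integrand off at `L = 0`, so that the bound `B` is available for
  -- every `L`.
  have hlim : Tendsto (fun L : ℕ => ∫ x in Set.Ico (0 : ℝ) 1,
      Set.indicator (Set.Ioi 0) (fun _ => f (⌊L * x⌋₊ / L)) (L : ℝ)) atTop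
      (𝓝 (∫ x in Set.Ico (0 : ℝ) 1, f x)) := by
    refine tendsto_integral_of_dominated_convergence (fun _ => B) ?_ (integrable_const _) ?_ ?_
    · intro L
      rcases Nat.eq_zero_or_pos L with rfl | hL
      · simp only [Nat.cast_zero, Set.mem_Ioi, lt_irrefl, not_false_eq_true,
          Set.indicator_of_notMem]
        exact aestronglyMeasurable_const
      · have hm : Measurable fun x : ℝ => ((⌊L * x⌋₊ : ℕ)) :=
          Nat.measurable_floor.comp (measurable_const.mul measurable_id)
        have : Measurable fun x : ℝ => f (⌊L * x⌋₊ / L) :=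
          (measurable_from_nat (f := fun k : ℕ => f (k / L))).comp hm
        have hp : (L : ℝ) ∈ Set.Ioi (0 : ℝ) := by simpa using hL
        simp only [Set.indicator_of_mem hp]
        exact this.aestronglyMeasurable
    · intro L
      filter_upwards [ae_restrict_mem measurableSet_Ico] with x hx
      rcases Nat.eq_zero_or_pos L with rfl | hL
      · simpa using (abs_nonneg _).trans (hB x hx)
      · have hp : (L : ℝ) ∈ Set.Ioi (0 : ℝ) := by simpa using hL
        simp only [Set.indicator_of_mem hp]
        exact hB _ (hfl L x hx hL)
    · filter_upwards [ae_restrict_mem measurableSet_Ico] with x hx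
      have h1 : Tendsto (fun L : ℕ => ((⌊x * (L : ℝ)⌋₊ : ℝ) / L)) atTop (𝓝 x) :=
        (tendsto_nat_floor_mul_div_atTop hx.1).comp tendsto_natCast_atTop_atTop
      have h2 : Tendsto (fun L : ℕ => ((⌊x * (L : ℝ)⌋₊ : ℝ) / L)) atTop
          (𝓝[Set.Ico 0 1] x) := by
        refine tendsto_nhdsWithin_iff.2 ⟨h1, ?_⟩
        filter_upwards [eventually_gt_atTop 0] with L hL
        rw [mul_comm]
        exact hfl L x hx hL
      refine ((hf x hx).tendsto.comp h2).congr' ?_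
      filter_upwards [eventually_gt_atTop 0] with L hL
      have hp : (L : ℝ) ∈ Set.Ioi (0 : ℝ) := by simpa using hL
      simp only [Set.indicator_of_mem hp, Function.comp, mul_comm]
  refine hlim.congr' ?_
  filter_upwards [eventually_gt_atTop 0] with L hL
  have hp : (L : ℝ) ∈ Set.Ioi (0 : ℝ) := by simpa using hL
  rw [hsum L hL]
  simp only [Set.indicator_of_mem hp]

/-! ### Convergence of laws on countable spaces -/

/-- On a countable space, pointwise convergence of mass functions to a probability mass function
implies setwise convergence of the laws. -/
theorem tendsto_measureReal_preimage {Ω T : Type*} [MeasurableSpace Ω] {P : Measure Ω}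
    [IsProbabilityMeasure P] [Countable T] [MeasurableSpace T] [MeasurableSingletonClass T]
    {f : ℕ → Ω → T} (hf : ∀ n, Measurable (f n)) (ν : Measure T) [IsProbabilityMeasure ν]
    (h : ∀ x, Tendsto (fun n => P.real (f n ⁻¹' {x})) atTop (𝓝 (ν.real {x}))) (S : Set T) :
    Tendsto (fun n => P.real (f n ⁻¹' S)) atTop (𝓝 (ν.real S)) := by
  have hmap : ∀ n (B : Set T), (P.map (f n)).real B = P.real (f n ⁻¹' B) := fun n B =>
    map_measureReal_apply (hf n) B.to_countable.measurableSet
  have hprob : ∀ n, IsProbabilityMeasure (P.map (f n)) := fun n =>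
    Measure.isProbabilityMeasure_map (hf n).aemeasurable
  -- Finitely many atoms carry all but `ε` of the mass of `B`. Applied to `S` and to `Sᶜ` this gives
  -- both bounds, because `ν` has total mass one and no mass can escape.
  have low : ∀ (B : Set T) (ε : ℝ), 0 < ε → ∀ᶠ n in atTop, ν.real B - ε < P.real (f n ⁻¹' B) := by
    intro B ε hε
    classical
    have hs : Tendsto (fun A : Finset T => (∑ x ∈ A, B.indicator (fun x => ν {x}) x).toReal) atTop
        (𝓝 (ν.real B)) := by
      have h1 := ENNReal.summable.hasSum (f := fun x => B.indicator (fun x => ν {x}) x)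
      rw [Measure.tsum_indicator_apply_singleton ν B B.to_countable.measurableSet] at h1
      exact (ENNReal.tendsto_toReal (measure_ne_top ν B)).comp h1
    obtain ⟨A, hA⟩ := (hs.eventually (lt_mem_nhds (sub_lt_self _ hε))).exists
    have hsum : (∑ x ∈ A, B.indicator (fun x => ν {x}) x).toReal =
        ∑ x ∈ A with x ∈ B, ν.real {x} := by
      simp_rw [Set.indicator_apply, ← Finset.sum_filter]
      rw [ENNReal.toReal_sum fun _ _ => measure_ne_top _ _]
      rfl
    rw [hsum] at hA
    filter_upwards [(tendsto_finsetSum (A.filter (· ∈ B)) fun x _ => h x).eventually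
      (lt_mem_nhds hA)] with n hn
    have := hprob n
    refine hn.trans_le ?_
    simp_rw [← hmap, sum_measureReal_singleton]
    exact measureReal_mono fun x hx => (Finset.mem_filter.1 hx).2
  rw [Metric.tendsto_nhds]
  intro ε hε
  filter_upwards [low S ε hε, low Sᶜ ε hε] with n h1 h2
  have := hprob n
  have e1 := measureReal_compl (μ := ν) (S.to_countable.measurableSet)
  have e2 := measureReal_compl (μ := P.map (f n)) (S.to_countable.measurableSet)
  rw [hmap, hmap, hmap, Set.preimage_univ] at e2
  rw [Real.dist_eq, abs_lt]
  simp only [probReal_univ] at e1 e2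
  constructor <;> linarith

/-! ### Covariances of integrated indicators -/

section Indicator

variable {W T T' : Type*} [MeasurableSpace W] [MeasurableSpace T] [MeasurableSpace T']

theorem integrable_indicator_prod (μ : Measure W) [IsFiniteMeasure μ] (ρ : Measure T) [SFinite ρ]
    {S : Set (W × T)} (hS : MeasurableSet S) {q : T → ℝ} (hq : Integrable q ρ) :
    Integrable (fun z : W × T => {t | (z.1, t) ∈ S}.indicator q z.2) (μ.prod ρ) :=
  (hq.comp_snd μ).indicator hS

theorem integral_integral_indicator (μ : Measure W) [IsFiniteMeasure μ] (ρ : Measure T) [SFinite ρ]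
    {S : Set (W × T)} (hS : MeasurableSet S) {q : T → ℝ} (hq : Integrable q ρ) :
    ∫ w, ∫ t, {t | (w, t) ∈ S}.indicator q t ∂ρ ∂μ = ∫ t, q t * μ.real {w | (w, t) ∈ S} ∂ρ := by
  rw [integral_integral_swap (integrable_indicator_prod μ ρ hS hq)]
  refine integral_congr_ae (ae_of_all _ fun t => ?_)
  have hSt : MeasurableSet {w | (w, t) ∈ S} := (measurable_id.prodMk measurable_const) hS
  have : (fun w => {t | (w, t) ∈ S}.indicator q t) =
      {w | (w, t) ∈ S}.indicator fun _ => q t := by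
    classical
    ext w
    simp only [Set.indicator_apply, Set.mem_ofPred_eq]
  simp only [this]
  rw [integral_indicator hSt, setIntegral_const, smul_eq_mul, mul_comm]

theorem memLp_integral_indicator (μ : Measure W) [IsFiniteMeasure μ] (ρ : Measure T) [SFinite ρ]
    {S : Set (W × T)} (hS : MeasurableSet S) {q : T → ℝ} (hq : Integrable q ρ) (p : ℝ≥0∞) :
    MemLp (fun w => ∫ t, {t | (w, t) ∈ S}.indicator q t ∂ρ) p μ := by
  refine MemLp.of_bound (integrable_indicator_prod μ ρ hS hq).integral_prod_left.1
    (∫ t, ‖q t‖ ∂ρ) (ae_of_all _ fun w => ?_)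
  refine norm_integral_le_of_norm_le hq.norm (ae_of_all _ fun t => ?_)
  exact norm_indicator_le_norm_self _ _

theorem measurable_measureReal_section (μ : Measure W) [SFinite μ] {S : Set (W × T)}
    (hS : MeasurableSet S) : Measurable fun t => μ.real {w | (w, t) ∈ S} :=
  (measurable_measure_prodMk_right hS).ennreal_toReal

theorem measurable_measureReal_inter_sub (μ : Measure W) [SFinite μ] {S : Set (W × T)}
    (hS : MeasurableSet S) {R : Set (W × T')} (hR : MeasurableSet R) :
    Measurable fun z : T × T' => μ.real {w | (w, z.1) ∈ S ∧ (w, z.2) ∈ R} -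
      μ.real {w | (w, z.1) ∈ S} * μ.real {w | (w, z.2) ∈ R} := by
  have hSR : MeasurableSet {z : W × T × T' | (z.1, z.2.1) ∈ S ∧ (z.1, z.2.2) ∈ R} :=
    MeasurableSet.inter ((measurable_fst.prodMk (measurable_fst.comp measurable_snd)) hS)
      ((measurable_fst.prodMk (measurable_snd.comp measurable_snd)) hR)
  exact (measurable_measureReal_section μ hSR).sub
    (((measurable_measureReal_section μ hS).comp measurable_fst).mul
      ((measurable_measureReal_section μ hR).comp measurable_snd))

theorem abs_measureReal_inter_sub_le (μ : Measure W) [IsProbabilityMeasure μ] (A B C : Set W)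
    (hA : A ⊆ B) : |μ.real A - μ.real B * μ.real C| ≤ 1 := by
  have h1 := measureReal_mono (μ := μ) hA
  have h2 : μ.real B ≤ 1 := measureReal_le_one
  have h3 : μ.real C ≤ 1 := measureReal_le_one
  have h4 : 0 ≤ μ.real A := measureReal_nonneg
  have h5 : 0 ≤ μ.real C := measureReal_nonneg
  rw [abs_le]
  constructor <;> nlinarith

/-- Fubini: the product of the two integrals is an integral over pairs of levels of the indicator of
the intersection, whose mean is a joint probability. -/
theorem covariance_integral_indicator (μ : Measure W) [IsProbabilityMeasure μ] (ρ : Measure T)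
    [SFinite ρ] (ρ' : Measure T') [SFinite ρ'] {S : Set (W × T)} (hS : MeasurableSet S)
    {R : Set (W × T')} (hR : MeasurableSet R) {q : T → ℝ} (hq : Integrable q ρ) {r : T' → ℝ}
    (hr : Integrable r ρ') :
    cov[fun w => ∫ s, {s | (w, s) ∈ S}.indicator q s ∂ρ,
        fun w => ∫ t, {t | (w, t) ∈ R}.indicator r t ∂ρ'; μ] =
      ∫ z, q z.1 * r z.2 * (μ.real {w | (w, z.1) ∈ S ∧ (w, z.2) ∈ R} -
        μ.real {w | (w, z.1) ∈ S} * μ.real {w | (w, z.2) ∈ R}) ∂(ρ.prod ρ') := by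
  have hSR : MeasurableSet {z : W × T × T' | (z.1, z.2.1) ∈ S ∧ (z.1, z.2.2) ∈ R} :=
    MeasurableSet.inter ((measurable_fst.prodMk (measurable_fst.comp measurable_snd)) hS)
      ((measurable_fst.prodMk (measurable_snd.comp measurable_snd)) hR)
  have hqr : Integrable (fun z : T × T' => q z.1 * r z.2) (ρ.prod ρ') := hq.mul_prod hr
  rw [covariance_eq_sub (memLp_integral_indicator μ ρ hS hq 2)
    (memLp_integral_indicator μ ρ' hR hr 2), integral_integral_indicator μ ρ hS hq,
    integral_integral_indicator μ ρ' hR hr, ← integral_prod_mul]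
  have h1 : ∀ w, ((fun w => ∫ s, {s | (w, s) ∈ S}.indicator q s ∂ρ) *
      fun w => ∫ t, {t | (w, t) ∈ R}.indicator r t ∂ρ') w =
      ∫ z, {z : T × T' | (w, z) ∈ {z : W × T × T' | (z.1, z.2.1) ∈ S ∧ (z.1, z.2.2) ∈ R}}.indicator
        (fun z => q z.1 * r z.2) z ∂(ρ.prod ρ') := by
    intro w
    rw [Pi.mul_apply, ← integral_prod_mul]
    classical
    refine integral_congr_ae (ae_of_all _ fun z => ?_)
    simp only [Set.indicator_apply, Set.mem_ofPred_eq]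
    split_ifs <;> simp_all
  simp_rw [h1]
  rw [integral_integral_indicator μ (ρ.prod ρ') hSR hqr, ← integral_sub]
  · refine integral_congr_ae (ae_of_all _ fun z => ?_)
    simp only [Set.mem_ofPred_eq]
    ring
  · refine hqr.mul_bdd (c := 1) (measurable_measureReal_section μ hSR).aestronglyMeasurable
      (ae_of_all _ fun z => ?_)
    rw [Real.norm_of_nonneg measureReal_nonneg]
    exact measureReal_le_one
  · refine Integrable.mul_prod (f := fun s => q s * μ.real {w | (w, s) ∈ S})
      (g := fun t => r t * μ.real {w | (w, t) ∈ R}) ?_ ?_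
    · refine hq.mul_bdd (c := 1) (measurable_measureReal_section μ hS).aestronglyMeasurable
        (ae_of_all _ fun z => ?_)
      rw [Real.norm_of_nonneg measureReal_nonneg]
      exact measureReal_le_one
    · refine hr.mul_bdd (c := 1) (measurable_measureReal_section μ hR).aestronglyMeasurable
        (ae_of_all _ fun z => ?_)
      rw [Real.norm_of_nonneg measureReal_nonneg]
      exact measureReal_le_one

/-- A limit of covariance kernels of indicators is positive semidefinite in the integrated sense. -/
theorem sum_integral_kernel_nonneg {ι : Type*} [Fintype ι] (μ : Measure W)
    [IsProbabilityMeasure μ] (ρ : Measure T) [SFinite ρ] {S : ℕ → ι → Set (W × T)}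
    (hS : ∀ n α, MeasurableSet (S n α)) {c : ι → T → ℝ} (hc : ∀ α, Integrable (c α) ρ)
    (κ : ι → ι → T → T → ℝ)
    (hκ : ∀ α β, ∀ᵐ z ∂(ρ.prod ρ), Tendsto (fun n =>
      μ.real {w | (w, z.1) ∈ S n α ∧ (w, z.2) ∈ S n β} -
        μ.real {w | (w, z.1) ∈ S n α} * μ.real {w | (w, z.2) ∈ S n β}) atTop
      (𝓝 (κ α β z.1 z.2))) :
    0 ≤ ∑ α, ∑ β, ∫ z, c α z.1 * c β z.2 * κ α β z.1 z.2 ∂(ρ.prod ρ) := by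
  have hlim : Tendsto (fun n => ∑ α, ∑ β, ∫ z, c α z.1 * c β z.2 *
      (μ.real {w | (w, z.1) ∈ S n α ∧ (w, z.2) ∈ S n β} -
        μ.real {w | (w, z.1) ∈ S n α} * μ.real {w | (w, z.2) ∈ S n β}) ∂(ρ.prod ρ)) atTop
      (𝓝 (∑ α, ∑ β, ∫ z, c α z.1 * c β z.2 * κ α β z.1 z.2 ∂(ρ.prod ρ))) := by
    refine tendsto_finsetSum _ fun α _ => tendsto_finsetSum _ fun β _ => ?_
    have hcc := (hc α).mul_prod (hc β)
    refine tendsto_integral_of_dominated_convergence (fun z => ‖c α z.1 * c β z.2‖) ?_ hcc.norm ?_ ?_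
    · exact fun n => hcc.1.mul
        (measurable_measureReal_inter_sub μ (hS n α) (hS n β)).aestronglyMeasurable
    · refine fun n => ae_of_all _ fun z => ?_
      rw [norm_mul]
      refine mul_le_of_le_one_right (norm_nonneg _) ?_
      exact abs_measureReal_inter_sub_le μ _ _ _ fun w hw => hw.1
    · filter_upwards [hκ α β] with z hz using hz.const_mul _
  -- For fixed `n` the double sum is the variance of one random variable, the sum over `α` of the
  -- integrated indicators.
  refine ge_of_tendsto' hlim fun n => ?_
  simp_rw [← covariance_integral_indicator μ ρ ρ (hS n _) (hS n _) (hc _) (hc _)]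
  rw [← covariance_fun_sum_fun_sum (fun α => memLp_integral_indicator μ ρ (hS n α) (hc α) 2)
    (fun α => memLp_integral_indicator μ ρ (hS n α) (hc α) 2), covariance_self]
  · exact variance_nonneg _ _
  · exact (memLp_finsetSum _ fun α _ => memLp_integral_indicator μ ρ (hS n α) (hc α) 2).1.aemeasurable

end Indicator

/-! ### Existence of laws with given tails -/

/-- Here `a` is the intended mass function of the first coordinate and `g` the intended tail of the
second. On the fibre over `j` the distribution function is `a j - G j x`; domination of its
increments by those of the continuous `g` gives right continuity, and the comparison with `1 - g x`
excludes an atom at `0`. -/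
theorem exists_hasMixedTail {G : ℕ → ℝ → ℝ} {a : ℕ → ℝ} {g : ℝ → ℝ} (ha : ∀ j, 0 ≤ a j)
    (hsum : HasSum a 1) (hg : Continuous g) (hg0 : g 0 = 1) (hginf : Tendsto g atTop (𝓝 0))
    (hG0 : ∀ j x, 0 < x → 0 ≤ G j x) (hGg : ∀ j x, 0 < x → G j x ≤ g x)
    (hanti : ∀ j x y, 0 < x → x ≤ y → G j y ≤ G j x)
    (hlip : ∀ j x y, 0 < x → x ≤ y → G j x - G j y ≤ g x - g y)
    (hGa : ∀ j x, 0 < x → G j x ≤ a j) (haG : ∀ j x, 0 < x → a j - G j x ≤ 1 - g x) :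
    ∃ μ, HasMixedTail G μ ∧ ∀ j, μ ({j} ×ˢ Set.univ) = ENNReal.ofReal (a j) := by
  let f : ℕ → StieltjesFunction ℝ := fun j =>
    { toFun := fun x => if x ≤ 0 then 0 else a j - G j x
      mono' := by
        intro x y hxy
        simp only
        split_ifs with h1 h2 h2
        · exact le_rfl
        · have := hGa j y (not_le.1 h2); linarith
        · exact absurd (hxy.trans h2) h1
        · have := hanti j x y (not_le.1 h1) hxy; linarith
      right_continuous' := by
        intro x
        have hgx : Tendsto g (𝓝[Set.Ici x] x) (𝓝 (g x)) := hg.continuousAt.continuousWithinAt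
        rcases lt_trichotomy x 0 with hx | rfl | hx
        · refine ContinuousAt.continuousWithinAt ?_
          refine continuousAt_const.congr (f := fun _ => (0 : ℝ)) ?_
          filter_upwards [Iio_mem_nhds hx] with y hy
          rw [if_pos (le_of_lt hy)]
        · rw [ContinuousWithinAt, if_pos le_rfl]
          refine tendsto_of_tendsto_of_tendsto_of_le_of_le' tendsto_const_nhds
            (h := fun y => 1 - g y) (g := fun _ => (0 : ℝ)) ?_ ?_ ?_
          · have := hgx.const_sub 1
            rwa [hg0, sub_self] at this
          · filter_upwards with y
            split_ifs with h
            · exact le_rfl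
            · have := hGa j y (not_le.1 h); linarith
          · filter_upwards [self_mem_nhdsWithin] with y hy
            split_ifs with h
            · rw [le_antisymm h hy, hg0, sub_self]
            · exact haG j y (not_le.1 h)
        · rw [ContinuousWithinAt, if_neg (not_le.2 hx)]
          refine tendsto_of_tendsto_of_tendsto_of_le_of_le' tendsto_const_nhds
            (h := fun y => a j - G j x + (g x - g y)) (g := fun _ => a j - G j x) ?_ ?_ ?_
          · have := (hgx.const_sub (g x)).const_add (a j - G j x)
            rwa [sub_self, add_zero] at this
          · filter_upwards [self_mem_nhdsWithin] with y hy
            rw [if_neg (not_le.2 (hx.trans_le hy))]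
            have := hanti j x y hx hy; linarith
          · filter_upwards [self_mem_nhdsWithin] with y hy
            rw [if_neg (not_le.2 (hx.trans_le hy))]
            have := hlip j x y hx hy; linarith }
  have hf : ∀ j x, f j x = if x ≤ 0 then 0 else a j - G j x := fun _ _ => rfl
  have hbot : ∀ j, Tendsto (f j) atBot (𝓝 0) := fun j =>
    tendsto_const_nhds.congr' (by
      filter_upwards [eventually_le_atBot 0] with x hx
      rw [hf, if_pos hx])
  have htop : ∀ j, Tendsto (f j) atTop (𝓝 (a j)) := by
    intro j
    have h1 : Tendsto (fun x => G j x) atTop (𝓝 0) := by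
      refine tendsto_of_tendsto_of_tendsto_of_le_of_le' tendsto_const_nhds hginf ?_ ?_
      · filter_upwards [eventually_gt_atTop 0] with x hx using hG0 j x hx
      · filter_upwards [eventually_gt_atTop 0] with x hx using hGg j x hx
    have h2 := h1.const_sub (a j)
    rw [sub_zero] at h2
    refine h2.congr' ?_
    filter_upwards [eventually_gt_atTop 0] with x hx
    rw [hf, if_neg (not_le.2 hx)]
  have hmk : ∀ j : ℕ, Measurable (Prod.mk j : ℝ → ℕ × ℝ) := fun j => measurable_prodMk_left
  let μ : Measure (ℕ × ℝ) := Measure.sum fun j => (f j).measure.map (Prod.mk j)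
  have hμ : ∀ (j : ℕ) (A : Set ℝ), MeasurableSet A → μ ({j} ×ˢ A) = (f j).measure A := by
    intro j A hA
    have hm : MeasurableSet (({j} : Set ℕ) ×ˢ A) := (measurableSet_singleton j).prod hA
    rw [Measure.sum_apply _ hm, tsum_eq_single j]
    · rw [Measure.map_apply (hmk j) hm]
      congr 1
      ext x
      simp
    · intro i hi
      rw [Measure.map_apply (hmk i) hm]
      have : Prod.mk i ⁻¹' (({j} : Set ℕ) ×ˢ A) = ∅ := by
        ext x
        simp [hi]
      rw [this, measure_empty]
  have hμu : ∀ (A : Set ℝ), MeasurableSet A → μ (Set.univ ×ˢ A) = ∑' j, (f j).measure A := by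
    intro A hA
    have hm : MeasurableSet ((Set.univ : Set ℕ) ×ˢ A) := MeasurableSet.univ.prod hA
    rw [Measure.sum_apply _ hm]
    refine tsum_congr fun j => ?_
    rw [Measure.map_apply (hmk j) hm]
    congr 1
    ext x
    simp
  refine ⟨μ, ⟨⟨?_⟩, ?_, ?_⟩, ?_⟩
  · rw [← Set.univ_prod_univ, hμu _ MeasurableSet.univ]
    simp_rw [fun j => (f j).measure_univ (hbot j) (htop j), sub_zero]
    rw [← ENNReal.ofReal_tsum_of_nonneg ha hsum.summable, hsum.tsum_eq, ENNReal.ofReal_one]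
  · rw [hμu _ measurableSet_Iic]
    simp_rw [fun j => (f j).measure_Iic (hbot j) 0]
    simp [hf]
  · intro j x hx
    rw [hμ j _ measurableSet_Ioi, (f j).measure_Ioi (htop j), hf, if_neg (not_le.2 hx)]
    congr 1
    ring
  · intro j
    rw [hμ j _ MeasurableSet.univ, (f j).measure_univ (hbot j) (htop j), sub_zero]

theorem expMeasure_Ioi {θ : ℝ} (hθ : 0 < θ) {x : ℝ} (hx : 0 ≤ x) :
    expMeasure θ (Set.Ioi x) = ENNReal.ofReal (Real.exp (-(θ * x))) := by
  have := isProbabilityMeasure_expMeasure hθ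
  have h := cdf_expMeasure_eq hθ x
  rw [if_pos hx, cdf_eq_real] at h
  have h2 := measureReal_compl (μ := expMeasure θ) (measurableSet_Iic (a := x))
  rw [Set.compl_Iic, h, probReal_univ] at h2
  rw [← ofReal_measureReal, h2]
  congr 1
  ring

/-- The Marshall–Olkin bivariate exponential law. -/
theorem exists_hasSurvival {θ ξ : ℝ} (hθ : 0 < θ) (h0 : 0 < ξ) (h1 : ξ < 1) :
    ∃ μ, HasSurvival (survival₂ θ ξ) μ ∧ ∀ x y : ℝ, 0 ≤ x → 0 ≤ y →
      μ (Set.Ioi x ×ˢ Set.Ioi y) = ENNReal.ofReal (survival₂ θ ξ x y) := by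
  have hξ : 0 < θ * ξ := mul_pos hθ h0
  have hξ' : 0 < θ * (1 - ξ) := mul_pos hθ (sub_pos.2 h1)
  have := isProbabilityMeasure_expMeasure hξ
  have := isProbabilityMeasure_expMeasure hξ'
  -- Two individual shocks of rate `θ * ξ` and a common shock of rate `θ * (1 - ξ)`. All rates must
  -- be positive, hence the open range of `ξ`.
  let ν := ((expMeasure (θ * ξ)).prod (expMeasure (θ * ξ))).prod (expMeasure (θ * (1 - ξ)))
  let φ : (ℝ × ℝ) × ℝ → ℝ × ℝ := fun w => (min w.1.1 w.2, min w.1.2 w.2)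
  have hφ : Measurable φ := by fun_prop
  have key : ∀ x y : ℝ, 0 ≤ x → 0 ≤ y → (ν.map φ) (Set.Ioi x ×ˢ Set.Ioi y) =
      ENNReal.ofReal (survival₂ θ ξ x y) := by
    intro x y hx hy
    rw [Measure.map_apply hφ (measurableSet_Ioi.prod measurableSet_Ioi)]
    have : φ ⁻¹' (Set.Ioi x ×ˢ Set.Ioi y) =
        (Set.Ioi x ×ˢ Set.Ioi y) ×ˢ Set.Ioi (max x y) := by
      ext w
      simp only [φ, Set.mem_preimage, Set.mem_prod, Set.mem_Ioi, lt_min_iff, max_lt_iff]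
      tauto
    rw [this, Measure.prod_prod, Measure.prod_prod, expMeasure_Ioi hξ hx, expMeasure_Ioi hξ hy,
      expMeasure_Ioi hξ' (hx.trans (le_max_left _ _)), ← ENNReal.ofReal_mul (Real.exp_nonneg _),
      ← ENNReal.ofReal_mul (by positivity), ← Real.exp_add, ← Real.exp_add, survival₂]
    congr 2
    have := min_add_max x y
    linear_combination (θ * ξ) * this
  have hp : IsProbabilityMeasure (ν.map φ) := Measure.isProbabilityMeasure_map hφ.aemeasurable
  refine ⟨ν.map φ, ⟨hp, ?_, fun x y hx hy => key x y hx.le hy.le⟩, key⟩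
  rw [prob_compl_eq_zero_iff (measurableSet_Ioi.prod measurableSet_Ioi), key 0 0 le_rfl le_rfl]
  simp [survival₂]

/-! ### Laws on `ℕ × ℕ` and compound Poisson pairs -/

theorem lawOfMass_singleton (q : ℕ → ℕ → ℝ) (w : ℕ × ℕ) :
    lawOfMass q {w} = ENNReal.ofReal (q w.1 w.2) := by
  rw [lawOfMass, Measure.sum_apply _ (measurableSet_singleton w), tsum_eq_single w]
  · simp
  · intro v hv
    simp [hv]

theorem lawOfMass_univ (q : ℕ → ℕ → ℝ) :
    lawOfMass q Set.univ = ∑' w : ℕ × ℕ, ENNReal.ofReal (q w.1 w.2) := by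
  rw [lawOfMass, Measure.sum_apply _ MeasurableSet.univ]
  simp

theorem eq_lawOfMass {q : ℕ → ℕ → ℝ} {μ : Measure (ℕ × ℕ)}
    (h : ∀ i j, μ {(i, j)} = ENNReal.ofReal (q i j)) : μ = lawOfMass q :=
  Measure.ext_of_singleton fun w => by rw [lawOfMass_singleton, ← h]

/-- The antidiagonals partition `ℕ × ℕ`. This yields that the total mass of a convolution is the
product of the total masses. -/
theorem tsum_tsum_antidiagonal (F : ℕ → ℕ → ℕ → ℕ → ℝ≥0∞) :
    ∑' (i : ℕ) (j : ℕ), ∑ a ∈ Finset.HasAntidiagonal.antidiagonal i,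
      ∑ c ∈ Finset.HasAntidiagonal.antidiagonal j, F a.1 c.1 a.2 c.2 =
    ∑' (i : ℕ) (j : ℕ) (i' : ℕ) (j' : ℕ), F i j i' j' := by
  have key : ∀ g : ℕ × ℕ → ℝ≥0∞,
      ∑' i : ℕ, ∑ a ∈ Finset.HasAntidiagonal.antidiagonal i, g a = ∑' a : ℕ × ℕ, g a := by
    intro g
    rw [← Finset.HasAntidiagonal.sigmaAntidiagonalEquivProd.tsum_eq g, ENNReal.tsum_sigma']
    refine tsum_congr fun i => ?_
    rw [← Finset.tsum_subtype (Finset.HasAntidiagonal.antidiagonal i) g]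
    rfl
  have h1 : ∀ i : ℕ, ∑' j : ℕ, ∑ a ∈ Finset.HasAntidiagonal.antidiagonal i,
      ∑ c ∈ Finset.HasAntidiagonal.antidiagonal j, F a.1 c.1 a.2 c.2 =
      ∑ a ∈ Finset.HasAntidiagonal.antidiagonal i, ∑' c : ℕ × ℕ, F a.1 c.1 a.2 c.2 := by
    intro i
    rw [Summable.tsum_finsetSum fun _ _ => ENNReal.summable]
    exact Finset.sum_congr rfl fun a _ => key fun c => F a.1 c.1 a.2 c.2
  simp_rw [h1]
  rw [key fun a => ∑' c : ℕ × ℕ, F a.1 c.1 a.2 c.2, ENNReal.tsum_prod']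
  refine tsum_congr fun i => ?_
  simp_rw [ENNReal.tsum_prod']
  rw [ENNReal.tsum_comm]

/-! ### Convolution powers and total mass of compound Poisson pairs. -/

theorem convPow₂_nonneg {f : ℕ → ℕ → ℝ} (hf : IsClusterMass₂ f) (k i j : ℕ) :
    0 ≤ convPow₂ f k i j := by
  induction k generalizing i j with
  | zero => rw [convPow₂]; split_ifs <;> norm_num
  | succ k ih =>
    rw [convPow₂]
    exact Finset.sum_nonneg fun a _ => Finset.sum_nonneg fun c _ =>
      mul_nonneg (ih _ _) (hf.nonneg _ _)

/-- Each summand has first coordinate at least `1` and at least its second coordinate; both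
properties add up. Hence the sum over `k` in the compound Poisson mass stops at `i`. -/
theorem convPow₂_eq_zero {f : ℕ → ℕ → ℝ} (hf : IsClusterMass₂ f) {k i j : ℕ} (h : i < j ∨ i < k) :
    convPow₂ f k i j = 0 := by
  induction k generalizing i j with
  | zero => rw [convPow₂, if_neg (by omega)]
  | succ k ih =>
    rw [convPow₂]
    refine Finset.sum_eq_zero fun a ha => Finset.sum_eq_zero fun c hc => ?_
    rw [Finset.HasAntidiagonal.mem_antidiagonal] at ha hc
    by_cases h1 : a.1 < c.1 ∨ a.1 < k
    · rw [ih h1, zero_mul]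
    by_cases h2 : a.2 < c.2
    · rw [hf.zero_of_lt _ _ h2, mul_zero]
    have h3 : a.2 = 0 := by omega
    have h4 : c.2 = 0 := by omega
    rw [h3, h4, hf.zero_zero, mul_zero]

theorem tsum_convPow₂ {f : ℕ → ℕ → ℝ} (hf : IsClusterMass₂ f) (k : ℕ) :
    ∑' (i : ℕ) (j : ℕ), ENNReal.ofReal (convPow₂ f k i j) = 1 := by
  induction k with
  | zero =>
    rw [tsum_eq_single 0, tsum_eq_single 0]
    · simp [convPow₂]
    · intro j hj
      simp [convPow₂, hj]
    · intro i hi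
      simp [convPow₂, hi]
  | succ k ih =>
    have h1 : ∀ i j : ℕ, ENNReal.ofReal (convPow₂ f (k + 1) i j) =
        ∑ a ∈ Finset.HasAntidiagonal.antidiagonal i, ∑ c ∈ Finset.HasAntidiagonal.antidiagonal j,
          ENNReal.ofReal (convPow₂ f k a.1 c.1) * ENNReal.ofReal (f a.2 c.2) := by
      intro i j
      rw [convPow₂, ENNReal.ofReal_sum_of_nonneg fun a _ => Finset.sum_nonneg fun c _ =>
        mul_nonneg (convPow₂_nonneg hf _ _ _) (hf.nonneg _ _)]
      refine Finset.sum_congr rfl fun a _ => ?_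
      rw [ENNReal.ofReal_sum_of_nonneg fun c _ =>
        mul_nonneg (convPow₂_nonneg hf _ _ _) (hf.nonneg _ _)]
      exact Finset.sum_congr rfl fun c _ => ENNReal.ofReal_mul (convPow₂_nonneg hf _ _ _)
    have h2 : ∑' (i : ℕ) (j : ℕ), ENNReal.ofReal (f i j) = 1 := by
      rw [← ENNReal.tsum_prod (f := fun i j => ENNReal.ofReal (f i j)),
        ← ENNReal.ofReal_tsum_of_nonneg (f := fun w : ℕ × ℕ => f w.1 w.2)
          (fun w => hf.nonneg w.1 w.2) hf.hasSum.summable,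
        hf.hasSum.tsum_eq, ENNReal.ofReal_one]
    simp_rw [h1]
    rw [tsum_tsum_antidiagonal fun i j i' j' =>
      ENNReal.ofReal (convPow₂ f k i j) * ENNReal.ofReal (f i' j')]
    simp_rw [ENNReal.tsum_mul_left, h2, mul_one, ih]

/-- The case distinction disappears once `k = 0` is included: that term is the unit mass at the
origin, and below the diagonal all convolution powers vanish. -/
theorem cpMass₂_eq_sum {θ : ℝ} {π₂ : ℝ → ℕ → ℕ → ℝ} {τ₁ τ₂ : ℝ}
    (hf : IsClusterMass₂ (π₂ (τ₂ / τ₁))) (i j : ℕ) :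
    cpMass₂ θ π₂ τ₁ τ₂ i j = ∑ k ∈ Finset.range (i + 1),
      Real.exp (-(θ * τ₁)) * (θ * τ₁) ^ k / (k.factorial : ℝ) * convPow₂ (π₂ (τ₂ / τ₁)) k i j := by
  rw [cpMass₂]
  split_ifs with h1 h2
  · exact (Finset.sum_eq_zero fun k _ => by rw [convPow₂_eq_zero hf (Or.inl h1), mul_zero]).symm
  · subst h2
    have : j = 0 := by omega
    simp [this, convPow₂]
  · rw [Finset.range_eq_Ico, Finset.sum_eq_sum_Ico_succ_bot (Nat.succ_pos i), Finset.mul_sum]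
    simp only [convPow₂, h2, false_and, if_false, mul_zero, zero_add]
    refine Finset.sum_congr (by ext; simp) fun k _ => ?_
    ring

theorem cpMass₂_nonneg {θ : ℝ} (hθ : 0 ≤ θ) {π₂ : ℝ → ℕ → ℕ → ℝ} {τ₁ τ₂ : ℝ} (hτ : 0 ≤ τ₁)
    (hf : IsClusterMass₂ (π₂ (τ₂ / τ₁))) (i j : ℕ) : 0 ≤ cpMass₂ θ π₂ τ₁ τ₂ i j := by
  rw [cpMass₂_eq_sum hf]
  exact Finset.sum_nonneg fun k _ => mul_nonneg (by positivity) (convPow₂_nonneg hf _ _ _)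

theorem isProbabilityMeasure_lawOfMass_cpMass₂ {θ : ℝ} (hθ : 0 ≤ θ) {π₂ : ℝ → ℕ → ℕ → ℝ}
    {τ₁ τ₂ : ℝ} (hτ : 0 ≤ τ₁) (hf : IsClusterMass₂ (π₂ (τ₂ / τ₁))) :
    IsProbabilityMeasure (lawOfMass (cpMass₂ θ π₂ τ₁ τ₂)) := by
  constructor
  rw [lawOfMass_univ, ENNReal.tsum_prod']
  have h1 : ∀ i j : ℕ, ENNReal.ofReal (cpMass₂ θ π₂ τ₁ τ₂ i j) =
      ∑' k : ℕ, ENNReal.ofReal (Real.exp (-(θ * τ₁)) * (θ * τ₁) ^ k / (k.factorial : ℝ)) *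
        ENNReal.ofReal (convPow₂ (π₂ (τ₂ / τ₁)) k i j) := by
    intro i j
    rw [cpMass₂_eq_sum hf, ENNReal.ofReal_sum_of_nonneg fun k _ =>
      mul_nonneg (by positivity) (convPow₂_nonneg hf _ _ _), tsum_eq_sum]
    · exact Finset.sum_congr rfl fun k _ => ENNReal.ofReal_mul (by positivity)
    · intro k hk
      rw [convPow₂_eq_zero hf (Or.inr (by simpa using hk)), ENNReal.ofReal_zero, mul_zero]
  simp_rw [h1]
  rw [tsum_congr fun i => ENNReal.tsum_comm, ENNReal.tsum_comm]
  simp_rw [ENNReal.tsum_mul_left, tsum_convPow₂ hf, mul_one]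
  have h2 : HasSum (fun k : ℕ => Real.exp (-(θ * τ₁)) * (θ * τ₁) ^ k / (k.factorial : ℝ)) 1 := by
    have h3 : HasSum (fun k : ℕ => (θ * τ₁) ^ k / (k.factorial : ℝ)) (Real.exp (θ * τ₁)) := by
      rw [Real.exp_eq_exp_ℝ]
      exact NormedSpace.expSeries_div_hasSum_exp (θ * τ₁)
    have h4 := h3.mul_left (Real.exp (-(θ * τ₁)))
    rw [← Real.exp_add, neg_add_cancel, Real.exp_zero] at h4
    simpa only [mul_div_assoc] using h4
  rw [← ENNReal.ofReal_tsum_of_nonneg (fun k => by positivity) h2.summable, h2.tsum_eq,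
    ENNReal.ofReal_one]

/-! ### Exceedances -/

section Exceedances

variable {Ω : Type*} [MeasurableSpace Ω] {P : Measure Ω} {X : ℤ → Ω → ℝ}

theorem threshold_antitone (P : Measure Ω) (X : ℤ → Ω → ℝ) (n : ℕ) :
    Antitone (threshold P X n) := by
  intro τ τ' h
  refine sInf_le_sInf (Set.image_mono fun x hx => ?_)
  have : τ / n ≤ τ' / n := by gcongr
  simp only [Set.mem_ofPred_eq] at hx ⊢
  linarith

theorem exceedances_mono (n : ℕ) {τ τ' : ℝ} (h : τ ≤ τ') (B : Set ℝ) (ω : Ω) :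
    exceedances P X n τ B ω ≤ exceedances P X n τ' B ω := by
  refine Finset.sum_le_sum fun t _ => ?_
  refine Set.indicator_le_indicator_of_subset (fun ω hω => ?_) (fun _ => Nat.zero_le _) ω
  exact ⟨hω.1, (threshold_antitone P X n h).trans_lt hω.2⟩

theorem exceedances_add_of_le (n : ℕ) (τ : ℝ) {a b c : ℝ} (hab : a ≤ b) (hbc : b ≤ c) (ω : Ω) :
    exceedances P X n τ (Set.Ioc a b) ω + exceedances P X n τ (Set.Ioc b c) ω =
      exceedances P X n τ (Set.Ioc a c) ω := by
  classical
  rw [exceedances, exceedances, exceedances, ← Finset.sum_add_distrib]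
  refine Finset.sum_congr rfl fun t _ => ?_
  simp only [Set.indicator_apply, Set.mem_ofPred_eq, Set.mem_Ioc]
  by_cases ht : threshold P X n τ < (X (t : ℤ) ω : EReal)
  · simp only [ht, and_true]
    rcases le_or_gt ((t : ℝ) / n) a with h1 | h1
    · simp [h1.not_gt, (h1.trans hab).not_gt]
    · rcases le_or_gt ((t : ℝ) / n) b with h2 | h2
      · simp [h1, h2, h2.not_gt, h2.trans hbc]
      · simp [h1, h2, h2.not_ge]
  · simp [ht]

/-- Joint measurability in the sample point and the level, required for integrating over levels; the
threshold is monotone in the level and therefore Borel. -/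
theorem measurable_exceedances_uncurry (hX : ∀ t, Measurable (X t)) (n : ℕ) (B : Set ℝ) :
    Measurable fun z : Ω × ℝ => exceedances P X n z.2 B z.1 := by
  refine Finset.measurable_sum _ fun t _ => ?_
  have hs : MeasurableSet {z : Ω × ℝ | (t : ℝ) / n ∈ B ∧
      threshold P X n z.2 < (X (t : ℤ) z.1 : EReal)} := by
    refine MeasurableSet.inter (MeasurableSet.const _) ?_
    exact measurableSet_lt ((threshold_antitone P X n).measurable.comp measurable_snd)
      (measurable_coe_real_ereal.comp ((hX t).comp measurable_fst))
  exact (measurable_const (a := (1 : ℕ))).indicator hs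

theorem measurable_exceedances (hX : ∀ t, Measurable (X t)) (n : ℕ) (τ : ℝ) (B : Set ℝ) :
    Measurable fun ω => exceedances P X n τ B ω := by
  refine Finset.measurable_sum _ fun t _ => measurable_const.indicator ?_
  exact (MeasurableSet.const _).inter
    (measurableSet_lt measurable_const (measurable_coe_real_ereal.comp (hX t)))

end Exceedances

/-! ### Joint limit laws of counts -/

/-- The data of a series whose exceedances have one- and two-level compound Poisson limits. -/
structure HasClusterLimits {Ω : Type*} [MeasurableSpace Ω] (P : Measure Ω) (X : ℤ → Ω → ℝ)
    (θ : ℝ) (π : ℕ → ℝ) (π₂ : ℝ → ℕ → ℕ → ℝ) : Prop where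
  prob : IsProbabilityMeasure P
  measurable : ∀ t, Measurable (X t)
  pos : 0 < θ
  clusterMass₂ : ∀ σ ∈ Set.Icc (0 : ℝ) 1, IsClusterMass₂ (π₂ σ)
  oneLevel : OneLevelLimit P X θ π
  twoLevel : TwoLevelLimit P X θ π₂

namespace HasClusterLimits

variable {Ω : Type*} [MeasurableSpace Ω] {P : Measure Ω} {X : ℤ → Ω → ℝ} {θ : ℝ} {π : ℕ → ℝ}
  {π₂ : ℝ → ℕ → ℕ → ℝ}

/-- For `s = 0` the ratio of the levels is `0 / 0`, which evaluates to `0` and so still lies in `[0,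
1]`. -/
theorem isProbabilityMeasure_pair (h : HasClusterLimits P X θ π π₂) {s τ₁ τ₂ : ℝ} (hs : 0 ≤ s)
    (h1 : 0 ≤ τ₁) (h2 : 0 ≤ τ₂) (h12 : τ₂ ≤ τ₁) :
    IsProbabilityMeasure (lawOfMass (cpMass₂ θ π₂ (s * τ₁) (s * τ₂))) := by
  refine isProbabilityMeasure_lawOfMass_cpMass₂ h.pos.le (mul_nonneg hs h1)
    (h.clusterMass₂ _ ⟨by positivity, ?_⟩)
  exact div_le_one_of_le₀ (by gcongr) (by positivity)

theorem cpMass₂_nonneg (h : HasClusterLimits P X θ π π₂) {s τ₁ τ₂ : ℝ} (hs : 0 ≤ s)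
    (h1 : 0 ≤ τ₁) (h2 : 0 ≤ τ₂) (h12 : τ₂ ≤ τ₁) (i j : ℕ) :
    0 ≤ cpMass₂ θ π₂ (s * τ₁) (s * τ₂) i j := by
  refine SlidingBlocks.cpMass₂_nonneg h.pos.le (mul_nonneg hs h1)
    (h.clusterMass₂ _ ⟨by positivity, ?_⟩) _ _
  exact div_le_one_of_le₀ (by gcongr) (by positivity)

/-- Convergence of point masses to a probability law extends to all events, here with the product
law that expresses independence over disjoint intervals. -/
theorem tendsto_pi (h : HasClusterLimits P X θ π π₂) {τ₁ τ₂ : ℝ} (h1 : 0 < τ₁) (h2 : 0 ≤ τ₂)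
    (h12 : τ₂ ≤ τ₁) {r : ℕ} {l u : Fin r → ℝ} (hlu : DisjointIntervals l u)
    (S : Set (Fin r → ℕ × ℕ)) :
    Tendsto (fun n : ℕ => P.real {ω | (fun i => (exceedances P X n τ₁ (Set.Ioc (l i) (u i)) ω,
      exceedances P X n τ₂ (Set.Ioc (l i) (u i)) ω)) ∈ S}) atTop
      (𝓝 ((Measure.pi fun i => lawOfMass
        (cpMass₂ θ π₂ ((u i - l i) * τ₁) ((u i - l i) * τ₂))).real S)) := by
  have hlen : ∀ i, 0 ≤ u i - l i := fun i => sub_nonneg.2 (hlu.1 i).2.1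
  have := h.prob
  have := fun i => h.isProbabilityMeasure_pair (hlen i) h1.le h2 h12
  refine tendsto_measureReal_preimage (f := fun n ω i =>
    (exceedances P X n τ₁ (Set.Ioc (l i) (u i)) ω, exceedances P X n τ₂ (Set.Ioc (l i) (u i)) ω))
    (fun n => measurable_pi_lambda _ fun i => (measurable_exceedances h.measurable n _ _).prodMk
      (measurable_exceedances h.measurable n _ _)) _ (fun x => ?_) S
  have hx := h.twoLevel τ₁ τ₂ h1 h2 h12 r l u hlu (fun i => (x i).1) fun i => (x i).2
  have hpi : (Measure.pi fun i => lawOfMass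
      (cpMass₂ θ π₂ ((u i - l i) * τ₁) ((u i - l i) * τ₂))).real {x} =
      ∏ i, cpMass₂ θ π₂ ((u i - l i) * τ₁) ((u i - l i) * τ₂) (x i).1 (x i).2 := by
    rw [measureReal_def, ← Set.univ_pi_singleton, Measure.pi_pi, ENNReal.toReal_prod]
    refine Finset.prod_congr rfl fun i _ => ?_
    rw [lawOfMass_singleton, ENNReal.toReal_ofReal (h.cpMass₂_nonneg (hlen i) h1.le h2 h12 _ _)]
  rw [hpi]
  refine hx.congr fun n => ?_
  congr 1
  ext ω
  simp only [Set.mem_ofPred_eq, Set.mem_preimage, Set.mem_singleton_iff, funext_iff, Prod.ext_iff]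

theorem tendsto_pair (h : HasClusterLimits P X θ π π₂) {τ₁ τ₂ : ℝ} (h1 : 0 < τ₁) (h2 : 0 ≤ τ₂)
    (h12 : τ₂ ≤ τ₁) {a b : ℝ} (ha : 0 ≤ a) (hab : a ≤ b) (hb : b ≤ 1) (S : Set (ℕ × ℕ)) :
    Tendsto (fun n : ℕ => P.real {ω | (exceedances P X n τ₁ (Set.Ioc a b) ω,
      exceedances P X n τ₂ (Set.Ioc a b) ω) ∈ S}) atTop
      (𝓝 ((lawOfMass (cpMass₂ θ π₂ ((b - a) * τ₁) ((b - a) * τ₂))).real S)) := by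
  have hlu : DisjointIntervals (fun _ : Fin 1 => a) (fun _ => b) :=
    ⟨fun _ => ⟨ha, hab, hb⟩, fun i j hij => absurd (Subsingleton.elim i j) hij⟩
  have hlen : 0 ≤ b - a := sub_nonneg.2 hab
  have := h.isProbabilityMeasure_pair hlen h1.le h2 h12
  have hlim := h.tendsto_pi h1 h2 h12 hlu (Set.univ.pi fun _ => S)
  rw [measureReal_def, Measure.pi_pi, Fin.prod_univ_one] at hlim
  refine hlim.congr fun n => ?_
  congr 1
  ext ω
  simp

theorem tendsto_single (h : HasClusterLimits P X θ π π₂) {τ : ℝ} (hτ : 0 < τ) {a b : ℝ}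
    (ha : 0 ≤ a) (hab : a ≤ b) (hb : b ≤ 1) (j : ℕ) :
    Tendsto (fun n : ℕ => P.real {ω | exceedances P X n τ (Set.Ioc a b) ω = j}) atTop
      (𝓝 (cpMass θ π ((b - a) * τ) j)) := by
  have hlu : DisjointIntervals (fun _ : Fin 1 => a) (fun _ => b) :=
    ⟨fun _ => ⟨ha, hab, hb⟩, fun i j hij => absurd (Subsingleton.elim i j) hij⟩
  have hlim := h.oneLevel τ hτ 1 _ _ hlu fun _ => j
  rw [Fin.prod_univ_one] at hlim
  refine hlim.congr fun n => ?_
  congr 1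
  ext ω
  simp

/-- The same probabilities converge by the two-level and by the one-level limit; uniqueness of
limits ties `π₂` to `π`. -/
theorem lawOfMass_cpMass₂_fst (h : HasClusterLimits P X θ π π₂) {s τ₁ τ₂ : ℝ} (h1 : 0 < τ₁)
    (h2 : 0 ≤ τ₂) (h12 : τ₂ ≤ τ₁) (hs : 0 ≤ s) (hs1 : s ≤ 1) (j : ℕ) :
    (lawOfMass (cpMass₂ θ π₂ (s * τ₁) (s * τ₂))).real {w | w.1 = j} = cpMass θ π (s * τ₁) j := by
  have l1 := h.tendsto_pair h1 h2 h12 le_rfl hs hs1 {w | w.1 = j}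
  have l2 := h.tendsto_single h1 le_rfl hs hs1 j
  rw [sub_zero] at l1 l2
  exact tendsto_nhds_unique l1 l2

theorem lawOfMass_cpMass₂_snd (h : HasClusterLimits P X θ π π₂) {s τ₁ τ₂ : ℝ} (h2 : 0 < τ₂)
    (h12 : τ₂ ≤ τ₁) (hs : 0 ≤ s) (hs1 : s ≤ 1) (j : ℕ) :
    (lawOfMass (cpMass₂ θ π₂ (s * τ₁) (s * τ₂))).real {w | w.2 = j} = cpMass θ π (s * τ₂) j := by
  have l1 := h.tendsto_pair (h2.trans_le h12) h2.le h12 le_rfl hs hs1 {w | w.2 = j}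
  have l2 := h.tendsto_single h2 le_rfl hs hs1 j
  rw [sub_zero] at l1 l2
  exact tendsto_nhds_unique l1 l2

/-- The joint law of the two-level counts in three disjoint intervals of relative lengths
`ξ`, `1 - ξ`, `ξ`. -/
noncomputable def _root_.SlidingBlocks.tripleLaw (θ : ℝ) (π₂ : ℝ → ℕ → ℕ → ℝ) (ξ τ₁ τ₂ : ℝ) :
    Measure (Fin 3 → ℕ × ℕ) :=
  Measure.pi fun i => lawOfMass
    (cpMass₂ θ π₂ ((![ξ, 1 - ξ, ξ] : Fin 3 → ℝ) i * τ₁) ((![ξ, 1 - ξ, ξ] : Fin 3 → ℝ) i * τ₂))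

theorem isProbabilityMeasure_pair_vec (h : HasClusterLimits P X θ π π₂) {ξ τ₁ τ₂ : ℝ}
    (hξ : 0 ≤ ξ) (hξ1 : ξ ≤ 1) (h2 : 0 < τ₂) (h12 : τ₂ ≤ τ₁) (i : Fin 3) :
    IsProbabilityMeasure (lawOfMass (cpMass₂ θ π₂ ((![ξ, 1 - ξ, ξ] : Fin 3 → ℝ) i * τ₁)
      ((![ξ, 1 - ξ, ξ] : Fin 3 → ℝ) i * τ₂))) := by
  refine h.isProbabilityMeasure_pair ?_ (h2.trans_le h12).le h2.le h12
  fin_cases i <;> simp <;> linarith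

theorem isProbabilityMeasure_tripleLaw (h : HasClusterLimits P X θ π π₂) {ξ τ₁ τ₂ : ℝ}
    (hξ : 0 ≤ ξ) (hξ1 : ξ ≤ 1) (h2 : 0 < τ₂) (h12 : τ₂ ≤ τ₁) :
    IsProbabilityMeasure (tripleLaw θ π₂ ξ τ₁ τ₂) := by
  have := fun i => h.isProbabilityMeasure_pair_vec hξ hξ1 h2 h12 i
  rw [tripleLaw]
  infer_instance

/-- The first coordinate of each pair is the count at the higher level `τ'`. The left part enters
only at level `τ`, the right part only at `τ'`, the overlap at both. The event is split by the left
count `l` and the higher-level count `r` in the overlap. -/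
theorem tripleLaw_real (h : HasClusterLimits P X θ π π₂) {ξ τ τ' : ℝ}
    (hξ : 0 ≤ ξ) (hξ1 : ξ ≤ 1) (hτ : 0 < τ) (hττ' : τ ≤ τ') (j j' : ℕ) :
    (tripleLaw θ π₂ ξ τ' τ).real {x | ((x 0).2 + (x 1).2, (x 1).1 + (x 2).1) = (j, j')} =
      mass₁Aux θ π π₂ ξ τ τ' j j' := by
  have := h.isProbabilityMeasure_tripleLaw hξ hξ1 hτ hττ'
  have := fun i => h.isProbabilityMeasure_pair_vec hξ hξ1 hτ hττ' i
  let box : ℕ × ℕ → Set (Fin 3 → ℕ × ℕ) := fun p =>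
    Set.univ.pi ![{w | w.2 = p.1}, {(p.2, j - p.1)}, {w | w.1 = j' - p.2}]
  have hbox : ∀ p x, x ∈ box p ↔ (x 0).2 = p.1 ∧ x 1 = (p.2, j - p.1) ∧ (x 2).1 = j' - p.2 := by
    intro p x
    simp [box, Set.mem_pi, Fin.forall_fin_succ]
  have hS : {x : Fin 3 → ℕ × ℕ | ((x 0).2 + (x 1).2, (x 1).1 + (x 2).1) = (j, j')} =
      ⋃ p ∈ Finset.range (j + 1) ×ˢ Finset.range (j' + 1), box p := by
    ext x
    simp only [Set.mem_ofPred_eq, Set.mem_iUnion, hbox, Finset.mem_product, Finset.mem_range,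
      Prod.ext_iff, exists_prop, Prod.exists]
    constructor
    · rintro ⟨h1, h2⟩
      exact ⟨(x 0).2, (x 1).1, ⟨by omega, by omega⟩, rfl, ⟨rfl, by omega⟩, by omega⟩
    · rintro ⟨p, q, ⟨h1, h2⟩, h3, ⟨h4, h5⟩, h6⟩
      omega
  rw [hS, measureReal_biUnion_finset]
  · rw [Finset.sum_product, mass₁Aux]
    refine Finset.sum_congr rfl fun l _ => ?_
    -- Terms with `r < j - l` vanish: the higher-level count in the overlap cannot be below the
    -- lower-level one.
    rw [← Finset.sum_subset (s₁ := Finset.Icc (j - l) j')]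
    · refine Finset.sum_congr rfl fun r _ => ?_
      simp only [box]
      rw [measureReal_def, tripleLaw, Measure.pi_pi, ENNReal.toReal_prod, Fin.prod_univ_three]
      simp only [Matrix.cons_val_zero, Matrix.cons_val_one, Matrix.cons_val]
      have e0 := h.lawOfMass_cpMass₂_snd hτ hττ' hξ hξ1 l
      have e2 := h.lawOfMass_cpMass₂_fst (hτ.trans_le hττ') hτ.le hττ' hξ hξ1 (j' - r)
      rw [measureReal_def] at e0 e2
      rw [e0, e2, lawOfMass_singleton, ENNReal.toReal_ofReal
        (h.cpMass₂_nonneg (sub_nonneg.2 hξ1) (hτ.trans_le hττ').le hτ.le hττ' _ _)]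
      ring
    · intro r hr
      simp only [Finset.mem_Icc, Finset.mem_range] at hr ⊢
      omega
    · intro r hr hr'
      simp only [Finset.mem_Icc, Finset.mem_range] at hr hr'
      simp only [box]
      rw [measureReal_def, tripleLaw, Measure.pi_pi, ENNReal.toReal_prod, Fin.prod_univ_three]
      simp only [Matrix.cons_val_zero, Matrix.cons_val_one, Matrix.cons_val]
      have : cpMass₂ θ π₂ ((1 - ξ) * τ') ((1 - ξ) * τ) r (j - l) = 0 := by
        rw [cpMass₂, if_pos (by omega)]
      rw [lawOfMass_singleton, this]
      simp
  · intro p _ q _ hpq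
    rw [Function.onFun, Set.disjoint_left]
    intro x hx hx'
    rw [hbox] at hx hx'
    refine hpq (Prod.ext (hx.1.symm.trans hx'.1) ?_)
    exact (congrArg Prod.fst hx.2.1).symm.trans (congrArg Prod.fst hx'.2.1)
  · intro p _
    exact (Set.to_countable _).measurableSet

theorem lawOfMass_mass₁Aux (h : HasClusterLimits P X θ π π₂) {ξ τ τ' : ℝ}
    (hξ : 0 ≤ ξ) (hξ1 : ξ ≤ 1) (hτ : 0 < τ) (hττ' : τ ≤ τ') :
    (tripleLaw θ π₂ ξ τ' τ).map (fun x => ((x 0).2 + (x 1).2, (x 1).1 + (x 2).1)) =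
      lawOfMass (mass₁Aux θ π π₂ ξ τ τ') := by
  have := h.isProbabilityMeasure_tripleLaw hξ hξ1 hτ hττ'
  refine eq_lawOfMass fun i j => ?_
  rw [← h.tripleLaw_real hξ hξ1 hτ hττ', Measure.map_apply (measurable_of_countable _)
    (measurableSet_singleton _), ofReal_measureReal]
  rfl

theorem isProbabilityMeasure_mass₁ (h : HasClusterLimits P X θ π π₂) {ξ τ τ' : ℝ}
    (hξ : 0 ≤ ξ) (hξ1 : ξ ≤ 1) (hτ : 0 < τ) (hτ' : 0 < τ') :
    IsProbabilityMeasure (lawOfMass (mass₁ θ π π₂ ξ τ τ')) := by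
  have key : ∀ {τ τ' : ℝ}, 0 < τ → τ ≤ τ' →
      ∑' w : ℕ × ℕ, ENNReal.ofReal (mass₁Aux θ π π₂ ξ τ τ' w.1 w.2) = 1 := by
    intro τ τ' hτ hττ'
    have := h.isProbabilityMeasure_tripleLaw hξ hξ1 hτ hττ'
    rw [← lawOfMass_univ, ← h.lawOfMass_mass₁Aux hξ hξ1 hτ hττ']
    exact (Measure.isProbabilityMeasure_map (measurable_of_countable _).aemeasurable).measure_univ
  constructor
  rw [lawOfMass_univ]
  simp only [mass₁]
  split_ifs with hle
  · exact key hτ hle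
  · rw [← key hτ' (not_le.1 hle).le, ← (Equiv.prodComm ℕ ℕ).tsum_eq]
    rfl

/-- Configurations of three disjoint intervals `(l 0, u 0]`, `(l 1, u 1]`, `(l 2, u 2]` in `(0,1]`
of lengths `ξ / K`, `(1 - ξ) / K` and `ξ / K`. -/
structure _root_.SlidingBlocks.IsOverlap (K ξ : ℝ) (l u : Fin 3 → ℝ) : Prop where
  disjoint : DisjointIntervals l u
  length : ∀ i, u i - l i = (![ξ, 1 - ξ, ξ] : Fin 3 → ℝ) i / K

/-- The limit law depends on length times level only, so shrinking the intervals by `K` is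
compensated by raising the levels by `K`. -/
theorem tendsto_mass₁Aux (h : HasClusterLimits P X θ π π₂) {ξ τ τ' K : ℝ}
    (hξ : 0 ≤ ξ) (hξ1 : ξ ≤ 1) (hτ : 0 < τ) (hττ' : τ ≤ τ') (hK : 0 < K) {l u : Fin 3 → ℝ}
    (hlu : IsOverlap K ξ l u) (j j' : ℕ) :
    Tendsto (fun n : ℕ => P.real {ω |
      exceedances P X n (K * τ) (Set.Ioc (l 0) (u 0)) ω +
        exceedances P X n (K * τ) (Set.Ioc (l 1) (u 1)) ω = j ∧
      exceedances P X n (K * τ') (Set.Ioc (l 1) (u 1)) ω +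
        exceedances P X n (K * τ') (Set.Ioc (l 2) (u 2)) ω = j'}) atTop
      (𝓝 (mass₁Aux θ π π₂ ξ τ τ' j j')) := by
  have hlim := h.tendsto_pi (mul_pos hK (hτ.trans_le hττ')) (mul_pos hK hτ).le
    (mul_le_mul_of_nonneg_left hττ' hK.le) hlu.disjoint
    {x | ((x 0).2 + (x 1).2, (x 1).1 + (x 2).1) = (j, j')}
  have hs : ∀ (i : Fin 3) (t : ℝ), (u i - l i) * (K * t) = (![ξ, 1 - ξ, ξ] : Fin 3 → ℝ) i * t := by
    intro i t
    rw [hlu.length, ← mul_assoc, div_mul_cancel₀ _ hK.ne']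
  simp_rw [hs] at hlim
  rw [show (Measure.pi fun i : Fin 3 => lawOfMass (cpMass₂ θ π₂
    ((![ξ, 1 - ξ, ξ] : Fin 3 → ℝ) i * τ') ((![ξ, 1 - ξ, ξ] : Fin 3 → ℝ) i * τ))) =
    tripleLaw θ π₂ ξ τ' τ from rfl, h.tripleLaw_real hξ hξ1 hτ hττ'] at hlim
  refine hlim.congr fun n => ?_
  congr 1
  ext ω
  simp only [Set.mem_ofPred_eq, Prod.mk.injEq]

/-- Reversing the three intervals exchanges the two blocks, which reduces `τ ≥ τ'` to the opposite
order. -/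
theorem _root_.SlidingBlocks.IsOverlap.symm {K ξ : ℝ} {l u : Fin 3 → ℝ} (hlu : IsOverlap K ξ l u) :
    IsOverlap K ξ (l ∘ ![2, 1, 0]) (u ∘ ![2, 1, 0]) := by
  refine ⟨⟨fun i => hlu.disjoint.1 _, fun i j hij => hlu.disjoint.2 ?_⟩, fun i => ?_⟩
  · fin_cases i <;> fin_cases j <;> simp_all
  · rw [Function.comp, Function.comp, hlu.length]
    fin_cases i <;> simp

theorem tendsto_mass₁Aux_symm (h : HasClusterLimits P X θ π π₂) {ξ τ τ' K : ℝ}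
    (hξ : 0 ≤ ξ) (hξ1 : ξ ≤ 1) (hτ' : 0 < τ') (hττ' : τ' ≤ τ) (hK : 0 < K) {l u : Fin 3 → ℝ}
    (hlu : IsOverlap K ξ l u) (j j' : ℕ) :
    Tendsto (fun n : ℕ => P.real {ω |
      exceedances P X n (K * τ) (Set.Ioc (l 0) (u 0)) ω +
        exceedances P X n (K * τ) (Set.Ioc (l 1) (u 1)) ω = j ∧
      exceedances P X n (K * τ') (Set.Ioc (l 1) (u 1)) ω +
        exceedances P X n (K * τ') (Set.Ioc (l 2) (u 2)) ω = j'}) atTop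
      (𝓝 (mass₁Aux θ π π₂ ξ τ' τ j' j)) := by
  refine (h.tendsto_mass₁Aux hξ hξ1 hτ' hττ' hK hlu.symm j' j).congr fun n => ?_
  congr 1
  ext ω
  simp only [Set.mem_ofPred_eq, Function.comp, Matrix.cons_val_zero, Matrix.cons_val_one,
    Matrix.cons_val]
  constructor
  · rintro ⟨h1, h2⟩
    exact ⟨by omega, by omega⟩
  · rintro ⟨h1, h2⟩
    exact ⟨by omega, by omega⟩

theorem tendsto_mass₁ (h : HasClusterLimits P X θ π π₂) {ξ τ τ' K : ℝ}
    (hξ : 0 ≤ ξ) (hξ1 : ξ ≤ 1) (hτ : 0 < τ) (hτ' : 0 < τ') (hK : 0 < K) {l u : Fin 3 → ℝ}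
    (hlu : IsOverlap K ξ l u) (j j' : ℕ) :
    Tendsto (fun n : ℕ => P.real {ω |
      exceedances P X n (K * τ) (Set.Ioc (l 0) (u 0)) ω +
        exceedances P X n (K * τ) (Set.Ioc (l 1) (u 1)) ω = j ∧
      exceedances P X n (K * τ') (Set.Ioc (l 1) (u 1)) ω +
        exceedances P X n (K * τ') (Set.Ioc (l 2) (u 2)) ω = j'}) atTop
      (𝓝 (mass₁ θ π π₂ ξ τ τ' j j')) := by
  rw [mass₁]
  split_ifs with hle
  · exact h.tendsto_mass₁Aux hξ hξ1 hτ hle hK hlu j j'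
  · exact h.tendsto_mass₁Aux_symm hξ hξ1 hτ' (not_le.1 hle).le hK hlu j j'

end HasClusterLimits

/-! ### The law of the counts in two overlapping blocks -/

/-- Two blocks of length `1 / 2` fit into `(0, 1]` for every offset up to disjointness. -/
theorem isOverlap_half {ξ : ℝ} (hξ : 0 ≤ ξ) (hξ1 : ξ ≤ 1) :
    IsOverlap 2 ξ ![0, ξ / 2, 1 / 2] ![ξ / 2, 1 / 2, 1 / 2 + ξ / 2] := by
  refine ⟨⟨fun i => ?_, fun i j hij => ?_⟩, fun i => ?_⟩
  · fin_cases i <;> refine ⟨?_, ?_, ?_⟩ <;> simp <;> linarith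
  · refine Set.Ioc_disjoint_Ioc.2 ?_
    fin_cases i <;> fin_cases j <;> (simp at hij ⊢; try grind)
  · fin_cases i <;> simp <;> ring

theorem cpMass_zero_level (θ : ℝ) (π : ℕ → ℝ) (l : ℕ) :
    cpMass θ π 0 l = if l = 0 then 1 else 0 := by
  rw [cpMass]
  split_ifs with hl
  · simp
  · refine Finset.sum_eq_zero fun k hk => ?_
    have : k ≠ 0 := by have := (Finset.mem_Icc.1 hk).1; omega
    simp [this]

namespace HasClusterLimits

variable {Ω : Type*} [MeasurableSpace Ω] {P : Measure Ω} {X : ℤ → Ω → ℝ} {θ : ℝ} {π : ℕ → ℝ}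
  {π₂ : ℝ → ℕ → ℕ → ℝ} {ξ : ℝ}

theorem tendsto_mass₁_Ioc (h : HasClusterLimits P X θ π π₂) (hξ : 0 ≤ ξ) (hξ1 : ξ ≤ 1) {τ τ' : ℝ}
    (hτ : 0 < τ) (hτ' : 0 < τ') (j j' : ℕ) :
    Tendsto (fun n : ℕ => P.real {ω |
      exceedances P X n (2 * τ) (Set.Ioc 0 (1 / 2)) ω = j ∧
      exceedances P X n (2 * τ') (Set.Ioc (ξ / 2) (1 / 2 + ξ / 2)) ω = j'}) atTop
      (𝓝 (mass₁ θ π π₂ ξ τ τ' j j')) := by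
  refine (h.tendsto_mass₁ hξ hξ1 hτ hτ' two_pos (isOverlap_half hξ hξ1) j j').congr fun n => ?_
  congr 1
  ext ω
  simp only [Matrix.cons_val_zero, Matrix.cons_val_one, Matrix.cons_val]
  rw [Set.mem_ofPred_eq, Set.mem_ofPred_eq, exceedances_add_of_le n _ (by linarith) (by linarith),
    exceedances_add_of_le n _ (by linarith) (by linarith)]

theorem mass₁_nonneg (h : HasClusterLimits P X θ π π₂) (hξ : 0 ≤ ξ) (hξ1 : ξ ≤ 1) {τ τ' : ℝ}
    (hτ : 0 < τ) (hτ' : 0 < τ') (j j' : ℕ) : 0 ≤ mass₁ θ π π₂ ξ τ τ' j j' :=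
  ge_of_tendsto' (h.tendsto_mass₁_Ioc hξ hξ1 hτ hτ' j j') fun _ => measureReal_nonneg

/-- Only `τ = τ'` needs an argument: there the formula is not visibly symmetric, but interval
reversal computes the same limit in the other form. -/
theorem mass₁_symm (h : HasClusterLimits P X θ π π₂) (hξ : 0 ≤ ξ) (hξ1 : ξ ≤ 1) {τ τ' : ℝ}
    (hτ : 0 < τ) (j j' : ℕ) : mass₁ θ π π₂ ξ τ τ' j j' = mass₁ θ π π₂ ξ τ' τ j' j := by
  rcases lt_trichotomy τ τ' with hlt | rfl | hlt
  · rw [mass₁, mass₁, if_pos hlt.le, if_neg (not_le.2 hlt)]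
  · rw [mass₁, mass₁, if_pos le_rfl, if_pos le_rfl]
    exact tendsto_nhds_unique
      (h.tendsto_mass₁Aux hξ hξ1 hτ le_rfl two_pos (isOverlap_half hξ hξ1) j j')
      (h.tendsto_mass₁Aux_symm hξ hξ1 hτ le_rfl two_pos (isOverlap_half hξ hξ1) j j')
  · rw [mass₁, mass₁, if_neg (not_le.2 hlt), if_pos hlt.le]

theorem lawOfMass_mass₁_real (h : HasClusterLimits P X θ π π₂) (hξ : 0 ≤ ξ) (hξ1 : ξ ≤ 1)
    {τ τ' : ℝ} (hτ : 0 < τ) (hτ' : 0 < τ') (j j' : ℕ) :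
    (lawOfMass (mass₁ θ π π₂ ξ τ τ')).real {(j, j')} = mass₁ θ π π₂ ξ τ τ' j j' := by
  rw [measureReal_def, lawOfMass_singleton,
    ENNReal.toReal_ofReal (h.mass₁_nonneg hξ hξ1 hτ hτ' j j')]

theorem tendsto_lawOfMass_mass₁ (h : HasClusterLimits P X θ π π₂) (hξ : 0 ≤ ξ) (hξ1 : ξ ≤ 1)
    {τ τ' : ℝ} (hτ : 0 < τ) (hτ' : 0 < τ') (S : Set (ℕ × ℕ)) :
    Tendsto (fun n : ℕ => P.real {ω |
      (exceedances P X n (2 * τ) (Set.Ioc 0 (1 / 2)) ω,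
      exceedances P X n (2 * τ') (Set.Ioc (ξ / 2) (1 / 2 + ξ / 2)) ω) ∈ S}) atTop
      (𝓝 ((lawOfMass (mass₁ θ π π₂ ξ τ τ')).real S)) := by
  have := h.prob
  have := h.isProbabilityMeasure_mass₁ hξ hξ1 hτ hτ'
  refine tendsto_measureReal_preimage (f := fun n ω =>
    (exceedances P X n (2 * τ) (Set.Ioc 0 (1 / 2)) ω,
      exceedances P X n (2 * τ') (Set.Ioc (ξ / 2) (1 / 2 + ξ / 2)) ω))
    (fun n => (measurable_exceedances h.measurable n _ _).prodMk
      (measurable_exceedances h.measurable n _ _)) _ (fun x => ?_) S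
  rw [h.lawOfMass_mass₁_real hξ hξ1 hτ hτ' x.1 x.2]
  refine (h.tendsto_mass₁_Ioc hξ hξ1 hτ hτ' x.1 x.2).congr fun n => ?_
  congr 1
  ext ω
  simp only [Set.mem_ofPred_eq, Set.mem_preimage, Set.mem_singleton_iff, Prod.ext_iff]

theorem tendsto_fst (h : HasClusterLimits P X θ π π₂) {τ : ℝ} (hτ : 0 < τ) (j : ℕ) :
    Tendsto (fun n : ℕ => P.real {ω | exceedances P X n (2 * τ) (Set.Ioc 0 (1 / 2)) ω = j}) atTop
      (𝓝 (cpMass θ π τ j)) := by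
  have := h.tendsto_single (mul_pos two_pos hτ) le_rfl (b := 1 / 2) (by norm_num) (by norm_num) j
  rwa [show ((1 : ℝ) / 2 - 0) * (2 * τ) = τ by ring] at this

theorem tendsto_snd (h : HasClusterLimits P X θ π π₂) (hξ : 0 ≤ ξ) (hξ1 : ξ ≤ 1) {τ : ℝ}
    (hτ : 0 < τ) (j : ℕ) :
    Tendsto (fun n : ℕ => P.real {ω |
      exceedances P X n (2 * τ) (Set.Ioc (ξ / 2) (1 / 2 + ξ / 2)) ω = j}) atTop
      (𝓝 (cpMass θ π τ j)) := by
  have := h.tendsto_single (mul_pos two_pos hτ) (a := ξ / 2) (b := 1 / 2 + ξ / 2) (by linarith)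
    (by linarith) (by linarith) j
  rwa [show ((1 : ℝ) / 2 + ξ / 2 - ξ / 2) * (2 * τ) = τ by ring] at this

theorem lawOfMass_mass₁_fst (h : HasClusterLimits P X θ π π₂) (hξ : 0 ≤ ξ) (hξ1 : ξ ≤ 1)
    {τ τ' : ℝ} (hτ : 0 < τ) (hτ' : 0 < τ') (j : ℕ) :
    (lawOfMass (mass₁ θ π π₂ ξ τ τ')).real {w | w.1 = j} = cpMass θ π τ j :=
  tendsto_nhds_unique (h.tendsto_lawOfMass_mass₁ hξ hξ1 hτ hτ' {w | w.1 = j}) (h.tendsto_fst hτ j)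

theorem lawOfMass_mass₁_snd (h : HasClusterLimits P X θ π π₂) (hξ : 0 ≤ ξ) (hξ1 : ξ ≤ 1)
    {τ τ' : ℝ} (hτ : 0 < τ) (hτ' : 0 < τ') (j : ℕ) :
    (lawOfMass (mass₁ θ π π₂ ξ τ τ')).real {w | w.2 = j} = cpMass θ π τ' j :=
  tendsto_nhds_unique (h.tendsto_lawOfMass_mass₁ hξ hξ1 hτ hτ' {w | w.2 = j})
    (h.tendsto_snd hξ hξ1 hτ' j)

theorem cpMass_nonneg (h : HasClusterLimits P X θ π π₂) {τ : ℝ} (hτ : 0 < τ) (j : ℕ) :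
    0 ≤ cpMass θ π τ j :=
  ge_of_tendsto' (h.tendsto_fst hτ j) fun _ => measureReal_nonneg

theorem cpMass_le_one (h : HasClusterLimits P X θ π π₂) {τ : ℝ} (hτ : 0 < τ) (j : ℕ) :
    cpMass θ π τ j ≤ 1 :=
  have := h.prob
  le_of_tendsto' (h.tendsto_fst hτ j) fun _ => measureReal_le_one

theorem cpMass_hasSum (h : HasClusterLimits P X θ π π₂) {τ : ℝ} (hτ : 0 < τ) :
    HasSum (cpMass θ π τ) 1 := by
  have := h.isProbabilityMeasure_mass₁ le_rfl zero_le_one hτ hτ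
  have hm : Measurable (Prod.fst : ℕ × ℕ → ℕ) := measurable_fst
  set μ := (lawOfMass (mass₁ θ π π₂ 0 τ τ)).map Prod.fst
  have hμ : IsProbabilityMeasure μ := Measure.isProbabilityMeasure_map hm.aemeasurable
  have h1 : ∑' j, μ {j} = 1 := by
    have := Measure.tsum_indicator_apply_singleton μ Set.univ MeasurableSet.univ
    simpa using this
  have h2 := ENNReal.hasSum_toReal (f := fun j => μ {j}) (by rw [h1]; exact ENNReal.one_ne_top)
  rw [← ENNReal.tsum_toReal_eq fun _ => measure_ne_top _ _, h1, ENNReal.toReal_one] at h2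
  convert h2 using 2 with j
  rw [← h.lawOfMass_mass₁_fst le_rfl zero_le_one hτ hτ j, measureReal_def,
    Measure.map_apply hm (measurableSet_singleton j)]
  rfl

/-! ### Bounds that make `P(N = j, N' = 0)` a mixed tail function, obtained from finite-sample
probabilities. -/

theorem mass₁_zero_antitone (h : HasClusterLimits P X θ π π₂) (hξ : 0 ≤ ξ) (hξ1 : ξ ≤ 1)
    {τ x y : ℝ} (hτ : 0 < τ) (hx : 0 < x) (hxy : x ≤ y) (j : ℕ) :
    mass₁ θ π π₂ ξ τ y j 0 ≤ mass₁ θ π π₂ ξ τ x j 0 := by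
  have := h.prob
  refine le_of_tendsto_of_tendsto' (h.tendsto_mass₁_Ioc hξ hξ1 hτ (hx.trans_le hxy) j 0)
    (h.tendsto_mass₁_Ioc hξ hξ1 hτ hx j 0) fun n => measureReal_mono ?_
  rintro ω ⟨h1, h2⟩
  exact ⟨h1, Nat.le_zero.1 (le_of_le_of_eq (exceedances_mono n (by linarith) _ ω) h2)⟩

theorem _root_.SlidingBlocks.measureReal_inter_sub_le {μ : Measure Ω} [IsFiniteMeasure μ]
    (A : Set Ω) {B B' : Set Ω} (hB : B' ⊆ B) (hm : MeasurableSet B') :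
    μ.real (A ∩ B) - μ.real (A ∩ B') ≤ μ.real B - μ.real B' := by
  rw [← measureReal_sdiff hB hm]
  have h1 : A ∩ B ⊆ (A ∩ B') ∪ (B \ B') := by
    rintro ω ⟨hA, hω⟩
    by_cases hω' : ω ∈ B'
    · exact Or.inl ⟨hA, hω'⟩
    · exact Or.inr ⟨hω, hω'⟩
  have := (measureReal_mono (μ := μ) h1).trans (measureReal_union_le _ _)
  linarith

theorem mass₁_zero_sub_le (h : HasClusterLimits P X θ π π₂) (hξ : 0 ≤ ξ) (hξ1 : ξ ≤ 1)
    {τ x y : ℝ} (hτ : 0 < τ) (hx : 0 < x) (hxy : x ≤ y) (j : ℕ) :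
    mass₁ θ π π₂ ξ τ x j 0 - mass₁ θ π π₂ ξ τ y j 0 ≤
      Real.exp (-(θ * x)) - Real.exp (-(θ * y)) := by
  have := h.prob
  have hy := hx.trans_le hxy
  have l1 := (h.tendsto_mass₁_Ioc hξ hξ1 hτ hx j 0).sub (h.tendsto_mass₁_Ioc hξ hξ1 hτ hy j 0)
  have l2 := (h.tendsto_snd hξ hξ1 hx 0).sub (h.tendsto_snd hξ hξ1 hy 0)
  refine le_of_tendsto_of_tendsto' l1 l2 fun n => measureReal_inter_sub_le _ ?_ ?_
  · intro ω hω
    refine Nat.le_zero.1 (le_of_le_of_eq (exceedances_mono n ?_ _ ω) hω)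
    linarith
  · exact measurable_exceedances h.measurable n _ _ (measurableSet_singleton 0)

theorem mass₁_zero_le_exp (h : HasClusterLimits P X θ π π₂) (hξ : 0 ≤ ξ) (hξ1 : ξ ≤ 1)
    {τ x : ℝ} (hτ : 0 < τ) (hx : 0 < x) (j : ℕ) :
    mass₁ θ π π₂ ξ τ x j 0 ≤ Real.exp (-(θ * x)) := by
  have := h.prob
  exact le_of_tendsto_of_tendsto' (h.tendsto_mass₁_Ioc hξ hξ1 hτ hx j 0)
    (h.tendsto_snd hξ hξ1 hx 0) fun n => measureReal_mono fun ω hω => hω.2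

theorem mass₁_le_cpMass (h : HasClusterLimits P X θ π π₂) (hξ : 0 ≤ ξ) (hξ1 : ξ ≤ 1)
    {τ x : ℝ} (hτ : 0 < τ) (hx : 0 < x) (j i : ℕ) :
    mass₁ θ π π₂ ξ τ x j i ≤ cpMass θ π τ j := by
  have := h.prob
  exact le_of_tendsto_of_tendsto' (h.tendsto_mass₁_Ioc hξ hξ1 hτ hx j i)
    (h.tendsto_fst hτ j) fun n => measureReal_mono fun ω hω => hω.1

theorem cpMass_sub_mass₁_zero_le (h : HasClusterLimits P X θ π π₂) (hξ : 0 ≤ ξ) (hξ1 : ξ ≤ 1)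
    {τ x : ℝ} (hτ : 0 < τ) (hx : 0 < x) (j : ℕ) :
    cpMass θ π τ j - mass₁ θ π π₂ ξ τ x j 0 ≤ 1 - Real.exp (-(θ * x)) := by
  have := h.prob
  have l1 := (h.tendsto_fst hτ j).sub (h.tendsto_mass₁_Ioc hξ hξ1 hτ hx j 0)
  have l2 := (h.tendsto_snd hξ hξ1 hx 0).const_sub 1
  refine le_of_tendsto_of_tendsto' l1 l2 fun n => ?_
  have := measureReal_inter_sub_le (μ := P)
    {ω | exceedances P X n (2 * τ) (Set.Ioc 0 (1 / 2)) ω = j} (Set.subset_univ _)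
    (measurable_exceedances (P := P) h.measurable n (2 * x) (Set.Ioc (ξ / 2) (1 / 2 + ξ / 2))
      (measurableSet_singleton 0))
  rwa [Set.inter_univ, probReal_univ] at this

/-! ### The mixed laws -/

/-- `{Y₃ > x}` corresponds to an empty second block at level `x`. For `x > τ` an empty overlap at
level `x` is also empty at level `τ`, so all `j` exceedances lie in the left part and only `l = j`
remains. -/
theorem tail₃_eq_mass₁ (h : HasClusterLimits P X θ π π₂) (hξ : 0 ≤ ξ) (hξ1 : ξ ≤ 1) {τ x : ℝ}
    (hx : 0 < x) (j : ℕ) : tail₃ θ π π₂ ξ τ j x = mass₁ θ π π₂ ξ τ x j 0 := by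
  rw [tail₃]
  split_ifs with hle
  · have hI : Finset.Icc (0 - 0) j = Finset.range (j + 1) := by ext; simp
    rw [← h.mass₁_symm hξ hξ1 hx, mass₁, if_pos hle, mass₁Aux, Finset.sum_range_one, hI,
      ← Finset.sum_range_reflect, Finset.mul_sum]
    refine Finset.sum_congr rfl fun r hr => ?_
    have hr' := Finset.mem_range.1 hr
    rw [show j - (j + 1 - 1 - r) = r by omega, show j + 1 - 1 - r = j - r by omega, cpMass.eq_def
      θ π (ξ * x), if_pos rfl, mul_assoc θ]
    ring
  · rw [mass₁, if_pos (not_le.1 hle).le, mass₁Aux, Finset.sum_eq_single_of_mem j (by simp)]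
    · rw [Nat.sub_self, Finset.Icc_self, Finset.sum_singleton, cpMass.eq_def θ π (ξ * x),
        if_pos (Nat.sub_self 0), cpMass₂, if_neg (lt_irrefl _), if_pos rfl, mul_assoc, ← Real.exp_add,
        mul_comm τ ξ, mul_comm]
      congr 2
      ring
    · intro l hl hlj
      have := Finset.mem_range.1 hl
      rw [Finset.Icc_eq_empty (by omega), Finset.sum_empty]

theorem tailNZ_eq_mass₁ (h : HasClusterLimits P X θ π π₂) {τ x : ℝ} (hx : 0 < x) (j : ℕ) :
    tailNZ θ π₂ τ j x = mass₁ θ π π₂ 0 τ x j 0 := by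
  rw [← h.tail₃_eq_mass₁ le_rfl zero_le_one hx, tailNZ, tail₃]
  split_ifs with h1 h2
  · simp [cpMass_zero_level]
  · simp [cpMass_zero_level, h2]
  · simp [cpMass_zero_level, h2]

theorem exists_hasMixedTail (h : HasClusterLimits P X θ π π₂) (hξ : 0 ≤ ξ) (hξ1 : ξ ≤ 1) {τ : ℝ}
    (hτ : 0 < τ) {G : ℕ → ℝ → ℝ} (hG : ∀ j x, 0 < x → G j x = mass₁ θ π π₂ ξ τ x j 0) :
    ∃ μ, HasMixedTail G μ ∧ ∀ j, μ ({j} ×ˢ Set.univ) = ENNReal.ofReal (cpMass θ π τ j) := by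
  refine SlidingBlocks.exists_hasMixedTail (g := fun x => Real.exp (-(θ * x)))
    (h.cpMass_nonneg hτ) (h.cpMass_hasSum hτ) (by fun_prop) (by simp) ?_ ?_ ?_ ?_ ?_ ?_ ?_
  · exact Real.tendsto_exp_neg_atTop_nhds_zero.comp (tendsto_id.const_mul_atTop h.pos)
  · intro j x hx
    rw [hG j x hx]
    exact h.mass₁_nonneg hξ hξ1 hτ hx _ _
  · intro j x hx
    rw [hG j x hx]
    exact h.mass₁_zero_le_exp hξ hξ1 hτ hx _
  · intro j x y hx hxy
    rw [hG j x hx, hG j y (hx.trans_le hxy)]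
    exact h.mass₁_zero_antitone hξ hξ1 hτ hx hxy _
  · intro j x y hx hxy
    rw [hG j x hx, hG j y (hx.trans_le hxy)]
    exact h.mass₁_zero_sub_le hξ hξ1 hτ hx hxy _
  · intro j x hx
    rw [hG j x hx]
    exact h.mass₁_le_cpMass hξ hξ1 hτ hx _ _
  · intro j x hx
    rw [hG j x hx]
    exact h.cpMass_sub_mass₁_zero_le hξ hξ1 hτ hx _

/-- Summing over the first count leaves the probability that the second block is empty. -/
theorem hasMixedTail_snd (h : HasClusterLimits P X θ π π₂) (hξ : 0 ≤ ξ) (hξ1 : ξ ≤ 1) {τ : ℝ}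
    (hτ : 0 < τ) {G : ℕ → ℝ → ℝ} (hG : ∀ j x, 0 < x → G j x = mass₁ θ π π₂ ξ τ x j 0)
    {μ : Measure (ℕ × ℝ)} (hμ : HasMixedTail G μ) {x : ℝ} (hx : 0 < x) :
    μ.real {w | x < w.2} = Real.exp (-(θ * x)) := by
  have h1 : {w : ℕ × ℝ | x < w.2} = ⋃ j : ℕ, {j} ×ˢ Set.Ioi x := by
    ext w
    simp
  have h2 : {w : ℕ × ℕ | w.2 = 0} = ⋃ j : ℕ, {(j, 0)} := by
    ext w
    simp [Prod.ext_iff, eq_comm]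
  have h3 := h.lawOfMass_mass₁_snd hξ hξ1 hτ hx 0
  rw [measureReal_def, h2, measure_iUnion _ fun _ => measurableSet_singleton _] at h3
  · rw [measureReal_def, h1, measure_iUnion _ fun _ =>
      (measurableSet_singleton _).prod measurableSet_Ioi]
    · simp_rw [lawOfMass_singleton] at h3
      simp_rw [hμ.tail _ x hx, hG _ x hx, h3]
      simp [cpMass]
    · intro i j hij
      rw [Function.onFun, Set.disjoint_left]
      rintro w ⟨h1, _⟩ ⟨h2, _⟩
      exact hij ((Set.mem_singleton_iff.1 h1).symm.trans h2)
  · intro i j hij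
    rw [Function.onFun, Set.disjoint_left]
    rintro w h1 h2
    exact hij (congrArg Prod.fst ((Set.mem_singleton_iff.1 h1).symm.trans h2))

end HasClusterLimits

/-! ### Exponential integrals and the derivative of the compound Poisson mass function -/

/-- Lebesgue measure on `(0,∞)`. -/
noncomputable abbrev posVolume : Measure ℝ := volume.restrict (Set.Ioi 0)

/-- The density of the exponential law on `(0,∞)`. -/
noncomputable def expDensity (θ x : ℝ) : ℝ := θ * Real.exp (-(θ * x))

theorem ae_posVolume : ∀ᵐ x ∂posVolume, 0 < x := ae_restrict_mem measurableSet_Ioi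

theorem ae_expMeasure {θ : ℝ} (hθ : 0 < θ) : ∀ᵐ x ∂(expMeasure θ), 0 < x := by
  have := isProbabilityMeasure_expMeasure hθ
  have h := expMeasure_Ioi hθ le_rfl
  rw [mul_zero, neg_zero, Real.exp_zero, ENNReal.ofReal_one,
    ← prob_compl_eq_zero_iff measurableSet_Ioi] at h
  exact h

/-- This puts the exponential weight and the weight `cpMassDeriv` over one base measure, so that
both kinds of terms fit into the same quadratic form. -/
theorem integral_expMeasure {θ : ℝ} (hθ : 0 < θ) (f : ℝ → ℝ) :
    ∫ x, f x ∂(expMeasure θ) = ∫ x, expDensity θ x * f x ∂posVolume := by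
  have h1 : expMeasure θ = volume.withDensity (exponentialPDF θ) := rfl
  have hm : Measurable (exponentialPDF θ) :=
    (measurable_exponentialPDFReal θ).ennreal_ofReal
  rw [h1, integral_withDensity_eq_integral_toReal_smul hm
    (ae_of_all _ fun x => ENNReal.ofReal_lt_top), ← integral_Ici_eq_integral_Ioi,
    ← setIntegral_eq_integral_of_forall_compl_eq_zero (s := Set.Ici 0)]
  · refine setIntegral_congr_fun measurableSet_Ici fun x hx => ?_
    rw [exponentialPDF_of_nonneg hx, ENNReal.toReal_ofReal (by positivity), smul_eq_mul, expDensity]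
  · intro x hx
    rw [exponentialPDF_of_neg (not_le.1 hx), ENNReal.toReal_zero, zero_smul]

theorem isBigO_eval_mul_exp {θ : ℝ} (hθ : 0 < θ) (R : Polynomial ℝ) :
    (fun x => Real.exp (-(θ * x)) * R.eval x) =O[atTop] fun x => Real.exp (-(θ / 2) * x) := by
  have h1 : (fun x => R.eval x) =O[atTop] fun x => Real.exp (θ / 2 * x) := by
    simp_rw [Polynomial.eval_eq_sum_range]
    refine Asymptotics.IsBigO.fun_sum fun k _ => Asymptotics.IsBigO.const_mul_left ?_ _
    exact (isLittleO_pow_exp_pos_mul_atTop k (half_pos hθ)).isBigO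
  refine ((Asymptotics.isBigO_refl (fun x => Real.exp (-(θ * x))) atTop).mul h1).congr_right ?_
  intro x
  rw [← Real.exp_add]
  congr 1
  ring

theorem integrable_eval_mul_exp {θ : ℝ} (hθ : 0 < θ) (R : Polynomial ℝ) :
    Integrable (fun x => Real.exp (-(θ * x)) * R.eval x) posVolume :=
  integrable_of_isBigO_exp_neg (half_pos hθ) (Continuous.continuousOn (by fun_prop))
    (isBigO_eval_mul_exp hθ R)

theorem integrable_expDensity {θ : ℝ} (hθ : 0 < θ) : Integrable (expDensity θ) posVolume := by
  refine (integrable_eval_mul_exp hθ (Polynomial.C θ)).congr (ae_of_all _ fun x => ?_)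
  simp only [Polynomial.eval_C, expDensity, mul_comm]

/-- The derivative of `τ ↦ p^{(τ)}(j)`. -/
noncomputable def cpMassDeriv (θ : ℝ) (π : ℕ → ℝ) (j : ℕ) (x : ℝ) : ℝ :=
  deriv (fun x => cpMass θ π x j) x

theorem exists_cpMass_eq_eval (θ : ℝ) (π : ℕ → ℝ) {j : ℕ} (hj : j ≠ 0) :
    ∃ R : Polynomial ℝ, R.eval 0 = 0 ∧
      ∀ x, cpMass θ π x j = Real.exp (-(θ * x)) * R.eval x := by
  refine ⟨∑ k ∈ Finset.Icc 1 j, Polynomial.C (θ ^ k / (k.factorial : ℝ) * convPow π k j) *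
    Polynomial.X ^ k, ?_, fun x => ?_⟩
  · rw [Polynomial.eval_finsetSum]
    refine Finset.sum_eq_zero fun k hk => ?_
    have : k ≠ 0 := by have := (Finset.mem_Icc.1 hk).1; omega
    simp [this]
  · rw [cpMass, if_neg hj, Polynomial.eval_finsetSum, Finset.mul_sum]
    refine Finset.sum_congr rfl fun k _ => ?_
    simp only [Polynomial.eval_mul, Polynomial.eval_C, Polynomial.eval_pow, Polynomial.eval_X]
    rw [mul_pow]
    ring

theorem exists_cpMassDeriv_eq_eval (θ : ℝ) (π : ℕ → ℝ) {j : ℕ} (hj : j ≠ 0) :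
    ∃ R : Polynomial ℝ, (∀ x, cpMassDeriv θ π j x = Real.exp (-(θ * x)) * R.eval x) ∧
      ∀ x, HasDerivAt (fun x => cpMass θ π x j) (cpMassDeriv θ π j x) x := by
  obtain ⟨R, -, hR⟩ := exists_cpMass_eq_eval θ π hj
  have hd : ∀ x, HasDerivAt (fun x => cpMass θ π x j)
      (Real.exp (-(θ * x)) * (Polynomial.derivative R - Polynomial.C θ * R).eval x) x := by
    intro x
    have h1 : HasDerivAt (fun x => Real.exp (-(θ * x))) (Real.exp (-(θ * x)) * (-(θ * 1))) x :=
      ((hasDerivAt_id x).const_mul θ).neg.exp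
    have h2 := h1.mul (R.hasDerivAt x)
    rw [show (fun x => cpMass θ π x j) = fun x => Real.exp (-(θ * x)) * R.eval x from funext hR]
    refine h2.congr_deriv ?_
    simp only [Polynomial.eval_sub, Polynomial.eval_mul, Polynomial.eval_C]
    ring
  refine ⟨_, fun x => (hd x).deriv, fun x => ?_⟩
  rw [cpMassDeriv, (hd x).deriv]
  exact hd x

theorem integrable_cpMassDeriv {θ : ℝ} (hθ : 0 < θ) (π : ℕ → ℝ) {j : ℕ} (hj : j ≠ 0) :
    Integrable (cpMassDeriv θ π j) posVolume := by
  obtain ⟨R, hR, -⟩ := exists_cpMassDeriv_eq_eval θ π hj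
  rw [show cpMassDeriv θ π j = _ from funext hR]
  exact integrable_eval_mul_exp hθ R

/-- Fundamental theorem of calculus, with `p^{(0)}(j) = 0` because `j ≠ 0`. It turns `p^{(Z)}(j)`
into a weighted integral of the indicators of `{x < Z}`. -/
theorem cpMass_eq_integral (θ : ℝ) (π : ℕ → ℝ) {j : ℕ} (hj : j ≠ 0) {z : ℝ} (hz : 0 < z) :
    cpMass θ π z j = ∫ x, {x | x < z}.indicator (cpMassDeriv θ π j) x ∂posVolume := by
  obtain ⟨R, hR0, hR⟩ := exists_cpMass_eq_eval θ π hj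
  obtain ⟨R', hR', hd⟩ := exists_cpMassDeriv_eq_eval θ π hj
  have hc : Continuous (cpMassDeriv θ π j) := by
    rw [show cpMassDeriv θ π j = _ from funext hR']
    fun_prop
  have h1 := intervalIntegral.integral_eq_sub_of_hasDerivAt (a := 0) (b := z) (fun x _ => hd x)
    (hc.intervalIntegrable _ _)
  rw [hR 0, hR0, mul_zero, sub_zero, intervalIntegral.integral_of_le hz.le,
    integral_Ioc_eq_integral_Ioo] at h1
  have hms : MeasurableSet {x : ℝ | x < z} := measurableSet_Iio
  rw [← h1, integral_indicator hms, Measure.restrict_restrict hms]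
  congr 2
  ext x
  simp [and_comm]

/-! ### The covariance kernel of overlapping blocks -/

/-- The covariance of `1(N = j)` and `1(N' = j')` for the counts in two blocks with offset `ξ`. -/
noncomputable def covKernel (θ : ℝ) (π : ℕ → ℝ) (π₂ : ℝ → ℕ → ℕ → ℝ) (ξ τ τ' : ℝ) (j j' : ℕ) : ℝ :=
  mass₁ θ π π₂ ξ τ τ' j j' - cpMass θ π τ j * cpMass θ π τ' j'

/-- The integral of the covariance kernel against two weights. -/
noncomputable def kernelIntegral (θ : ℝ) (π : ℕ → ℝ) (π₂ : ℝ → ℕ → ℕ → ℝ) (ξ : ℝ) (c d : ℝ → ℝ)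
    (j j' : ℕ) : ℝ :=
  ∫ z, c z.1 * d z.2 * covKernel θ π π₂ ξ z.1 z.2 j j' ∂(posVolume.prod posVolume)

theorem ae_prod_pos {ν ν' : Measure ℝ} [SFinite ν] [SFinite ν'] (hν : ∀ᵐ x ∂ν, 0 < x)
    (hν' : ∀ᵐ x ∂ν', 0 < x) : ∀ᵐ z ∂(ν.prod ν'), 0 < z.1 ∧ 0 < z.2 :=
  (Measure.quasiMeasurePreserving_fst.ae hν).and (Measure.quasiMeasurePreserving_snd.ae hν')

/-! ### Dependence of the kernel on the offset. -/

theorem cpMass₂_eq_sum_of_pos (θ : ℝ) (π₂ : ℝ → ℕ → ℕ → ℝ) (τ₁ τ₂ : ℝ) {s : ℝ} (hs : s ≠ 0)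
    (i j : ℕ) : cpMass₂ θ π₂ (s * τ₁) (s * τ₂) i j =
      if i < j then 0 else if i = 0 then Real.exp (-(θ * (s * τ₁))) else
        Real.exp (-(θ * (s * τ₁))) * ∑ k ∈ Finset.Icc 1 i,
          (θ * (s * τ₁)) ^ k / (k.factorial : ℝ) * convPow₂ (π₂ (τ₂ / τ₁)) k i j := by
  rw [cpMass₂, mul_div_mul_left _ _ hs]

theorem continuous_cpMass (θ : ℝ) (π : ℕ → ℝ) (j : ℕ) : Continuous fun x => cpMass θ π x j := by
  unfold cpMass
  split_ifs
  · fun_prop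
  · fun_prop

/-- For `ξ < 1` the factor `1 - ξ` cancels in the ratio of the levels, so `π₂` is evaluated at a
point independent of `ξ` and its regularity is irrelevant. At `ξ = 1` the ratio degenerates to `0 /
0`. -/
theorem continuousOn_mass₁Aux (θ : ℝ) (π : ℕ → ℝ) (π₂ : ℝ → ℕ → ℕ → ℝ) (τ τ' : ℝ) (j j' : ℕ) :
    ContinuousOn (fun ξ => mass₁Aux θ π π₂ ξ τ τ' j j') (Set.Ico 0 1) := by
  unfold mass₁Aux
  refine continuousOn_finsetSum _ fun l _ => continuousOn_finsetSum _ fun r _ => ?_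
  refine ContinuousOn.mul (ContinuousOn.mul ?_ ?_) ?_
  · exact ((continuous_cpMass θ π l).comp (continuous_id.mul continuous_const)).continuousOn
  · exact ((continuous_cpMass θ π (j' - r)).comp
      (continuous_id.mul continuous_const)).continuousOn
  · refine ContinuousOn.congr (f := fun ξ : ℝ => if r < j - l then 0 else if r = 0 then
      Real.exp (-(θ * ((1 - ξ) * τ'))) else Real.exp (-(θ * ((1 - ξ) * τ'))) *
        ∑ k ∈ Finset.Icc 1 r, (θ * ((1 - ξ) * τ')) ^ k / (k.factorial : ℝ) *
          convPow₂ (π₂ (τ / τ')) k r (j - l)) ?_ fun ξ hξ =>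
        cpMass₂_eq_sum_of_pos θ π₂ τ' τ (sub_ne_zero.2 hξ.2.ne') r (j - l)
    split_ifs
    · exact continuousOn_const
    · exact Continuous.continuousOn (by fun_prop)
    · exact Continuous.continuousOn (by fun_prop)

theorem continuousOn_mass₁ (θ : ℝ) (π : ℕ → ℝ) (π₂ : ℝ → ℕ → ℕ → ℝ) (τ τ' : ℝ) (j j' : ℕ) :
    ContinuousOn (fun ξ => mass₁ θ π π₂ ξ τ τ' j j') (Set.Ico 0 1) := by
  unfold mass₁
  split_ifs
  · exact continuousOn_mass₁Aux θ π π₂ τ τ' j j'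
  · exact continuousOn_mass₁Aux θ π π₂ τ' τ j' j

/-- At offset `1` the overlap has length zero and contributes no counts, so the blocks are
independent. -/
theorem mass₁Aux_one (θ : ℝ) (π : ℕ → ℝ) (π₂ : ℝ → ℕ → ℕ → ℝ) (τ τ' : ℝ) (j j' : ℕ) :
    mass₁Aux θ π π₂ 1 τ τ' j j' = cpMass θ π τ j * cpMass θ π τ' j' := by
  have h0 : ∀ r s, cpMass₂ θ π₂ 0 0 r s = if r = 0 ∧ s = 0 then 1 else 0 := by
    intro r s
    rw [cpMass₂]
    split_ifs with h1 h2 h3 h4 h5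
    · omega
    · rfl
    · simp
    · omega
    · omega
    · rw [mul_zero, Finset.sum_eq_zero, mul_zero]
      intro k hk
      have : k ≠ 0 := by have := (Finset.mem_Icc.1 hk).1; omega
      simp [this]
  simp only [mass₁Aux, sub_self, zero_mul, one_mul, h0]
  rw [Finset.sum_eq_single_of_mem j (by simp), Finset.sum_eq_single_of_mem 0 (by simp)]
  · simp
  · intro r _ hr
    rw [if_neg (by omega), mul_zero]
  · intro l hl hlj
    have := Finset.mem_range.1 hl
    refine Finset.sum_eq_zero fun r _ => ?_
    rw [if_neg (by omega), mul_zero]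

theorem covKernel_one (θ : ℝ) (π : ℕ → ℝ) (π₂ : ℝ → ℕ → ℕ → ℝ) (τ τ' : ℝ) (j j' : ℕ) :
    covKernel θ π π₂ 1 τ τ' j j' = 0 := by
  rw [covKernel, mass₁]
  split_ifs
  · rw [mass₁Aux_one, sub_self]
  · rw [mass₁Aux_one, mul_comm, sub_self]

theorem kernelIntegral_one (θ : ℝ) (π : ℕ → ℝ) (π₂ : ℝ → ℕ → ℕ → ℝ) (c d : ℝ → ℝ) (j j' : ℕ) :
    kernelIntegral θ π π₂ 1 c d j j' = 0 := by
  simp [kernelIntegral, covKernel_one]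

/-- At offset `0` the outer parts are empty and the two blocks coincide. -/
theorem mass₁Aux_zero (θ : ℝ) (π : ℕ → ℝ) (π₂ : ℝ → ℕ → ℕ → ℝ) (τ τ' : ℝ) (j j' : ℕ) :
    mass₁Aux θ π π₂ 0 τ τ' j j' = cpMass₂ θ π₂ τ' τ j' j := by
  simp only [mass₁Aux, zero_mul, sub_zero, one_mul, cpMass_zero_level]
  rw [Finset.sum_eq_single_of_mem 0 (by simp)]
  · simp only [Nat.sub_zero, if_true, one_mul]
    rcases le_or_gt j j' with h | h
    · rw [Finset.sum_eq_single_of_mem j' (by simp [h])]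
      · simp
      · intro r hr hr'
        have := Finset.mem_Icc.1 hr
        rw [if_neg (by omega), zero_mul]
    · rw [Finset.Icc_eq_empty (by omega), Finset.sum_empty, cpMass₂, if_pos h]
  · intro l _ hl
    simp [hl]

namespace HasClusterLimits

variable {Ω : Type*} [MeasurableSpace Ω] {P : Measure Ω} {X : ℤ → Ω → ℝ} {θ : ℝ} {π : ℕ → ℝ}
  {π₂ : ℝ → ℕ → ℕ → ℝ} {ξ : ℝ}

theorem massNN_eq_mass₁ (h : HasClusterLimits P X θ π π₂) {τ τ' : ℝ} (hτ : 0 < τ)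
    (j j' : ℕ) : massNN θ π₂ τ τ' j j' = mass₁ θ π π₂ 0 τ τ' j j' := by
  rw [massNN]
  split_ifs with hle
  · rw [h.mass₁_symm le_rfl zero_le_one hτ, mass₁, if_pos hle, mass₁Aux_zero]
  · rw [mass₁, if_pos (not_le.1 hle).le, mass₁Aux_zero]

theorem covKernel_symm (h : HasClusterLimits P X θ π π₂) (hξ : 0 ≤ ξ) (hξ1 : ξ ≤ 1) {τ τ' : ℝ}
    (hτ : 0 < τ) (j j' : ℕ) :
    covKernel θ π π₂ ξ τ τ' j j' = covKernel θ π π₂ ξ τ' τ j' j := by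
  rw [covKernel, covKernel, h.mass₁_symm hξ hξ1 hτ, mul_comm]

theorem abs_covKernel_le_one (h : HasClusterLimits P X θ π π₂) (hξ : 0 ≤ ξ) (hξ1 : ξ ≤ 1)
    {τ τ' : ℝ} (hτ : 0 < τ) (hτ' : 0 < τ') (j j' : ℕ) : |covKernel θ π π₂ ξ τ τ' j j'| ≤ 1 := by
  have h1 := h.mass₁_nonneg hξ hξ1 hτ hτ' j j'
  have h2 := h.mass₁_le_cpMass hξ hξ1 hτ hτ' j j'
  have h3 := h.cpMass_le_one hτ j
  have h4 := h.cpMass_le_one hτ' j'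
  have h5 := h.cpMass_nonneg hτ' j'
  rw [covKernel, abs_le]
  constructor <;> nlinarith

theorem covariance_ind (h : HasClusterLimits P X θ π π₂) (hξ : 0 ≤ ξ) (hξ1 : ξ ≤ 1)
    {τ τ' : ℝ} (hτ : 0 < τ) (hτ' : 0 < τ') (j j' : ℕ) :
    cov[fun w : ℕ × ℕ => ind j w.1, fun w => ind j' w.2; lawOfMass (mass₁ θ π π₂ ξ τ τ')] =
      covKernel θ π π₂ ξ τ τ' j j' := by
  have := h.isProbabilityMeasure_mass₁ hξ hξ1 hτ hτ'
  have hb : ∀ (f : ℕ × ℕ → ℝ), (∀ w, |f w| ≤ 1) →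
      MemLp f 2 (lawOfMass (mass₁ θ π π₂ ξ τ τ')) := fun f hf =>
    MemLp.of_bound (measurable_of_countable f).aestronglyMeasurable 1 (ae_of_all _ hf)
  have hind : ∀ i k : ℕ, |ind i k| ≤ 1 := by
    intro i k
    rw [ind]
    split_ifs <;> simp
  rw [covariance_eq_sub (hb _ fun w => hind _ _) (hb _ fun w => hind _ _), covKernel,
    ← h.lawOfMass_mass₁_real hξ hξ1 hτ hτ', ← h.lawOfMass_mass₁_fst hξ hξ1 hτ hτ' j,
    ← h.lawOfMass_mass₁_snd hξ hξ1 hτ hτ' j']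
  have hi : ∀ S : Set (ℕ × ℕ), (lawOfMass (mass₁ θ π π₂ ξ τ τ')).real S =
      ∫ w, S.indicator (fun _ => (1 : ℝ)) w ∂(lawOfMass (mass₁ θ π π₂ ξ τ τ')) := by
    intro S
    rw [integral_indicator S.to_countable.measurableSet, setIntegral_const, smul_eq_mul, mul_one]
  classical
  rw [hi, hi, hi]
  congr 1
  · congr 1
    ext w
    simp only [Pi.mul_apply, ind, Set.indicator_apply, Set.mem_singleton_iff, Prod.ext_iff]
    split_ifs <;> simp_all
  · congr 2 <;> (ext w; simp [ind, Set.indicator_apply])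

theorem tendsto_covKernel (h : HasClusterLimits P X θ π π₂) (hξ : 0 ≤ ξ) (hξ1 : ξ ≤ 1)
    {τ τ' : ℝ} (hτ : 0 < τ) (hτ' : 0 < τ') (j j' : ℕ) :
    Tendsto (fun n : ℕ => P.real {ω |
      exceedances P X n (2 * τ) (Set.Ioc 0 (1 / 2)) ω = j ∧
      exceedances P X n (2 * τ') (Set.Ioc (ξ / 2) (1 / 2 + ξ / 2)) ω = j'} -
      P.real {ω | exceedances P X n (2 * τ) (Set.Ioc 0 (1 / 2)) ω = j} *
      P.real {ω | exceedances P X n (2 * τ') (Set.Ioc (ξ / 2) (1 / 2 + ξ / 2)) ω = j'}) atTop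
      (𝓝 (covKernel θ π π₂ ξ τ τ' j j')) :=
  (h.tendsto_mass₁_Ioc hξ hξ1 hτ hτ' j j').sub ((h.tendsto_fst hτ j).mul (h.tendsto_snd hξ hξ1 hτ' j'))

theorem _root_.SlidingBlocks.measurableSet_exceedances_eq (hX : ∀ t, Measurable (X t)) (n : ℕ)
    (K : ℝ) (B : Set ℝ) (j : ℕ) :
    MeasurableSet {z : Ω × ℝ | exceedances P X n (K * z.2) B z.1 = j} := by
  have h1 : Measurable fun z : Ω × ℝ => (z.1, K * z.2) := by fun_prop
  exact (measurable_exceedances_uncurry (P := P) hX n B).comp h1 (measurableSet_singleton j)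

/-- Measurability in the levels is not visible from the formula, since `π₂` is an arbitrary function
of the ratio; the kernel is instead an almost everywhere limit of measurable finite-sample
covariances. -/
theorem aestronglyMeasurable_covKernel (h : HasClusterLimits P X θ π π₂) (hξ : 0 ≤ ξ)
    (hξ1 : ξ ≤ 1) {ν ν' : Measure ℝ} [SFinite ν] [SFinite ν'] (hν : ∀ᵐ x ∂ν, 0 < x)
    (hν' : ∀ᵐ x ∂ν', 0 < x) (j j' : ℕ) :
    AEStronglyMeasurable (fun z : ℝ × ℝ => covKernel θ π π₂ ξ z.1 z.2 j j') (ν.prod ν') := by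
  have := h.prob
  refine aestronglyMeasurable_of_tendsto_ae atTop (f := fun n z => P.real {ω |
      exceedances P X n (2 * z.1) (Set.Ioc 0 (1 / 2)) ω = j ∧
      exceedances P X n (2 * z.2) (Set.Ioc (ξ / 2) (1 / 2 + ξ / 2)) ω = j'} -
      P.real {ω | exceedances P X n (2 * z.1) (Set.Ioc 0 (1 / 2)) ω = j} *
      P.real {ω | exceedances P X n (2 * z.2) (Set.Ioc (ξ / 2) (1 / 2 + ξ / 2)) ω = j'})
      (fun n => ?_) ?_
  · exact (measurable_measureReal_inter_sub P
      (measurableSet_exceedances_eq (P := P) h.measurable n 2 (Set.Ioc 0 (1 / 2)) j)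
      (measurableSet_exceedances_eq (P := P) h.measurable n 2 _ j')).aestronglyMeasurable
  · filter_upwards [ae_prod_pos hν hν'] with z hz
    exact h.tendsto_covKernel hξ hξ1 hz.1 hz.2 j j'

theorem integrable_mul_covKernel (h : HasClusterLimits P X θ π π₂) (hξ : 0 ≤ ξ)
    (hξ1 : ξ ≤ 1) {ν ν' : Measure ℝ} [SFinite ν] [SFinite ν'] (hν : ∀ᵐ x ∂ν, 0 < x)
    (hν' : ∀ᵐ x ∂ν', 0 < x) {c d : ℝ → ℝ} (hc : Integrable c ν) (hd : Integrable d ν') (j j' : ℕ) :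
    Integrable (fun z : ℝ × ℝ => c z.1 * d z.2 * covKernel θ π π₂ ξ z.1 z.2 j j') (ν.prod ν') := by
  refine (hc.mul_prod hd).mul_bdd (c := 1) (h.aestronglyMeasurable_covKernel hξ hξ1 hν hν' j j') ?_
  filter_upwards [ae_prod_pos hν hν'] with z hz
  exact h.abs_covKernel_le_one hξ hξ1 hz.1 hz.2 j j'

/-! ### Symmetry, bounds and continuity of kernel integrals. -/

theorem kernelIntegral_symm (h : HasClusterLimits P X θ π π₂) (hξ : 0 ≤ ξ) (hξ1 : ξ ≤ 1)
    (c d : ℝ → ℝ) (j j' : ℕ) :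
    kernelIntegral θ π π₂ ξ c d j j' = kernelIntegral θ π π₂ ξ d c j' j := by
  refine (integral_prod_swap (μ := posVolume) (ν := posVolume) fun z : ℝ × ℝ =>
    c z.1 * d z.2 * covKernel θ π π₂ ξ z.1 z.2 j j').symm.trans ?_
  refine integral_congr_ae ?_
  filter_upwards [ae_prod_pos ae_posVolume ae_posVolume] with z hz
  simp only [Prod.fst_swap, Prod.snd_swap]
  rw [h.covKernel_symm hξ hξ1 hz.2, mul_comm (c z.2)]

theorem abs_kernelIntegral_le (h : HasClusterLimits P X θ π π₂) (hξ : 0 ≤ ξ) (hξ1 : ξ ≤ 1)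
    {c d : ℝ → ℝ} (hc : Integrable c posVolume) (hd : Integrable d posVolume) (j j' : ℕ) :
    |kernelIntegral θ π π₂ ξ c d j j'| ≤ ∫ z, ‖c z.1 * d z.2‖ ∂(posVolume.prod posVolume) := by
  rw [kernelIntegral, ← Real.norm_eq_abs]
  refine norm_integral_le_of_norm_le (hc.mul_prod hd).norm ?_
  filter_upwards [ae_prod_pos ae_posVolume ae_posVolume] with z hz
  rw [norm_mul]
  exact mul_le_of_le_one_right (norm_nonneg _) (h.abs_covKernel_le_one hξ hξ1 hz.1 hz.2 j j')

theorem continuousOn_kernelIntegral (h : HasClusterLimits P X θ π π₂) {c d : ℝ → ℝ}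
    (hc : Integrable c posVolume) (hd : Integrable d posVolume) (j j' : ℕ) :
    ContinuousOn (fun ξ => kernelIntegral θ π π₂ ξ c d j j') (Set.Ico 0 1) := by
  intro ξ hξ
  refine continuousWithinAt_of_dominated (bound := fun z => ‖c z.1 * d z.2‖) ?_ ?_
    (hc.mul_prod hd).norm ?_
  · filter_upwards [self_mem_nhdsWithin] with x hx
    exact (h.integrable_mul_covKernel hx.1 hx.2.le ae_posVolume ae_posVolume hc hd j j').1
  · filter_upwards [self_mem_nhdsWithin] with x hx
    filter_upwards [ae_prod_pos ae_posVolume ae_posVolume] with z hz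
    rw [norm_mul]
    exact mul_le_of_le_one_right (norm_nonneg _)
      (h.abs_covKernel_le_one hx.1 hx.2.le hz.1 hz.2 j j')
  · refine ae_of_all _ fun z => ContinuousWithinAt.mul continuousWithinAt_const ?_
    exact (continuousOn_mass₁ θ π π₂ z.1 z.2 j j' ξ hξ).sub continuousWithinAt_const

end HasClusterLimits

/-! ### The asymptotic covariances as kernel integrals -/

theorem covariance_congr_ae {W : Type*} [MeasurableSpace W] {μ : Measure W} {f f' g g' : W → ℝ}
    (hf : f =ᵐ[μ] f') (hg : g =ᵐ[μ] g') : cov[f, g; μ] = cov[f', g'; μ] := by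
  rw [covariance, covariance, integral_congr_ae hf, integral_congr_ae hg]
  refine integral_congr_ae ?_
  filter_upwards [hf, hg] with w h1 h2
  rw [h1, h2]

/-- The limiting covariance of the block statistics for the cluster sizes `j` and `j'` in two blocks
with offset `ξ`. -/
noncomputable def blockCov (θ : ℝ) (π : ℕ → ℝ) (π₂ : ℝ → ℕ → ℕ → ℝ) (ξ : ℝ) (j j' : ℕ) : ℝ :=
  kernelIntegral θ π π₂ ξ (expDensity θ) (expDensity θ) j j' +
    kernelIntegral θ π π₂ ξ (expDensity θ) (cpMassDeriv θ π j') j 0 +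
    kernelIntegral θ π π₂ ξ (expDensity θ) (cpMassDeriv θ π j) j' 0 +
    kernelIntegral θ π π₂ ξ (cpMassDeriv θ π j) (cpMassDeriv θ π j') 0 0

/-- The Marshall–Olkin survival function is the joint probability that both blocks are empty at
their respective levels. -/
theorem mass₁_zero_zero (θ : ℝ) (π : ℕ → ℝ) (π₂ : ℝ → ℕ → ℕ → ℝ) (ξ x y : ℝ) :
    mass₁ θ π π₂ ξ x y 0 0 = survival₂ θ ξ x y := by
  have key : ∀ x y : ℝ, mass₁Aux θ π π₂ ξ x y 0 0 = Real.exp (-(θ * (x * ξ + y))) := by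
    intro x y
    simp only [mass₁Aux, cpMass, cpMass₂, zero_add, Finset.sum_range_one, Nat.sub_zero,
      Finset.Icc_self, Finset.sum_singleton, if_true, lt_irrefl, if_false]
    rw [← Real.exp_add, ← Real.exp_add]
    congr 1
    ring
  rw [mass₁, survival₂, key, key]
  split_ifs with h
  · rw [min_eq_left h, max_eq_right h]
  · rw [min_eq_right (not_le.1 h).le, max_eq_left (not_le.1 h).le]

namespace HasClusterLimits

variable {Ω : Type*} [MeasurableSpace Ω] {P : Measure Ω} {X : ℤ → Ω → ℝ} {θ : ℝ} {π : ℕ → ℝ}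
  {π₂ : ℝ → ℕ → ℕ → ℝ} {ξ : ℝ}

theorem integral_integral_covKernel (h : HasClusterLimits P X θ π π₂) (hξ : 0 ≤ ξ) (hξ1 : ξ ≤ 1)
    (j j' : ℕ) :
    ∫ τ', ∫ τ, covKernel θ π π₂ ξ τ τ' j j' ∂(expMeasure θ) ∂(expMeasure θ) =
      kernelIntegral θ π π₂ ξ (expDensity θ) (expDensity θ) j j' := by
  have hi := integrable_expDensity h.pos
  rw [kernelIntegral, integral_prod_symm _ (h.integrable_mul_covKernel hξ hξ1 ae_posVolume
    ae_posVolume hi hi j j'), integral_expMeasure h.pos]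
  refine integral_congr_ae (ae_of_all _ fun τ' => ?_)
  simp only
  rw [integral_expMeasure h.pos, ← integral_const_mul]
  refine integral_congr_ae (ae_of_all _ fun τ => ?_)
  simp only
  ring

theorem covariance_of_hasMixedTail (h : HasClusterLimits P X θ π π₂) (hξ : 0 ≤ ξ) (hξ1 : ξ ≤ 1)
    {τ : ℝ} (hτ : 0 < τ) {G : ℕ → ℝ → ℝ} (hG : ∀ j x, 0 < x → G j x = mass₁ θ π π₂ ξ τ x j 0)
    (j : ℕ) {j' : ℕ} (hj' : j' ≠ 0) :
    cov[fun w : ℕ × ℝ => ind j w.1, fun w => cpMass θ π w.2 j'; lawOfMixedTail G] =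
      ∫ x, cpMassDeriv θ π j' x * covKernel θ π π₂ ξ τ x j 0 ∂posVolume := by
  obtain ⟨μ, hμ, hμj⟩ := h.exists_hasMixedTail hξ hξ1 hτ hG
  have hex : ∃ μ, HasMixedTail G μ := ⟨μ, hμ⟩
  have hlaw : lawOfMixedTail G = μ := by
    rw [lawOfMixedTail, dif_pos hex]
    exact hex.choose_spec.unique hμ
  have := hμ.prob
  rw [hlaw]
  have hpos : ∀ᵐ w ∂μ, 0 < w.2 := by
    have := hμ.pos
    refine measure_mono_null (fun w hw => ?_) this
    exact ⟨trivial, Set.mem_Iic.2 (not_lt.1 fun hh => hw hh)⟩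
  have hS : MeasurableSet {z : (ℕ × ℝ) × Unit | z.1.1 = j} :=
    (measurable_fst.comp measurable_fst) (measurableSet_singleton j)
  have hR : MeasurableSet {z : (ℕ × ℝ) × ℝ | z.2 < z.1.2} :=
    measurableSet_lt measurable_snd (measurable_snd.comp measurable_fst)
  have hq := integrable_cpMassDeriv h.pos π hj'
  -- The indicator of the count is not integrated over a level; a one-point space brings it into the
  -- required form.
  have hcov := covariance_integral_indicator μ (Measure.dirac ()) posVolume hS hR
    (integrable_const (1 : ℝ)) hq
  have e1 : (fun w : ℕ × ℝ => ind j w.1) = fun w => ∫ s,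
      {s : Unit | (w, s) ∈ {z : (ℕ × ℝ) × Unit | z.1.1 = j}}.indicator (fun _ => (1 : ℝ)) s
        ∂(Measure.dirac ()) := by
    classical
    ext w
    rw [integral_dirac]
    simp [ind, Set.indicator_apply]
  have e2 : (fun w : ℕ × ℝ => cpMass θ π w.2 j') =ᵐ[μ] fun w => ∫ t,
      {t | (w, t) ∈ {z : (ℕ × ℝ) × ℝ | z.2 < z.1.2}}.indicator (cpMassDeriv θ π j') t
        ∂posVolume := by
    filter_upwards [hpos] with w hw
    exact cpMass_eq_integral θ π hj' hw
  rw [e1, covariance_congr_ae (ae_eq_refl _) e2, hcov, Measure.dirac_prod, integral_map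
    measurable_prodMk_left.aemeasurable]
  · refine integral_congr_ae ?_
    filter_upwards [ae_posVolume] with x hx
    have hA : μ.real {w : ℕ × ℝ | w.1 = j} = cpMass θ π τ j := by
      rw [measureReal_def, ← ENNReal.toReal_ofReal (h.cpMass_nonneg hτ j), ← hμj]
      congr 2
      ext w
      simp
    have hB : μ.real {w : ℕ × ℝ | w.1 = j ∧ x < w.2} = mass₁ θ π π₂ ξ τ x j 0 := by
      rw [measureReal_def, ← ENNReal.toReal_ofReal (h.mass₁_nonneg hξ hξ1 hτ hx j 0), ← hG j x hx,
        ← hμ.tail j x hx]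
      congr 2
    have hC := h.hasMixedTail_snd hξ hξ1 hτ hG hμ hx
    simp only [one_mul]
    rw [hA, hB, hC, covKernel, cpMass.eq_def θ π x, if_pos rfl]
  · have hm := measurable_measureReal_inter_sub μ hS hR
    refine AEStronglyMeasurable.mul ?_ hm.aestronglyMeasurable
    refine (aestronglyMeasurable_const (b := (1 : ℝ))).mul ?_
    rw [← Measure.dirac_prod]
    exact hq.1.comp_snd

theorem integral_covariance_of_hasMixedTail (h : HasClusterLimits P X θ π π₂) (hξ : 0 ≤ ξ)
    (hξ1 : ξ ≤ 1) {G : ℝ → ℕ → ℝ → ℝ}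
    (hG : ∀ τ j x, 0 < x → G τ j x = mass₁ θ π π₂ ξ τ x j 0) (j : ℕ) {j' : ℕ} (hj' : j' ≠ 0) :
    ∫ τ, cov[fun w : ℕ × ℝ => ind j w.1, fun w => cpMass θ π w.2 j'; lawOfMixedTail (G τ)]
      ∂(expMeasure θ) = kernelIntegral θ π π₂ ξ (expDensity θ) (cpMassDeriv θ π j') j 0 := by
  have hi := integrable_expDensity h.pos
  have hq := integrable_cpMassDeriv h.pos π hj'
  rw [kernelIntegral, integral_prod _ (h.integrable_mul_covKernel hξ hξ1 ae_posVolume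
    ae_posVolume hi hq j 0), integral_expMeasure h.pos]
  refine integral_congr_ae ?_
  filter_upwards [ae_posVolume] with τ hτ
  rw [h.covariance_of_hasMixedTail hξ hξ1 hτ (hG τ) j hj', ← integral_const_mul]
  refine integral_congr_ae (ae_of_all _ fun x => ?_)
  simp only
  ring

theorem integrable_covariance_of_hasMixedTail (h : HasClusterLimits P X θ π π₂) (hξ : 0 ≤ ξ)
    (hξ1 : ξ ≤ 1) {G : ℝ → ℕ → ℝ → ℝ}
    (hG : ∀ τ j x, 0 < x → G τ j x = mass₁ θ π π₂ ξ τ x j 0) (j : ℕ) {j' : ℕ} (hj' : j' ≠ 0) :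
    Integrable (fun τ => cov[fun w : ℕ × ℝ => ind j w.1, fun w => cpMass θ π w.2 j';
      lawOfMixedTail (G τ)]) (expMeasure θ) := by
  have := isProbabilityMeasure_expMeasure h.pos
  have hq := integrable_cpMassDeriv h.pos π hj'
  have hint := (h.integrable_mul_covKernel hξ hξ1 (ae_expMeasure h.pos)
    ae_posVolume (integrable_const (1 : ℝ)) hq j 0).integral_prod_left
  refine hint.congr ?_
  filter_upwards [ae_expMeasure h.pos] with τ hτ
  rw [h.covariance_of_hasMixedTail hξ hξ1 hτ (hG τ) j hj']
  simp only [one_mul]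

/-- Both variables enter through the events `{x < U}` and `{y < V}`, whose joint and marginal
probabilities are those of empty blocks; hence the kernel with counts `0` and `0`. -/
theorem covariance_cpMass (h : HasClusterLimits P X θ π π₂) {W : Type*} [MeasurableSpace W]
    {μ : Measure W} [IsProbabilityMeasure μ] {U V : W → ℝ} (hU : Measurable U) (hV : Measurable V)
    (hU0 : ∀ᵐ w ∂μ, 0 < U w) (hV0 : ∀ᵐ w ∂μ, 0 < V w)
    (hUx : ∀ x, 0 < x → μ.real {w | x < U w} = Real.exp (-(θ * x)))
    (hVx : ∀ x, 0 < x → μ.real {w | x < V w} = Real.exp (-(θ * x)))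
    (hUV : ∀ x y, 0 < x → 0 < y → μ.real {w | x < U w ∧ y < V w} = survival₂ θ ξ x y)
    {j j' : ℕ} (hj : j ≠ 0) (hj' : j' ≠ 0) :
    cov[fun w => cpMass θ π (U w) j, fun w => cpMass θ π (V w) j'; μ] =
      kernelIntegral θ π π₂ ξ (cpMassDeriv θ π j) (cpMassDeriv θ π j') 0 0 := by
  have hS : MeasurableSet {z : W × ℝ | z.2 < U z.1} :=
    measurableSet_lt measurable_snd (hU.comp measurable_fst)
  have hR : MeasurableSet {z : W × ℝ | z.2 < V z.1} :=
    measurableSet_lt measurable_snd (hV.comp measurable_fst)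
  have e1 : (fun w => cpMass θ π (U w) j) =ᵐ[μ] fun w => ∫ t,
      {t | (w, t) ∈ {z : W × ℝ | z.2 < U z.1}}.indicator (cpMassDeriv θ π j) t ∂posVolume := by
    filter_upwards [hU0] with w hw
    exact cpMass_eq_integral θ π hj hw
  have e2 : (fun w => cpMass θ π (V w) j') =ᵐ[μ] fun w => ∫ t,
      {t | (w, t) ∈ {z : W × ℝ | z.2 < V z.1}}.indicator (cpMassDeriv θ π j') t ∂posVolume := by
    filter_upwards [hV0] with w hw
    exact cpMass_eq_integral θ π hj' hw
  rw [covariance_congr_ae e1 e2, covariance_integral_indicator μ posVolume posVolume hS hR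
    (integrable_cpMassDeriv h.pos π hj) (integrable_cpMassDeriv h.pos π hj'), kernelIntegral]
  refine integral_congr_ae ?_
  filter_upwards [ae_prod_pos ae_posVolume ae_posVolume] with z hz
  rw [hUV _ _ hz.1 hz.2, hUx _ hz.1, hVx _ hz.2, covKernel, mass₁_zero_zero, cpMass.eq_def θ π z.1,
    cpMass.eq_def θ π z.2, if_pos rfl, if_pos rfl]

theorem covariance_lawOfSurvival (h : HasClusterLimits P X θ π π₂) (hξ : 0 < ξ) (hξ1 : ξ < 1)
    {j j' : ℕ} (hj : j ≠ 0) (hj' : j' ≠ 0) :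
    cov[fun w : ℝ × ℝ => cpMass θ π w.1 j, fun w => cpMass θ π w.2 j';
        lawOfSurvival (survival₂ θ ξ)] =
      kernelIntegral θ π π₂ ξ (cpMassDeriv θ π j) (cpMassDeriv θ π j') 0 0 := by
  obtain ⟨μ, hμ, hμ0⟩ := exists_hasSurvival h.pos hξ hξ1
  have hex : ∃ μ, HasSurvival (survival₂ θ ξ) μ := ⟨μ, hμ⟩
  have hlaw : lawOfSurvival (survival₂ θ ξ) = μ := by
    rw [lawOfSurvival, dif_pos hex]
    exact hex.choose_spec.unique hμ
  have := hμ.prob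
  rw [hlaw]
  have hpos : ∀ᵐ w ∂μ, 0 < w.1 ∧ 0 < w.2 := hμ.pos
  have hs : ∀ x y, 0 ≤ x → 0 ≤ y → μ.real (Set.Ioi x ×ˢ Set.Ioi y) = survival₂ θ ξ x y := by
    intro x y hx hy
    rw [measureReal_def, hμ0 x y hx hy, survival₂, ENNReal.toReal_ofReal (Real.exp_nonneg _)]
  refine h.covariance_cpMass measurable_fst measurable_snd (hpos.mono fun _ hw => hw.1)
    (hpos.mono fun _ hw => hw.2) (fun x hx => ?_) (fun x hx => ?_)
    (fun x y hx hy => hs x y hx.le hy.le) hj hj'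
  · have h1 := hs x 0 hx.le le_rfl
    rw [survival₂, min_eq_right hx.le, max_eq_left hx.le, zero_mul, zero_add] at h1
    rw [← h1]
    refine measureReal_congr ?_
    filter_upwards [hpos] with w hw
    exact propext ⟨fun hh => ⟨hh, hw.2⟩, fun hh => hh.1⟩
  · have h1 := hs 0 x le_rfl hx.le
    rw [survival₂, min_eq_left hx.le, max_eq_right hx.le, zero_mul, zero_add] at h1
    rw [← h1]
    refine measureReal_congr ?_
    filter_upwards [hpos] with w hw
    exact propext ⟨fun hh => ⟨hw.1, hh⟩, fun hh => hh.2⟩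

/-- With one variable in both places the joint tail depends on the larger argument only, which is
the survival function at `ξ = 0`. -/
theorem covariance_expMeasure (h : HasClusterLimits P X θ π π₂) {j j' : ℕ} (hj : j ≠ 0)
    (hj' : j' ≠ 0) :
    cov[fun z => cpMass θ π z j, fun z => cpMass θ π z j'; expMeasure θ] =
      kernelIntegral θ π π₂ 0 (cpMassDeriv θ π j) (cpMassDeriv θ π j') 0 0 := by
  have := isProbabilityMeasure_expMeasure h.pos
  have hx : ∀ x : ℝ, 0 < x → (expMeasure θ).real {w | x < w} = Real.exp (-(θ * x)) := by
    intro x hx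
    rw [measureReal_def, ← ENNReal.toReal_ofReal (Real.exp_nonneg (-(θ * x))),
      ← expMeasure_Ioi h.pos hx.le]
    rfl
  refine h.covariance_cpMass measurable_id measurable_id (ae_expMeasure h.pos)
    (ae_expMeasure h.pos) hx hx (fun x y hx' hy' => ?_) hj hj'
  rw [survival₂, mul_zero, zero_add, ← hx _ (hx'.trans_le (le_max_left x y))]
  congr 1
  ext w
  simp

theorem dSb_eq (h : HasClusterLimits P X θ π π₂) {j j' : ℕ} (hj : j ≠ 0) (hj' : j' ≠ 0) :
    dSb θ π π₂ j j' = 2 * ∫ ξ in (0 : ℝ)..1, blockCov θ π π₂ ξ j j' := by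
  rw [dSb]
  congr 1
  -- The endpoints are discarded as null sets: the Marshall–Olkin law is constructed for `0 < ξ < 1`
  -- only.
  rw [intervalIntegral.integral_of_le zero_le_one, intervalIntegral.integral_of_le zero_le_one,
    integral_Ioc_eq_integral_Ioo, integral_Ioc_eq_integral_Ioo]
  refine setIntegral_congr_fun measurableSet_Ioo fun ξ hξ => ?_
  have hG : ∀ τ j x, 0 < x → tail₃ θ π π₂ ξ τ j x = mass₁ θ π π₂ ξ τ x j 0 := fun τ j x hx =>
    h.tail₃_eq_mass₁ hξ.1.le hξ.2.le hx j
  simp only [blockCov, cov₃]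
  rw [h.integral_covariance_of_hasMixedTail hξ.1.le hξ.2.le hG j hj',
    h.integral_covariance_of_hasMixedTail hξ.1.le hξ.2.le hG j' hj,
    h.covariance_lawOfSurvival hξ.1 hξ.2 hj hj', ← h.integral_integral_covKernel hξ.1.le hξ.2.le]
  congr 3
  refine integral_congr_ae ?_
  filter_upwards [ae_expMeasure h.pos] with τ' hτ'
  refine integral_congr_ae ?_
  filter_upwards [ae_expMeasure h.pos] with τ hτ
  exact h.covariance_ind hξ.1.le hξ.2.le hτ hτ' j j'

/-- Coinciding blocks: the four covariances are those at offset `0`. The integrability facts justify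
splitting the double integral. -/
theorem dDb_eq (h : HasClusterLimits P X θ π π₂) {j j' : ℕ} (hj : j ≠ 0) (hj' : j' ≠ 0) :
    dDb θ π π₂ j j' = blockCov θ π π₂ 0 j j' := by
  have := isProbabilityMeasure_expMeasure h.pos
  have hG : ∀ τ j x, 0 < x → tailNZ θ π₂ τ j x = mass₁ θ π π₂ 0 τ x j 0 := fun τ j x hx =>
    h.tailNZ_eq_mass₁ hx j
  have hae := ae_expMeasure h.pos
  have i1 : Integrable (fun z : ℝ × ℝ => covKernel θ π π₂ 0 z.1 z.2 j j')
      ((expMeasure θ).prod (expMeasure θ)) := by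
    simpa using h.integrable_mul_covKernel le_rfl zero_le_one hae hae (integrable_const (1 : ℝ))
      (integrable_const (1 : ℝ)) j j'
  have i2 : Integrable (fun z : ℝ × ℝ => covNZ θ π π₂ z.1 j j')
      ((expMeasure θ).prod (expMeasure θ)) := (h.integrable_covariance_of_hasMixedTail le_rfl zero_le_one hG j hj').comp_fst
    (expMeasure θ)
  have i3 : Integrable (fun z : ℝ × ℝ => covNZ θ π π₂ z.2 j' j)
      ((expMeasure θ).prod (expMeasure θ)) := (h.integrable_covariance_of_hasMixedTail le_rfl zero_le_one hG j' hj).comp_snd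
    (expMeasure θ)
  set d := cov[fun z => cpMass θ π z j, fun z => cpMass θ π z j'; expMeasure θ] with hd
  have i4 : Integrable (fun _ : ℝ × ℝ => d) ((expMeasure θ).prod (expMeasure θ)) :=
    integrable_const d
  have hsum := integral_prod_symm _ (((i1.add i2).add i3).add i4)
  have hL : dDb θ π π₂ j j' = ∫ z, ((((fun z : ℝ × ℝ => covKernel θ π π₂ 0 z.1 z.2 j j') +
      fun z : ℝ × ℝ => covNZ θ π π₂ z.1 j j') + fun z : ℝ × ℝ => covNZ θ π π₂ z.2 j' j) +
      fun _ : ℝ × ℝ => d : ℝ × ℝ → ℝ) z ∂((expMeasure θ).prod (expMeasure θ)) := by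
    refine Eq.trans ?_ hsum.symm
    rw [dDb]
    refine integral_congr_ae ?_
    filter_upwards [hae] with τ' hτ'
    refine integral_congr_ae ?_
    filter_upwards [hae] with τ hτ
    have hm : massNN θ π₂ τ τ' = mass₁ θ π π₂ 0 τ τ' := by
      ext i i'
      exact h.massNN_eq_mass₁ hτ i i'
    rw [hm, h.covariance_ind le_rfl zero_le_one hτ hτ']
    rfl
  have e2 : ∫ z : ℝ × ℝ, covNZ θ π π₂ z.1 j j' ∂((expMeasure θ).prod (expMeasure θ)) =
      kernelIntegral θ π π₂ 0 (expDensity θ) (cpMassDeriv θ π j') j 0 := by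
    rw [← h.integral_covariance_of_hasMixedTail le_rfl zero_le_one hG j hj',
      integral_fun_fst fun τ => covNZ θ π π₂ τ j j', probReal_univ, one_smul]
    rfl
  have e3 : ∫ z : ℝ × ℝ, covNZ θ π π₂ z.2 j' j ∂((expMeasure θ).prod (expMeasure θ)) =
      kernelIntegral θ π π₂ 0 (expDensity θ) (cpMassDeriv θ π j) j' 0 := by
    rw [← h.integral_covariance_of_hasMixedTail le_rfl zero_le_one hG j' hj,
      integral_fun_snd fun τ => covNZ θ π π₂ τ j' j, probReal_univ, one_smul]
    rfl
  rw [hL, integral_add' ((i1.add i2).add i3) i4, integral_add' (i1.add i2) i3,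
    integral_add' i1 i2, blockCov, ← h.integral_integral_covKernel le_rfl zero_le_one,
    ← integral_prod_symm _ i1, ← h.covariance_expMeasure hj hj', e2, e3, integral_const,
    probReal_univ, one_smul]

end HasClusterLimits

/-! ### Positive semidefiniteness and the comparison -/

theorem kernelIntegral_const_mul (θ : ℝ) (π : ℕ → ℝ) (π₂ : ℝ → ℕ → ℕ → ℝ) (ξ a b : ℝ)
    (c d : ℝ → ℝ) (j j' : ℕ) :
    kernelIntegral θ π π₂ ξ (fun x => a * c x) (fun x => b * d x) j j' =
      a * b * kernelIntegral θ π π₂ ξ c d j j' := by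
  rw [kernelIntegral, kernelIntegral, ← integral_const_mul]
  refine integral_congr_ae (ae_of_all _ fun z => ?_)
  simp only
  ring

theorem blockCov_one (θ : ℝ) (π : ℕ → ℝ) (π₂ : ℝ → ℕ → ℕ → ℝ) (j j' : ℕ) :
    blockCov θ π π₂ 1 j j' = 0 := by
  simp [blockCov, kernelIntegral_one]

namespace HasClusterLimits

variable {Ω : Type*} [MeasurableSpace Ω] {P : Measure Ω} {X : ℤ → Ω → ℝ} {θ : ℝ} {π : ℕ → ℝ}
  {π₂ : ℝ → ℕ → ℕ → ℝ} {ξ : ℝ}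

/-! ### The block covariance as a function of the offset. -/

theorem blockCov_symm (h : HasClusterLimits P X θ π π₂) (hξ : 0 ≤ ξ) (hξ1 : ξ ≤ 1) (j j' : ℕ) :
    blockCov θ π π₂ ξ j j' = blockCov θ π π₂ ξ j' j := by
  rw [blockCov, blockCov, h.kernelIntegral_symm hξ hξ1 (expDensity θ) (expDensity θ) j j',
    h.kernelIntegral_symm hξ hξ1 (cpMassDeriv θ π j) (cpMassDeriv θ π j') 0 0]
  ring

theorem continuousOn_blockCov (h : HasClusterLimits P X θ π π₂) {j j' : ℕ} (hj : j ≠ 0)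
    (hj' : j' ≠ 0) : ContinuousOn (fun ξ => blockCov θ π π₂ ξ j j') (Set.Ico 0 1) := by
  have h0 := integrable_expDensity h.pos
  have h1 := integrable_cpMassDeriv h.pos π hj
  have h2 := integrable_cpMassDeriv h.pos π hj'
  exact (((h.continuousOn_kernelIntegral h0 h0 _ _).add (h.continuousOn_kernelIntegral h0 h2 _ _)).add
    (h.continuousOn_kernelIntegral h0 h1 _ _)).add (h.continuousOn_kernelIntegral h1 h2 _ _)

theorem exists_abs_blockCov_le (h : HasClusterLimits P X θ π π₂) {j j' : ℕ} (hj : j ≠ 0)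
    (hj' : j' ≠ 0) : ∃ B, ∀ ξ ∈ Set.Ico (0 : ℝ) 1, |blockCov θ π π₂ ξ j j'| ≤ B := by
  have h0 := integrable_expDensity h.pos
  have h1 := integrable_cpMassDeriv h.pos π hj
  have h2 := integrable_cpMassDeriv h.pos π hj'
  have hb : ∀ {c d : ℝ → ℝ}, Integrable c posVolume → Integrable d posVolume → ∀ i i' : ℕ,
      ∃ B, ∀ ξ ∈ Set.Ico (0 : ℝ) 1, |kernelIntegral θ π π₂ ξ c d i i'| ≤ B := fun hc hd i i' =>
    ⟨_, fun ξ hξ => h.abs_kernelIntegral_le hξ.1 hξ.2.le hc hd i i'⟩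
  obtain ⟨B₁, hB₁⟩ := hb h0 h0 j j'
  obtain ⟨B₂, hB₂⟩ := hb h0 h2 j 0
  obtain ⟨B₃, hB₃⟩ := hb h0 h1 j' 0
  obtain ⟨B₄, hB₄⟩ := hb h1 h2 0 0
  refine ⟨B₁ + B₂ + B₃ + B₄, fun ξ hξ => ?_⟩
  refine (abs_add_le _ _).trans (add_le_add ((abs_add_le _ _).trans (add_le_add
    ((abs_add_le _ _).trans (add_le_add ?_ ?_)) ?_)) ?_)
  · exact hB₁ ξ hξ
  · exact hB₂ ξ hξ
  · exact hB₃ ξ hξ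
  · exact hB₄ ξ hξ

theorem intervalIntegrable_blockCov (h : HasClusterLimits P X θ π π₂) {j j' : ℕ} (hj : j ≠ 0)
    (hj' : j' ≠ 0) : IntervalIntegrable (fun ξ => blockCov θ π π₂ ξ j j') volume 0 1 := by
  obtain ⟨B, hB⟩ := h.exists_abs_blockCov_le hj hj'
  rw [intervalIntegrable_iff_integrableOn_Ico_of_le zero_le_one]
  refine Integrable.of_bound
    ((h.continuousOn_blockCov hj hj').aestronglyMeasurable measurableSet_Ico) B ?_
  filter_upwards [ae_restrict_mem measurableSet_Ico] with ξ hξ using hB ξ hξ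

/-- The `i`-th of `N` overlapping blocks on a grid with `L` points per block. -/
def _root_.SlidingBlocks.gridBlock (N L i : ℕ) : Set ℝ :=
  Set.Ioc ((i : ℝ) / (N + L : ℝ)) ((i + L : ℝ) / (N + L : ℝ))

/-- The relative offset of two blocks at distance `k` on a grid with `L` points per block. -/
noncomputable def _root_.SlidingBlocks.gridOffset (L k : ℕ) : ℝ := min (k : ℝ) L / L

theorem _root_.SlidingBlocks.gridOffset_nonneg (L k : ℕ) : 0 ≤ gridOffset L k := by
  unfold gridOffset
  positivity

theorem _root_.SlidingBlocks.gridOffset_le_one (L k : ℕ) : gridOffset L k ≤ 1 :=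
  div_le_one_of_le₀ (min_le_right _ _) (Nat.cast_nonneg L)

/-! ### Finite-sample covariances of blocks on a grid. -/

theorem tendsto_gridBlock_single (h : HasClusterLimits P X θ π π₂) {N L i : ℕ} (hL : 0 < L)
    (hi : i < N) {τ : ℝ} (hτ : 0 < τ) (j : ℕ) :
    Tendsto (fun n : ℕ => P.real {ω |
      exceedances P X n ((N + L : ℝ) / L * τ) (gridBlock N L i) ω = j}) atTop
      (𝓝 (cpMass θ π τ j)) := by
  have hL' : (0 : ℝ) < L := by exact_mod_cast hL
  have hM : (0 : ℝ) < N + L := by positivity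
  have hi' : (i : ℝ) ≤ N := by exact_mod_cast hi.le
  have := h.tendsto_single (mul_pos (div_pos hM hL') hτ) (a := (i : ℝ) / (N + L : ℝ))
    (b := (i + L : ℝ) / (N + L : ℝ)) (by positivity) (by gcongr; linarith)
    (by rw [div_le_one hM]; linarith) j
  rwa [show ((i + L : ℝ) / (N + L : ℝ) - (i : ℝ) / (N + L : ℝ)) * ((N + L : ℝ) / L * τ) = τ by
    field_simp; ring] at this

theorem tendsto_gridBlock_pair (h : HasClusterLimits P X θ π π₂) {N L i i' : ℕ} (hL : 0 < L)
    (hi : i' < N) (hii' : i ≤ i') {τ τ' : ℝ} (hτ : 0 < τ) (hτ' : 0 < τ') (j j' : ℕ) :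
    Tendsto (fun n : ℕ => P.real {ω |
      exceedances P X n ((N + L : ℝ) / L * τ) (gridBlock N L i) ω = j ∧
      exceedances P X n ((N + L : ℝ) / L * τ') (gridBlock N L i') ω = j'}) atTop
      (𝓝 (mass₁ θ π π₂ (gridOffset L (Nat.dist i i')) τ τ' j j')) := by
  have hL' : (0 : ℝ) < L := by exact_mod_cast hL
  have hM : (0 : ℝ) < N + L := by positivity
  have hi' : (i' : ℝ) ≤ N := by exact_mod_cast hi.le
  have hk : ((Nat.dist i i' : ℕ) : ℝ) = i' - i := by
    rw [Nat.dist_eq_sub_of_le hii', Nat.cast_sub hii']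
  have hii : (i : ℝ) ≤ i' := by exact_mod_cast hii'
  -- The distance of the starting points, capped at `L`. For overlapping blocks the three intervals
  -- abut; otherwise the middle one is empty and the offset `1` encodes independence.
  set s : ℝ := min ((Nat.dist i i' : ℕ) : ℝ) L with hs
  have hs0 : 0 ≤ s := by positivity
  have hsL : s ≤ L := min_le_right _ _
  have hsk : s ≤ i' - i := hk ▸ min_le_left _ _
  have hi0 : (0 : ℝ) ≤ i := Nat.cast_nonneg i
  let l : Fin 3 → ℝ := ![i / (N + L), (i + s) / (N + L), (i' + L - s) / (N + L)]
  let u : Fin 3 → ℝ := ![(i + s) / (N + L), (i + L) / (N + L), (i' + L) / (N + L)]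
  have hlu : IsOverlap ((N + L : ℝ) / L) (gridOffset L (Nat.dist i i')) l u := by
    refine ⟨⟨fun a => ?_, fun a b hab => Set.Ioc_disjoint_Ioc.2 ?_⟩, fun a => ?_⟩
    · fin_cases a <;> refine ⟨?_, ?_, ?_⟩ <;>
        simp only [l, u, Fin.zero_eta, Fin.mk_one, Fin.reduceFinMk, Matrix.cons_val_zero,
          Matrix.cons_val_one, Matrix.cons_val] <;>
        first
          | (rw [div_le_one hM]; linarith)
          | (rw [div_le_div_iff_of_pos_right hM]; linarith)
          | (refine div_nonneg ?_ hM.le; linarith)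
    · have e1 : (i + s) / (N + L : ℝ) ≤ (i + L) / (N + L) := by gcongr
      have e2 : (i + L) / (N + L : ℝ) ≤ (i' + L - s) / (N + L) := by gcongr; linarith
      fin_cases a <;> fin_cases b <;>
        simp only [l, u, Fin.zero_eta, Fin.mk_one, Fin.reduceFinMk, Matrix.cons_val_zero,
          Matrix.cons_val_one, Matrix.cons_val] <;> grind
    · fin_cases a <;>
        simp only [l, u, Fin.zero_eta, Fin.mk_one, Fin.reduceFinMk, Matrix.cons_val_zero,
          Matrix.cons_val_one, Matrix.cons_val, gridOffset, ← hs] <;> field_simp <;> ring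
  refine (h.tendsto_mass₁ (gridOffset_nonneg _ _) (gridOffset_le_one _ _) hτ hτ'
    (div_pos hM hL') hlu j j').congr fun n => ?_
  have e1 : ∀ t ω, exceedances P X n t (Set.Ioc (l 0) (u 0)) ω +
      exceedances P X n t (Set.Ioc (l 1) (u 1)) ω = exceedances P X n t (gridBlock N L i) ω := by
    intro t ω
    refine exceedances_add_of_le n t ?_ ?_ ω
    · exact div_le_div_of_nonneg_right (by linarith) hM.le
    · exact div_le_div_of_nonneg_right (by linarith) hM.le
  have e2 : ∀ t ω, exceedances P X n t (Set.Ioc (l 1) (u 1)) ω +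
      exceedances P X n t (Set.Ioc (l 2) (u 2)) ω = exceedances P X n t (gridBlock N L i') ω := by
    intro t ω
    simp only [l, u, Matrix.cons_val_one, Matrix.cons_val, gridBlock]
    rcases le_total ((i' : ℝ) - i) L with hc | hc
    · have hs' : s = i' - i := by rw [hs, hk, min_eq_left hc]
      rw [show (i + s : ℝ) = i' by linarith, show (i' + L - s : ℝ) = i + L by linarith]
      refine exceedances_add_of_le n t ?_ ?_ ω
      · exact div_le_div_of_nonneg_right (by linarith) hM.le
      · exact div_le_div_of_nonneg_right (by linarith) hM.le
    · have hs' : s = L := by rw [hs, hk, min_eq_right hc]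
      rw [hs', add_sub_cancel_right, Set.Ioc_self]
      simp [exceedances]
  congr 1
  ext ω
  rw [Set.mem_ofPred_eq, Set.mem_ofPred_eq, e1, e2]

theorem tendsto_gridBlock (h : HasClusterLimits P X θ π π₂) {N L i i' : ℕ} (hL : 0 < L)
    (hi : i < N) (hi' : i' < N) {τ τ' : ℝ} (hτ : 0 < τ) (hτ' : 0 < τ') (j j' : ℕ) :
    Tendsto (fun n : ℕ => P.real {ω |
      exceedances P X n ((N + L : ℝ) / L * τ) (gridBlock N L i) ω = j ∧
      exceedances P X n ((N + L : ℝ) / L * τ') (gridBlock N L i') ω = j'} -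
      P.real {ω | exceedances P X n ((N + L : ℝ) / L * τ) (gridBlock N L i) ω = j} *
      P.real {ω | exceedances P X n ((N + L : ℝ) / L * τ') (gridBlock N L i') ω = j'}) atTop
      (𝓝 (covKernel θ π π₂ (gridOffset L (Nat.dist i i')) τ τ' j j')) := by
  refine Tendsto.sub ?_ ((h.tendsto_gridBlock_single hL hi hτ j).mul
    (h.tendsto_gridBlock_single hL hi' hτ' j'))
  rcases le_total i i' with hii | hii
  · exact h.tendsto_gridBlock_pair hL hi' hii hτ hτ' j j'
  · rw [h.mass₁_symm (gridOffset_nonneg _ _) (gridOffset_le_one _ _) hτ, Nat.dist_comm]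
    refine (h.tendsto_gridBlock_pair hL hi hii hτ' hτ j' j).congr fun n => ?_
    congr 1
    ext ω
    exact and_comm

/-- An expanded variance indexed by block, cluster size and a Boolean. The Boolean selects the term
of the block statistic: exponential weight with count `j + 1`, or derivative weight with count `0`.
Its four combinations give the four terms of `blockCov`. -/
theorem sum_blockCov_nonneg (h : HasClusterLimits P X θ π π₂) {L : ℕ} (hL : 0 < L) {m : ℕ}
    (a : Fin m → ℝ) (N : ℕ) (w : ℕ → ℝ) :
    0 ≤ ∑ i ∈ Finset.range N, ∑ i' ∈ Finset.range N, w i * w i' *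
      ∑ j : Fin m, ∑ j' : Fin m,
        a j * a j' * blockCov θ π π₂ (gridOffset L (Nat.dist i i')) (j + 1) (j' + 1) := by
  have := h.prob
  let c : Fin N × Fin m × Bool → ℝ → ℝ := fun α x => w α.1 * a α.2.1 *
    (if α.2.2 then cpMassDeriv θ π (α.2.1 + 1) x else expDensity θ x)
  let e : Fin N × Fin m × Bool → ℕ := fun α => if α.2.2 then 0 else α.2.1 + 1
  have hc : ∀ α, Integrable (c α) posVolume := by
    rintro ⟨i, j, b⟩
    refine Integrable.const_mul ?_ _
    cases b
    · exact integrable_expDensity h.pos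
    · exact integrable_cpMassDeriv h.pos π (Nat.succ_ne_zero j)
  have key := sum_integral_kernel_nonneg P posVolume
    (S := fun n (α : Fin N × Fin m × Bool) =>
      {z : Ω × ℝ | exceedances P X n ((N + L : ℝ) / L * z.2) (gridBlock N L α.1) z.1 = e α})
    (fun n α => measurableSet_exceedances_eq h.measurable n _ _ _) hc
    (fun α β τ τ' => covKernel θ π π₂ (gridOffset L (Nat.dist α.1 β.1)) τ τ' (e α) (e β))
    (fun α β => by
      filter_upwards [ae_prod_pos ae_posVolume ae_posVolume] with z hz
      exact h.tendsto_gridBlock hL α.1.2 β.1.2 hz.1 hz.2 (e α) (e β))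
  refine key.trans_eq ?_
  rw [Finset.sum_range, Fintype.sum_prod_type]
  refine Finset.sum_congr rfl fun i _ => ?_
  rw [Finset.sum_range]
  simp_rw [Fintype.sum_prod_type, Finset.mul_sum]
  rw [Finset.sum_congr rfl fun j _ => Finset.sum_comm, Finset.sum_comm]
  refine Finset.sum_congr rfl fun i' _ => Finset.sum_congr rfl fun j _ => ?_
  rw [Finset.sum_comm]
  refine Finset.sum_congr rfl fun j' _ => ?_
  rw [Fintype.sum_bool, Fintype.sum_bool, Fintype.sum_bool]
  have e1 : ∀ b b' : Bool, ∫ z, c (i, j, b) z.1 * c (i', j', b') z.2 *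
      covKernel θ π π₂ (gridOffset L (Nat.dist i i')) z.1 z.2 (e (i, j, b)) (e (i', j', b'))
        ∂(posVolume.prod posVolume) = w i * a j * (w i' * a j') *
      kernelIntegral θ π π₂ (gridOffset L (Nat.dist i i'))
        (fun x => if b then cpMassDeriv θ π (j + 1) x else expDensity θ x)
        (fun x => if b' then cpMassDeriv θ π (j' + 1) x else expDensity θ x)
        (e (i, j, b)) (e (i', j', b')) := by
    intro b b'
    rw [← kernelIntegral_const_mul]
    rfl
  rw [e1, e1, e1, e1, blockCov]
  simp only [e, if_true, Bool.false_eq_true, if_false]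
  rw [h.kernelIntegral_symm (gridOffset_nonneg _ _) (gridOffset_le_one _ _)
    (fun x => cpMassDeriv θ π (j + 1) x)  (fun x => expDensity θ x)]
  ring

/-- For every vector `a`, the sliding-blocks quadratic form is nonnegative and at most the
disjoint-blocks one. -/
theorem quadraticForm_compare (h : HasClusterLimits P X θ π π₂) {m : ℕ} (a : Fin m → ℝ) :
    0 ≤ ∑ j : Fin m, ∑ j' : Fin m, a j * a j' * dSb θ π π₂ (j + 1) (j' + 1) ∧
    ∑ j : Fin m, ∑ j' : Fin m, a j * a j' * dSb θ π π₂ (j + 1) (j' + 1) ≤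
      ∑ j : Fin m, ∑ j' : Fin m, a j * a j' * dDb θ π π₂ (j + 1) (j' + 1) := by
  let f : ℝ → ℝ := fun ξ =>
    ∑ j : Fin m, ∑ j' : Fin m, a j * a j' * blockCov θ π π₂ ξ (j + 1) (j' + 1)
  have hne : ∀ j : Fin m, (j : ℕ) + 1 ≠ 0 := fun j => Nat.succ_ne_zero j
  have hfc : ContinuousOn f (Set.Ico 0 1) :=
    continuousOn_finsetSum _ fun j _ => continuousOn_finsetSum _ fun j' _ =>
      continuousOn_const.mul (h.continuousOn_blockCov (hne j) (hne j'))
  choose B hB using fun j j' : Fin m => h.exists_abs_blockCov_le (hne j) (hne j')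
  have hfB : ∀ ξ ∈ Set.Ico (0 : ℝ) 1, |f ξ| ≤ ∑ j : Fin m, ∑ j' : Fin m, |a j * a j'| * B j j' := by
    intro ξ hξ
    refine (Finset.abs_sum_le_sum_abs _ _).trans (Finset.sum_le_sum fun j _ => ?_)
    refine (Finset.abs_sum_le_sum_abs _ _).trans (Finset.sum_le_sum fun j' _ => ?_)
    rw [abs_mul]
    exact mul_le_mul_of_nonneg_left (hB j j' ξ hξ) (abs_nonneg _)
  have hsb : ∑ j : Fin m, ∑ j' : Fin m, a j * a j' * dSb θ π π₂ (j + 1) (j' + 1) =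
      2 * ∫ ξ in (0 : ℝ)..1, f ξ := by
    have hint := fun j j' : Fin m =>
      (h.intervalIntegrable_blockCov (hne j) (hne j')).const_mul (a j * a j')
    rw [intervalIntegral.integral_finsetSum fun j _ =>
      by
      simpa only [Finset.sum_fn] using IntervalIntegrable.sum Finset.univ fun j' _ => hint j j',
      Finset.mul_sum]
    refine Finset.sum_congr rfl fun j _ => ?_
    rw [intervalIntegral.integral_finsetSum fun j' _ => hint j j', Finset.mul_sum]
    refine Finset.sum_congr rfl fun j' _ => ?_
    rw [intervalIntegral.integral_const_mul, h.dSb_eq (hne j) (hne j')]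
    ring
  have hdb : ∑ j : Fin m, ∑ j' : Fin m, a j * a j' * dDb θ π π₂ (j + 1) (j' + 1) = f 0 :=
    Finset.sum_congr rfl fun j _ => Finset.sum_congr rfl fun j' _ => by
      rw [h.dDb_eq (hne j) (hne j')]
  -- The correction `f 0 / L` stems from `k = 0`, which occurs only once in the sum over `|k| < L`;
  -- it vanishes in the limit.
  have hlim : Tendsto (fun L : ℕ => 2 * ((L : ℝ)⁻¹ * ∑ k ∈ Finset.range L, f (k / L)) -
      (L : ℝ)⁻¹ * f 0) atTop (𝓝 (2 * ∫ ξ in (0 : ℝ)..1, f ξ)) := by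
    have h1 := ((tendsto_riemann_sum f _ hfc hfB).const_mul 2).sub
      ((tendsto_inv_atTop_nhds_zero_nat (𝕜 := ℝ)).mul_const (f 0))
    rwa [zero_mul, sub_zero] at h1
  have hgrid : ∀ L : ℕ, 0 < L → 0 ≤ 2 * ∑ k ∈ Finset.range L, f (k / L) - f 0 ∧
      2 * ∑ k ∈ Finset.range L, f (k / L) - f 0 ≤ L * f 0 := by
    intro L hL
    have hL' : (L : ℝ) ≠ 0 := by positivity
    have h1 := sum_nonneg_and_le_of_posSemidef (fun k => f (gridOffset L k)) L hL
      -- Distances of at least `L` are capped to offset `1`, where the covariance vanishes: this is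
      -- the finite range.
      (fun k hk => by
        have hk' : (L : ℝ) ≤ k := by exact_mod_cast hk
        have : gridOffset L k = 1 := by rw [gridOffset, min_eq_right hk', div_self hL']
        simp only [this, f, blockCov_one, mul_zero, Finset.sum_const_zero])
      (fun N w => h.sum_blockCov_nonneg hL a N w)
    have h2 : gridOffset L 0 = 0 := by simp [gridOffset]
    have h3 : ∑ k ∈ Finset.range L, f (gridOffset L k) = ∑ k ∈ Finset.range L, f (k / L) := by
      refine Finset.sum_congr rfl fun k hk => ?_
      have hk' : (k : ℝ) ≤ L := by exact_mod_cast (Finset.mem_range.1 hk).le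
      rw [gridOffset, min_eq_left hk']
    rwa [h2, h3] at h1
  rw [hsb, hdb]
  constructor
  · refine ge_of_tendsto hlim ?_
    filter_upwards [eventually_gt_atTop 0] with L hL
    have hL' : (0 : ℝ) < L := by exact_mod_cast hL
    rw [show 2 * ((L : ℝ)⁻¹ * ∑ k ∈ Finset.range L, f (k / L)) - (L : ℝ)⁻¹ * f 0 =
      (L : ℝ)⁻¹ * (2 * ∑ k ∈ Finset.range L, f (k / L) - f 0) by ring]
    exact mul_nonneg (by positivity) (hgrid L hL).1
  · refine le_of_tendsto hlim ?_
    filter_upwards [eventually_gt_atTop 0] with L hL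
    have hL' : (0 : ℝ) < L := by exact_mod_cast hL
    rw [show 2 * ((L : ℝ)⁻¹ * ∑ k ∈ Finset.range L, f (k / L)) - (L : ℝ)⁻¹ * f 0 =
      (L : ℝ)⁻¹ * (2 * ∑ k ∈ Finset.range L, f (k / L) - f 0) by ring, inv_mul_le_iff₀ hL']
    exact (hgrid L hL).2

/-! ### Passage from quadratic forms to matrices. -/

theorem SigmaSb_isSymm (h : HasClusterLimits P X θ π π₂) (m : ℕ) : (SigmaSb θ π π₂ m).IsSymm := by
  ext i j
  simp only [SigmaSb, Matrix.transpose_apply, Matrix.of_apply]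
  rw [h.dSb_eq (Nat.succ_ne_zero _) (Nat.succ_ne_zero _),
    h.dSb_eq (Nat.succ_ne_zero _) (Nat.succ_ne_zero _)]
  congr 1
  refine intervalIntegral.integral_congr fun ξ hξ => ?_
  rw [Set.uIcc_of_le zero_le_one] at hξ
  exact h.blockCov_symm hξ.1 hξ.2 _ _

theorem SigmaDb_isSymm (h : HasClusterLimits P X θ π π₂) (m : ℕ) : (SigmaDb θ π π₂ m).IsSymm := by
  ext i j
  simp only [SigmaDb, Matrix.transpose_apply, Matrix.of_apply]
  rw [h.dDb_eq (Nat.succ_ne_zero _) (Nat.succ_ne_zero _),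
    h.dDb_eq (Nat.succ_ne_zero _) (Nat.succ_ne_zero _), h.blockCov_symm le_rfl zero_le_one]

theorem _root_.SlidingBlocks.posSemidef_of_sum_nonneg {m : ℕ} {M : Matrix (Fin m) (Fin m) ℝ}
    (hM : M.IsSymm) (hpos : ∀ a : Fin m → ℝ, 0 ≤ ∑ i, ∑ j, a i * a j * M i j) : M.PosSemidef := by
  refine Matrix.PosSemidef.of_dotProduct_mulVec_nonneg ?_ fun a => (hpos a).trans_eq ?_
  · rw [Matrix.IsHermitian, Matrix.conjTranspose_eq_transpose_of_trivial]
    exact hM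
  · simp only [dotProduct, Matrix.mulVec, star_trivial, Finset.mul_sum]
    exact Finset.sum_congr rfl fun i _ => Finset.sum_congr rfl fun j _ => by ring

theorem posSemidef_SigmaSb (h : HasClusterLimits P X θ π π₂) (m : ℕ) :
    (SigmaSb θ π π₂ m).PosSemidef :=
  posSemidef_of_sum_nonneg (h.SigmaSb_isSymm m) fun a => (h.quadraticForm_compare a).1

theorem posSemidef_SigmaDb (h : HasClusterLimits P X θ π π₂) (m : ℕ) :
    (SigmaDb θ π π₂ m).PosSemidef :=
  posSemidef_of_sum_nonneg (h.SigmaDb_isSymm m) fun a =>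
    (h.quadraticForm_compare a).1.trans (h.quadraticForm_compare a).2

theorem posSemidef_sub (h : HasClusterLimits P X θ π π₂) (m : ℕ) :
    (SigmaDb θ π π₂ m - SigmaSb θ π π₂ m).PosSemidef := by
  refine posSemidef_of_sum_nonneg ((h.SigmaDb_isSymm m).sub (h.SigmaSb_isSymm m)) fun a => ?_
  refine (sub_nonneg.2 (h.quadraticForm_compare a).2).trans_eq ?_
  simp_rw [← Finset.sum_sub_distrib]
  refine Finset.sum_congr rfl fun i _ => Finset.sum_congr rfl fun j _ => ?_
  rw [Matrix.sub_apply, mul_sub]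
  rfl

end HasClusterLimits

theorem isSymm_mul_mul_transpose {m : ℕ} {M : Matrix (Fin m) (Fin m) ℝ} (hM : M.IsSymm)
    (A : Matrix (Fin m) (Fin m) ℝ) : (A * M * Aᵀ).IsSymm := by
  rw [Matrix.IsSymm, Matrix.transpose_mul, Matrix.transpose_mul, Matrix.transpose_transpose,
    hM.eq, Matrix.mul_assoc]

theorem posSemidef_mul_mul_transpose {m : ℕ} {M : Matrix (Fin m) (Fin m) ℝ} (hM : M.PosSemidef)
    (A : Matrix (Fin m) (Fin m) ℝ) : (A * M * Aᵀ).PosSemidef := by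
  rw [← Matrix.conjTranspose_eq_transpose_of_trivial]
  exact hM.mul_mul_conjTranspose_same A

theorem variance_le_of_posSemidef_sub {m : ℕ} {M M' : Matrix (Fin m) (Fin m) ℝ}
    (hM : M.PosSemidef) (hM' : M'.PosSemidef) (hsub : (M' - M).PosSemidef) (j : Fin m) :
    Var[fun s => s j; multivariateGaussian 0 M] ≤ Var[fun s => s j; multivariateGaussian 0 M'] := by
  rw [variance_eval_multivariateGaussian hM, variance_eval_multivariateGaussian hM']
  exact sub_nonneg.1 (hsub.diag_nonneg (i := j))

end SlidingBlocks

open SlidingBlocks in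
theorem theorem4 {Ω : Type*} [MeasurableSpace Ω] (P : Measure Ω) [IsProbabilityMeasure P]
    (X : ℤ → Ω → ℝ) (hX : ∀ t, Measurable (X t)) (hstat : IsStationary P X)
    (hF : Continuous (margCDF P X)) (b : ℕ → ℕ) (θ : ℝ) (π : ℕ → ℝ) (π₂ : ℝ → ℕ → ℕ → ℝ)
    (hreg : RegularityConditions P X b θ π π₂) :
    (∀ m : ℕ,
      (SigmaSb θ π π₂ m).PosSemidef ∧ (SigmaDb θ π π₂ m).PosSemidef ∧
      LoewnerLE (SigmaSb θ π π₂ m) (SigmaDb θ π π₂ m) ∧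
      LoewnerLE (GammaSb θ π π₂ m) (GammaDb θ π π₂ m)) ∧
    (∀ (m : ℕ) (j : Fin m),
      Var[fun s => s j; multivariateGaussian 0 (SigmaSb θ π π₂ m)]
        ≤ Var[fun s => s j; multivariateGaussian 0 (SigmaDb θ π π₂ m)] ∧
      Var[fun v => v j; multivariateGaussian 0 (GammaSb θ π π₂ m)]
        ≤ Var[fun v => v j; multivariateGaussian 0 (GammaDb θ π π₂ m)]) := by
  have h : HasClusterLimits P X θ π π₂ :=
    ⟨inferInstance, hX, hreg.extremalIndex.1, hreg.clusterMass₂, hreg.oneLevel, hreg.twoLevel⟩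
  have hΓ : ∀ m, (GammaDb θ π π₂ m - GammaSb θ π π₂ m).PosSemidef := by
    intro m
    -- The same `A_m` occurs in both matrices, so the difference is a congruence of the difference
    -- of the `Σ` matrices.
    rw [GammaDb, GammaSb, ← Matrix.sub_mul, ← Matrix.mul_sub]
    exact posSemidef_mul_mul_transpose (h.posSemidef_sub m) _
  refine ⟨fun m => ⟨h.posSemidef_SigmaSb m, h.posSemidef_SigmaDb m,
    ⟨h.SigmaSb_isSymm m, h.SigmaDb_isSymm m, h.posSemidef_sub m⟩,
    ⟨isSymm_mul_mul_transpose (h.SigmaSb_isSymm m) _,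
      isSymm_mul_mul_transpose (h.SigmaDb_isSymm m) _, hΓ m⟩⟩, fun m j => ⟨?_, ?_⟩⟩
  · exact variance_le_of_posSemidef_sub (h.posSemidef_SigmaSb m) (h.posSemidef_SigmaDb m)
      (h.posSemidef_sub m) j
  · exact variance_le_of_posSemidef_sub (posSemidef_mul_mul_transpose (h.posSemidef_SigmaSb m) _)
      (posSemidef_mul_mul_transpose (h.posSemidef_SigmaDb m) _) (hΓ m) j
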